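/- **Setup.** For integers $d,n\ge1$, let $\zeta=e^{2\pi i/d}$, and let $k^{(s)}$ ($1\le k\le n$, $s\in\mathbb Z/d$) be the column vector in $\mathbb C^n$ whose $k$-th entry is $\zeta^s$ and whose other entries are $0$. Let $G(d,d,n)$ be the group of monomial $n\times n$ matrices whose nonzero entries are $d$-th roots of unity with product $1$; it permutes the vectors $k^{(s)}$. Its reflections are its elements whose fixed space has codimension $1$. Let $\ell_T(w)$ be the least number of reflections with product $w$, and let $u\le_T v$ mean $\ell_T(v)=\ell_T(u)+\ell_T(u^{-1}v)$. For an element $c$, the poset of all $u$ with $1\le_T u\le_T c$, ordered by $\le_T$, is denoted - $NC(G(d,d,n))$ if $d,n\ge 2$ and $c=\gamma$ is the Coxeter element with $\gamma(k^{(s)})=(k+1)^{(s)}$ for $1\le k\le n-2$, $\gamma((n-1)^{(s)})=1^{(s+1)}$ and $\gamma(n^{(s)})=n^{(s-1)}$; - $NC(G(1,1,m))$ if the group is $G(1,1,m)\cong\mathfrak S_m$, $m\ge1$, and $c=(1\,2\,\cdots\,m)$. Let now $d\ge2$ and $n\ge3$. For $a\ne b$ let $((a^{(0)}\,b^{(s)}))$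 be the element with $a^{(r)}\mapsto b^{(r+s)}$ and $b^{(r)}\mapsto a^{(r-s)}$ that fixes all other $k^{(r)}$. Define $$R_i^{(s)}=\{u\in NC(G(d,d,n)) : u(1^{(0)})=i^{(s)}\},$$ $$E_1=\{((1^{(0)}\,n^{(d-2)}))\,x : x\in R_1^{(1)}\},\qquad E_2=\{((2^{(0)}\,n^{(0)}))\,x : x\in R_2^{(d-1)}\},$$ $$D_1=R_1^{(1)}\cup E_1,\qquad D_2=R_2^{(d-1)}\cup E_2,\qquad D=R_n^{(d-1)}\setminus(E_1\cup E_2),$$ and, for $3\le i\le n-1$, $D^{(i)}=\{u\in R_n^{(d-1)} : u(n^{(0)})=i^{(0)}\}$. A *decomposition* of a poset $P$ is a partition of $P$ into parts (empty members of a family are disregarded) such that the subposet induced by each part is connected, i.e. is not a disjoint union of two nonempty subposets without comparabilities between them, and each of its cover relations is a cover relation of $P$. A decomposition of a graded poset $P$ of rank $N$ is *symmetric* if for each part there is a bijection $p\mapsto q$ from its minimal to its maximal elements with $\mathrm{rk}(p)+\mathrm{rk}(q)=N$. **Theorem.** Let $d\ge2$ and $n\ge3$. The poset $NC(G(d,d,n))$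 is graded of rank $n$, the sets $E_1$ and $E_2$ are subsets of $R_n^{(d-1)}$, and $$NC(G(d,d,n))=\bigl(R_1^{(0)}\uplus R_2^{(0)}\bigr)\uplus\biguplus_{i=3}^{n-1}\bigl(R_i^{(0)}\uplus R_i^{(d-1)}\bigr)\uplus\biguplus_{s=0}^{d-2}R_n^{(s)}\uplus D_1\uplus D_2\uplus D$$ is a symmetric decomposition, with parts $R_1^{(0)}\uplus R_2^{(0)}$, the $R_i^{(0)}$ and $R_i^{(d-1)}$ ($3\le i\le n-1$), the $R_n^{(s)}$ ($0\le s\le d-2$), $D_1$, $D_2$ and $D$. Moreover $D=\biguplus_{i=3}^{n-1}D^{(i)}$, and replacing the part $D$ by the parts $D^{(3)},\dots,D^{(n-1)}$ again gives a symmetric decomposition. As induced subposets, the parts satisfy, with $\mathbf 2$ the two-element chain, - $R_1^{(0)}\uplus R_2^{(0)}\cong\mathbf 2\times NC(G(d,d,n-1))$; - $R_i^{(0)}\cong NC(G(d,d,n-i+1))\times NC(G(1,1,i-2))$ for $3\le i\le n-1$; - $R_i^{(d-1)}\cong NC(G(1,1,n-i))\times NC(G(d,d,i-1))$ for $3\le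 i\le n-1$; - $R_n^{(s)}\cong NC(G(1,1,n-1))$ for $0\le s\le d-1$ (of which $s\le d-2$ are parts); - $D_1\cong D_2\cong\mathbf 2\times NC(G(1,1,n-2))$; - $D^{(i)}\cong NC(G(1,1,i-2))\times NC(G(1,1,n-i))$ for $3\le i\le n-1$. -/

import Mathlib

namespace GddNC

/-! ### Posets and symmetric decompositions -/

section Posets

/-- A graded poset of rank `N`: the order is antisymmetric, and every maximal chain has length `N`,
that is, has exactly `N + 1` elements. -/
def IsGradedOfRank (α : Type*) [Preorder α] (N : ℕ) : Prop :=
  (∀ a b : α, a ≤ b → b ≤ a → a = b) ∧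
    ∀ c : Set α, IsMaxChain (· ≤ ·) c → c.encard = (N + 1 : ℕ)

/-- The subposet induced by `D` is connected: it is not the disjoint union of two nonempty subposets
(no element of the one being comparable to an element of the other). -/
def IsConnectedPart {α : Type*} [Preorder α] (D : Set α) : Prop :=
  ∀ X : Set α, X ⊆ D → X.Nonempty → (D \ X).Nonempty →
    ∃ x ∈ X, ∃ y ∈ D \ X, x ≤ y ∨ y ≤ x

/-- The family `A` is a decomposition of the poset `α`: the members of `A` are pairwise disjoint and
cover `α`, each of them induces a connected subposet, and each cover relation of such a subposet is a
cover relation of `α`.  (Empty members, which contribute no part, are allowed.) -/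
structure IsDecomposition {α : Type*} [Preorder α] {ι : Type*} (A : ι → Set α) : Prop where
  disjoint : Pairwise fun i j => Disjoint (A i) (A j)
  cover : ⋃ i, A i = Set.univ
  connected : ∀ i, IsConnectedPart (A i)
  covBy : ∀ i, ∀ p q : A i, p ⋖ q → (p : α) ⋖ (q : α)

/-- The family `A` is a symmetric decomposition of the graded poset `α` of rank `N`: for every part
there is a bijection from its minimal to its maximal elements such that the ranks of corresponding
elements add up to `N`.  In a graded poset, the rank of `p` is `Order.height p`. -/
structure IsSymmetricDecomposition {α : Type*} [Preorder α] (N : ℕ) {ι : Type*}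
    (A : ι → Set α) : Prop extends IsDecomposition A where
  graded : IsGradedOfRank α N
  symmetric : ∀ i, ∃ φ : {p : α // Minimal (· ∈ A i) p} ≃ {q : α // Maximal (· ∈ A i) q},
    ∀ p, Order.height p.1 + Order.height (φ p).1 = N

end Posets

/-! ### The absolute order and noncrossing partitions -/

section AbsoluteOrder

variable {W : Type*} [Group W]

/-- The absolute length of `w` with respect to `T`: the least number of factors in an expression of
`w` as a product of elements of `T` (and `⊤` if there is none). -/
noncomputable def absLength (T : Set W) (w : W) : ℕ∞ :=
  ⨅ (l : List W) (_ : (∀ t ∈ l, t ∈ T) ∧ l.prod = w), (l.length : ℕ∞)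

/-- The absolute order: `u ≤_T v` if and only if `ℓ_T(v) = ℓ_T(u) + ℓ_T(u⁻¹ v)`. -/
def AbsLE (T : Set W) (u v : W) : Prop :=
  absLength T v = absLength T u + absLength T (u⁻¹ * v)

theorem absLength_one (T : Set W) : absLength T 1 = 0 := by
  refine le_antisymm ?_ bot_le
  exact iInf₂_le_of_le [] ⟨by simp, by simp⟩ (by simp)

theorem absLength_mul_le (T : Set W) (u v : W) :
    absLength T (u * v) ≤ absLength T u + absLength T v := by
  unfold absLength
  rw [ENat.iInf_add]
  refine le_iInf fun l => ?_
  rw [ENat.iInf_add]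
  refine le_iInf fun hl => ?_
  rw [ENat.add_iInf]
  refine le_iInf fun m => ?_
  rw [ENat.add_iInf]
  refine le_iInf fun hm => ?_
  refine iInf₂_le_of_le (l ++ m) ⟨?_, by simp [hl.2, hm.2]⟩ (by simp)
  intro t ht
  rcases List.mem_append.1 ht with h | h
  · exact hl.1 t h
  · exact hm.1 t h

theorem AbsLE.refl (T : Set W) (u : W) : AbsLE T u u := by
  simp [AbsLE, absLength_one]

theorem AbsLE.trans {T : Set W} {u v w : W} (h₁ : AbsLE T u v) (h₂ : AbsLE T v w) :
    AbsLE T u w := by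
  unfold AbsLE at *
  refine le_antisymm ?_ ?_
  · simpa using absLength_mul_le T u (u⁻¹ * w)
  · have h := absLength_mul_le T (u⁻¹ * v) (v⁻¹ * w)
    rw [h₂, h₁, add_assoc]
    have e : u⁻¹ * v * (v⁻¹ * w) = u⁻¹ * w := by group
    rw [e] at h
    gcongr

/-- The noncrossing partitions of `W` (with set of reflections `T`) with respect to `c`, that is, the
elements `u` of `W` such that `1 ≤_T u ≤_T c`. -/
def NC (T : Set W) (c : W) : Type _ := {u : W // AbsLE T 1 u ∧ AbsLE T u c}

/-- `NC T c` is ordered by the absolute order. -/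
instance (T : Set W) (c : W) : Preorder (NC T c) where
  le u v := AbsLE T u.1 v.1
  le_refl u := AbsLE.refl T u.1
  le_trans _ _ _ h₁ h₂ := h₁.trans h₂

end AbsoluteOrder

/-! ### The groups `G(d,d,n)` -/

/-- The permutation `k^(s) ↦ π(k)^(s + t k)` of the set of `n` integers with `d` colours.  The pair
`(k, s) : Fin n × ZMod d` stands for the `(k+1)`-st integer with colour `s`, that is, for the column
vector with `(k+1)`-st entry `ζ ^ s` and other entries zero, where `ζ = exp (2πi/d)`. -/
def monomialPerm {d n : ℕ} (π : Equiv.Perm (Fin n)) (t : Fin n → ZMod d) :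
    Equiv.Perm (Fin n × ZMod d) where
  toFun x := (π x.1, x.2 + t x.1)
  invFun x := (π.symm x.1, x.2 - t (π.symm x.1))
  left_inv x := by simp
  right_inv x := by simp

/-- The group `G(d,d,n)` of monomial `n × n` matrices whose nonzero entries are `d`-th roots of unity
with product `1`, viewed as a group of permutations of the `n` integers with `d` colours (for
`d ≥ 1`). -/
def G (d n : ℕ) : Subgroup (Equiv.Perm (Fin n × ZMod d)) where
  carrier := {w | ∃ (π : Equiv.Perm (Fin n)) (t : Fin n → ZMod d),
    ∑ k, t k = 0 ∧ w = monomialPerm π t}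
  one_mem' := ⟨1, 0, by simp, by ext x <;> simp [monomialPerm]⟩
  mul_mem' := by
    rintro _ _ ⟨π, t, ht, rfl⟩ ⟨ρ, r, hr, rfl⟩
    refine ⟨π * ρ, fun k => r k + t (ρ k), ?_, ?_⟩
    · rw [Finset.sum_add_distrib, hr, Equiv.sum_comp ρ t, ht, add_zero]
    · ext x <;> simp [monomialPerm, add_assoc]
  inv_mem' := by
    rintro _ ⟨π, t, ht, rfl⟩
    refine ⟨π⁻¹, fun k => - t (π.symm k), ?_, ?_⟩
    · rw [Finset.sum_neg_distrib, Equiv.sum_comp π.symm t, ht, neg_zero]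
    · ext x <;> simp [monomialPerm, Equiv.Perm.inv_def, sub_eq_add_neg]

/-- The element `k^(s) ↦ π(k)^(s + t k)` of `G(d,d,n)`. -/
def G.mk {d n : ℕ} (π : Equiv.Perm (Fin n)) (t : Fin n → ZMod d) (ht : ∑ k, t k = 0) : G d n :=
  ⟨monomialPerm π t, π, t, ht, rfl⟩

/-- The monomial matrix of `w`: its column `k` is the column vector represented by `w (k^(0))`. -/
noncomputable def toMatrix {d n : ℕ} (w : G d n) : Matrix (Fin n) (Fin n) ℂ :=
  Matrix.of fun i k =>
    if i = (w.1 (k, 0)).1 then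
      Complex.exp (2 * Real.pi * Complex.I / d) ^ (w.1 (k, 0)).2.val
    else 0

/-- The space of vectors in `ℂⁿ` that are fixed by `w`. -/
noncomputable def fixedSpace {d n : ℕ} (w : G d n) : Submodule ℂ (Fin n → ℂ) :=
  LinearMap.eqLocus (toMatrix w).mulVecLin LinearMap.id

/-- The reflections of `G(d,d,n)`: the elements whose fixed space has codimension `1`.  (All elements
are unitary and, for `d ≥ 1`, of finite order.) -/
def reflections (d n : ℕ) : Set (G d n) :=
  {w | Module.finrank ℂ (fixedSpace w) + 1 = n}

/-- The Coxeter element `γ = [1^(0) 2^(0) … (n-1)^(0)]₁ [n^(0)]_{d-1}` of `G(d,d,n)` for `n ≥ 2`: it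
maps `k^(s)` to `(k+1)^(s)` for `1 ≤ k ≤ n-2`, and `(n-1)^(s)` to `1^(s+1)`, and `n^(s)` to
`n^(s-1)`.  (The value for `n < 2` is irrelevant.) -/
def gamma (d n : ℕ) : G d n :=
  if h : 2 ≤ n then
    G.mk (Fin.cycleRange ⟨n - 2, by omega⟩)
      (Pi.single ⟨n - 2, by omega⟩ 1 + Pi.single ⟨n - 1, by omega⟩ (-1))
      (by simp [Finset.sum_add_distrib])
  else 1

/-- The long cycle `(1 2 … m)` in the symmetric group `G(1,1,m)`. -/
def longCycle (m : ℕ) : G 1 m := G.mk (finRotate m) 0 (by simp)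

/-- The lattice of noncrossing partitions of `G(d,d,n)` below `γ`. -/
abbrev NCD (d n : ℕ) : Type := NC (reflections d n) (gamma d n)

/-- The lattice of noncrossing partitions of the symmetric group `G(1,1,m)` below `(1 2 … m)`. -/
abbrev NCA (m : ℕ) : Type := NC (reflections 1 m) (longCycle m)

/-- The simultaneous cycle `((a^(0) b^(s)))` for `a ≠ b`: it maps `a^(r)` to `b^(r+s)`, and `b^(r)` to
`a^(r-s)`, and fixes the remaining coloured integers. -/
def colRefl {d n : ℕ} (a b : Fin n) (s : ZMod d) : G d n :=
  G.mk (Equiv.swap a b) (Pi.single a s + Pi.single b (-s)) (by simp [Finset.sum_add_distrib])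

/-- `w` maps the coloured integer `k^(r)` to `i^(s)`, where `1 ≤ k, i ≤ n`. -/
def Maps {d n : ℕ} (w : G d n) (k : ℕ) (r : ZMod d) (i : ℕ) (s : ZMod d) : Prop :=
  ∃ a b : Fin n, (a : ℕ) + 1 = k ∧ (b : ℕ) + 1 = i ∧ w.1 (a, r) = (b, s)

/-! ### The parts of the decomposition; the colour `d - 1` is written `-1` -/

/-- `R_i^(s)`: the noncrossing partitions that map `1^(0)` to `i^(s)`. -/
def R (d n i : ℕ) (s : ZMod d) : Set (NCD d n) := {u | Maps u.1 1 0 i s}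

/-- `f₁ : x ↦ ((1^(0) n^(d-2))) x`. -/
def f₁ {d n : ℕ} (hn : 3 ≤ n) (x : G d n) : G d n :=
  colRefl ⟨0, by omega⟩ ⟨n - 1, by omega⟩ (-2) * x

/-- `f₂ : x ↦ ((2^(0) n^(0))) x`. -/
def f₂ {d n : ℕ} (hn : 3 ≤ n) (x : G d n) : G d n :=
  colRefl ⟨1, by omega⟩ ⟨n - 1, by omega⟩ 0 * x

/-- `E₁`: the image of `R_1^(1)` under `f₁`. -/
def E₁ (d n : ℕ) (hn : 3 ≤ n) : Set (NCD d n) := {y | ∃ x ∈ R d n 1 1, f₁ hn x.1 = y.1}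

/-- `E₂`: the image of `R_2^(d-1)` under `f₂`. -/
def E₂ (d n : ℕ) (hn : 3 ≤ n) : Set (NCD d n) := {y | ∃ x ∈ R d n 2 (-1), f₂ hn x.1 = y.1}

/-- `D₁ = R_1^(1) ⊎ E₁`. -/
def D₁ (d n : ℕ) (hn : 3 ≤ n) : Set (NCD d n) := R d n 1 1 ∪ E₁ d n hn

/-- `D₂ = R_2^(d-1) ⊎ E₂`. -/
def D₂ (d n : ℕ) (hn : 3 ≤ n) : Set (NCD d n) := R d n 2 (-1) ∪ E₂ d n hn

/-- `D = R_n^(d-1) \ (E₁ ⊎ E₂)`. -/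
def D (d n : ℕ) (hn : 3 ≤ n) : Set (NCD d n) := R d n n (-1) \ (E₁ d n hn ∪ E₂ d n hn)

/-- The elements of `R_n^(d-1)` that map `n^(0)` to `i^(0)`; for `3 ≤ i ≤ n-1` these are the pieces
of `D`. -/
def DPiece (d n i : ℕ) : Set (NCD d n) := {u ∈ R d n n (-1) | Maps u.1 n 0 i 0}

/-- Indices of the parts other than `D`. -/
inductive PartIndex (d n : ℕ) : Type
  | base
  | first (i : Finset.Icc 3 (n - 1))
  | last (i : Finset.Icc 3 (n - 1))
  | top (s : {s : ZMod d // s ≠ -1})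
  | one
  | two

/-- The parts other than `D`: `R_1^(0) ⊎ R_2^(0)`, the `R_i^(0)` and `R_i^(d-1)` for `3 ≤ i ≤ n-1`,
the `R_n^(s)` for all colours `s ≠ d-1`, and `D₁`, and `D₂`. -/
def part (d n : ℕ) (hn : 3 ≤ n) : PartIndex d n → Set (NCD d n)
  | .base => R d n 1 0 ∪ R d n 2 0
  | .first i => R d n i 0
  | .last i => R d n i (-1)
  | .top s => R d n n s
  | .one => D₁ d n hn
  | .two => D₂ d n hn

end GddNC

open GddNC

/-! Indices in comments are counted from 1, in the code from 0. `((x y))` is the reflection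
exchanging the coloured integers x and y, and [1]_s [a]_{-s} is the diagonal element shifting the
colours of 1 and a by s and -s. Two facts about length carry the proof.

Cutting. For every x and every index k, a reduced word of x can be rearranged so that at most two
reflections moving k stand in front of an element fixing k (`exists_reduction`). Hence, if x maps
k^(0) to j with j of another index, multiplication by ((k j)) lowers the length by exactly one
(`lg_refl_mul_of_apply`), and every u below x that fixes k^(0) stays below ((k j)) x
(`ale_refl_mul`).

Tightness. Length can exceed the codimension of the fixed space, but for γ both equal n. Equality is
inherited by everything below, and fixed spaces grow on the way down (`IsTight.of_ale`). Applied to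
indicator vectors: if w preserves a block made of one coloured copy of each of some indices, so does
everything below w (`IsTight.section_of_ale`).

Two cuts of γ at the index 1 show that, for i ≥ 3, a nonempty R_i^(s) is t [1, w] with t = ((1^(0)
i^(s))) and w = ((1^(0) 2^(0))) t γ (`IsCut.ale_and_apply_iff`). Its ranks run from 1 to n - 1,
which is symmetric. For i = n every colour occurs and w is one long cycle. For 3 ≤ i ≤ n - 1 only
the colours 0 and -1 occur, as otherwise t γ has no nonzero fixed vector and is too long
(`color_of_refl_ale_gamma`); then w is a long cycle times a smaller Coxeter element. By tightness,
every reflection below w respects this splitting and its colours, so it lifts to the smaller groups;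
this identifies [1, w] (`nonempty_orderIso_map`, `nonempty_nc_emb₂`).

The classes R_1^(0), R_2^(0), R_1^(1), R_2^(-1) are translates of intervals whose ranks are off
centre. They are completed by a copy shifted by one reflection r: if w fixes an index that r moves,
then t [1, w] together with t r [1, w] is a two-element chain times [1, w] (`isDoubled_of_fix`).
R_1^(0) and R_2^(0) complete each other. The other two need E₁ and E₂, which are taken out of
R_n^(-1) = ((1^(0) n^(-1))) [1, (2 3 … n)]: they consist of the translates of those y with y(n) = n
and y(n) = 2.

What remains of R_n^(-1) is D, sorted by the value i of y at n. A further cut at n makes each D^(i)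
a translated interval with ranks from 2 to n - 2. D is convex (`mem_D_of_le_of_le`), and it is
connected because one of its elements lies above the minimal elements of all pieces
(`exists_pivot`). -/

namespace GddNC

/-! ### Reflection length and the absolute order in an arbitrary group -/

section AbsoluteOrderTheory

variable {W : Type*} [Group W] {T : Set W}

theorem absLength_le_iff {w : W} {m : ℕ} :
    absLength T w ≤ m ↔ ∃ l : List W, (∀ t ∈ l, t ∈ T) ∧ l.prod = w ∧ l.length ≤ m := by
  constructor
  · intro h
    have h' : absLength T w < ((m + 1 : ℕ) : ℕ∞) :=
      lt_of_le_of_lt h (by exact_mod_cast Nat.lt_succ_self m)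
    unfold absLength at h'
    simp only [iInf_lt_iff] at h'
    obtain ⟨l, ⟨h1, h2⟩, h3⟩ := h'
    exact ⟨l, h1, h2, by have : l.length < m + 1 := by exact_mod_cast h3
                         omega⟩
  · rintro ⟨l, h1, h2, h3⟩
    exact iInf₂_le_of_le l ⟨h1, h2⟩ (by exact_mod_cast h3)

/-- The absolute length as a natural number. -/
noncomputable def len (T : Set W) (w : W) : ℕ := (absLength T w).toNat

/-- `T` generates the group (as a monoid) and is closed under conjugation. -/
structure IsReflSystem (T : Set W) : Prop where
  gen : ∀ w, ∃ l : List W, (∀ t ∈ l, t ∈ T) ∧ l.prod = w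
  conj : ∀ g, ∀ t ∈ T, g * t * g⁻¹ ∈ T

namespace IsReflSystem

variable (hT : IsReflSystem T)
include hT

theorem coe_len (w : W) : (len T w : ℕ∞) = absLength T w := by
  obtain ⟨l, h1, h2⟩ := hT.gen w
  have : absLength T w ≤ (l.length : ℕ) := absLength_le_iff.2 ⟨l, h1, h2, le_rfl⟩
  exact ENat.natCast_toNat (ne_top_of_le_ne_top (ENat.natCast_ne_top _) this)

theorem len_le_iff {w : W} {m : ℕ} :
    len T w ≤ m ↔ ∃ l : List W, (∀ t ∈ l, t ∈ T) ∧ l.prod = w ∧ l.length ≤ m := by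
  rw [← absLength_le_iff, ← hT.coe_len, Nat.cast_le]

theorem exists_word (w : W) : ∃ l : List W, (∀ t ∈ l, t ∈ T) ∧ l.prod = w ∧ l.length = len T w := by
  obtain ⟨l, h1, h2, h3⟩ := hT.len_le_iff.1 (le_refl (len T w))
  exact ⟨l, h1, h2, le_antisymm h3 (hT.len_le_iff.2 ⟨l, h1, h2, le_rfl⟩)⟩

theorem len_mul_le (u v : W) : len T (u * v) ≤ len T u + len T v := by
  have := absLength_mul_le T u v
  rw [← hT.coe_len, ← hT.coe_len, ← hT.coe_len] at this
  exact_mod_cast this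

theorem len_one : len T 1 = 0 :=
  Nat.le_zero.1 (hT.len_le_iff.2 ⟨[], by simp, by simp, by simp⟩)

theorem eq_one_of_len {w : W} (h : len T w = 0) : w = 1 := by
  obtain ⟨l, -, h2, h3⟩ := hT.exists_word w
  rw [h, List.length_eq_zero_iff] at h3
  simp [← h2, h3]

theorem len_le_one {t : W} (h : t ∈ T) : len T t ≤ 1 :=
  hT.len_le_iff.2 ⟨[t], by simpa using h, by simp, by simp⟩

theorem absLE_iff {u v : W} : AbsLE T u v ↔ len T v = len T u + len T (u⁻¹ * v) := by
  unfold AbsLE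
  rw [← hT.coe_len, ← hT.coe_len, ← hT.coe_len]
  norm_cast

theorem absLE_of_le {u v : W} (h : len T u + len T (u⁻¹ * v) ≤ len T v) : AbsLE T u v := by
  have := hT.len_mul_le u (u⁻¹ * v)
  rw [mul_inv_cancel_left] at this
  exact hT.absLE_iff.2 (le_antisymm this h)

theorem one_absLE (u : W) : AbsLE T 1 u := by
  rw [hT.absLE_iff, hT.len_one]; simp

theorem len_conj_le (g w : W) : len T (g * w * g⁻¹) ≤ len T w := by
  obtain ⟨l, h1, h2, h3⟩ := hT.exists_word w
  refine hT.len_le_iff.2 ⟨l.map (MulAut.conj g), ?_, ?_, by simp [h3]⟩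
  · intro t ht
    obtain ⟨s, hs, rfl⟩ := List.mem_map.1 ht
    exact hT.conj g s (h1 s hs)
  · rw [← map_list_prod, h2]; rfl

theorem len_conj (g w : W) : len T (g * w * g⁻¹) = len T w := by
  refine le_antisymm (hT.len_conj_le g w) ?_
  have := hT.len_conj_le g⁻¹ (g * w * g⁻¹)
  rwa [show g⁻¹ * (g * w * g⁻¹) * g⁻¹⁻¹ = w by group] at this

theorem len_mul_comm (u v : W) : len T (u * v) = len T (v * u) := by
  rw [← hT.len_conj v (u * v)]
  congr 1
  group

theorem exists_eq_mul {w : W} {m : ℕ} (h : len T w = m + 1) :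
    ∃ t ∈ T, ∃ w', w = t * w' ∧ len T w' = m := by
  obtain ⟨l, h1, h2, h3⟩ := hT.exists_word w
  rw [h] at h3
  obtain ⟨t, l', rfl⟩ := List.exists_cons_of_length_eq_add_one h3
  have ht : t ∈ T := h1 t (by simp)
  refine ⟨t, ht, l'.prod, by simp [← h2], ?_⟩
  have a : len T l'.prod ≤ m :=
    hT.len_le_iff.2 ⟨l', fun s hs => h1 s (by simp [hs]), rfl, by simpa using h3.le⟩
  have b := hT.len_mul_le t l'.prod
  have c := hT.len_le_one ht
  rw [show t * l'.prod = w by simpa using h2] at b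
  omega

theorem antisymm {u v : W} (h₁ : AbsLE T u v) (h₂ : AbsLE T v u) : u = v := by
  rw [hT.absLE_iff] at h₁ h₂
  have := hT.eq_one_of_len (w := u⁻¹ * v) (by omega)
  exact inv_mul_eq_one.1 this

theorem len_le {u v : W} (h : AbsLE T u v) : len T u ≤ len T v := by
  rw [hT.absLE_iff] at h; omega

theorem eq_of_len_le {u v : W} (h : AbsLE T u v) (h' : len T v ≤ len T u) : u = v := by
  rw [hT.absLE_iff] at h
  have := hT.eq_one_of_len (w := u⁻¹ * v) (by omega)
  exact inv_mul_eq_one.1 this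

theorem absLE_mul_iff {a b : W} : AbsLE T a (a * b) ↔ len T (a * b) = len T a + len T b := by
  rw [hT.absLE_iff, inv_mul_cancel_left]

theorem absLE_mul_right {a b : W} (h : len T (a * b) = len T a + len T b) :
    AbsLE T b (a * b) := by
  rw [hT.absLE_iff, h, hT.len_mul_comm b⁻¹, mul_inv_cancel_right, add_comm]

/-- The complement of `u` in `v` is below `v`. -/
theorem inv_mul_absLE {u v : W} (h : AbsLE T u v) : AbsLE T (u⁻¹ * v) v := by
  have := hT.absLE_mul_right (a := u) (b := u⁻¹ * v)
    (by rw [mul_inv_cancel_left]; exact hT.absLE_iff.1 h)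
  rwa [mul_inv_cancel_left] at this

theorem mul_absLE_mul_iff {t u v : W} (hu : len T (t * u) = len T t + len T u)
    (hv : len T (t * v) = len T t + len T v) : AbsLE T (t * u) (t * v) ↔ AbsLE T u v := by
  rw [hT.absLE_iff, hT.absLE_iff, hu, hv, show (t * u)⁻¹ * (t * v) = u⁻¹ * v by group]
  omega

/-- Subadditivity for t w = (t y)(y⁻¹ w) leaves no slack: if t y were shorter than expected, t w
would be too. -/
theorem len_mul_of_absLE {t w y : W} (hw : len T (t * w) = len T t + len T w)
    (hy : AbsLE T y w) : len T (t * y) = len T t + len T y := by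
  have h1 := hT.len_mul_le (t * y) (y⁻¹ * w)
  rw [show t * y * (y⁻¹ * w) = t * w by group] at h1
  have h2 := hT.len_mul_le t y
  rw [hT.absLE_iff] at hy
  omega

theorem mul_absLE_mul {t w y : W} (hw : len T (t * w) = len T t + len T w)
    (hy : AbsLE T y w) : AbsLE T (t * y) (t * w) :=
  (hT.mul_absLE_mul_iff (hT.len_mul_of_absLE hw hy) hw).2 hy

theorem absLE_inv_mul {t y c : W} (hy : len T (t * y) = len T t + len T y)
    (h : AbsLE T (t * y) c) : AbsLE T y (t⁻¹ * c) ∧ len T c = len T t + len T (t⁻¹ * c) := by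
  have htc : AbsLE T t c := (hT.absLE_mul_iff.2 hy).trans h
  have e := hT.absLE_iff.1 htc
  refine ⟨?_, e⟩
  rw [← hT.mul_absLE_mul_iff hy (by rw [mul_inv_cancel_left]; exact e), mul_inv_cancel_left]
  exact h

/-- A factorization of `c` whose lengths add up to at most the length of `c`. -/
theorem absLE_of_len_add_le {a b c : W} (h : a * b = c) (hl : len T a + len T b ≤ len T c) :
    AbsLE T a c := by
  apply hT.absLE_of_le
  rwa [show a⁻¹ * c = b by rw [← h, inv_mul_cancel_left]]

/-- Climb from a one step at a time, multiplying the element z reached so far by the first letter of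
a reduced word of z⁻¹ b. -/
theorem exists_between {a b : W} (h : AbsLE T a b) {k : ℕ} (h1 : len T a ≤ k)
    (h2 : k ≤ len T b) : ∃ z, AbsLE T a z ∧ AbsLE T z b ∧ len T z = k := by
  induction k, h1 using Nat.le_induction with
  | base => exact ⟨a, AbsLE.refl T a, h, rfl⟩
  | succ k hk ih =>
    obtain ⟨z, haz, hzb, rfl⟩ := ih (by omega)
    have e := hT.absLE_iff.1 hzb
    obtain ⟨t, ht, w, hw, hlw⟩ := hT.exists_eq_mul (w := z⁻¹ * b)
      (m := len T b - len T z - 1) (by omega)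
    have e1 := hT.len_le_one ht
    have e2 := hT.len_mul_le z t
    have hb : z * t * w = b := by rw [mul_assoc, ← hw, mul_inv_cancel_left]
    have e3 := hT.len_mul_le (z * t) w
    rw [hb] at e3
    have e4 := hT.len_mul_le t w
    rw [← hw] at e4
    refine ⟨z * t, haz.trans (hT.absLE_mul_iff.2 (by omega)),
      hT.absLE_of_len_add_le hb (by omega), by omega⟩

end IsReflSystem

/-! ### The poset `NC T c` -/

/-- An element below `c`, as an element of `NC T c`. -/
def NC.of (hT : IsReflSystem T) {c u : W} (h : AbsLE T u c) : NC T c := ⟨u, hT.one_absLE u, h⟩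

theorem NC.ext {c : W} {u v : NC T c} (h : u.1 = v.1) : u = v := Subtype.ext h

theorem NC.le_def {c : W} {u v : NC T c} : u ≤ v ↔ AbsLE T u.1 v.1 := Iff.rfl

namespace IsReflSystem

variable (hT : IsReflSystem T)
include hT

theorem nc_antisymm {c : W} {u v : NC T c} (h : u ≤ v) (h' : v ≤ u) : u = v :=
  NC.ext (hT.antisymm h h')

theorem nc_lt_iff {c : W} {u v : NC T c} : u < v ↔ u ≤ v ∧ len T u.1 < len T v.1 := by
  rw [lt_iff_le_not_ge]
  refine and_congr_right fun h => ⟨fun h' => ?_, fun h' h'' => ?_⟩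
  · by_contra hl
    have := hT.eq_of_len_le h (not_lt.1 hl)
    exact h' (NC.le_def.2 (this ▸ AbsLE.refl T _))
  · have := hT.len_le h''
    omega

theorem nc_exists_between {c : W} {u v : NC T c} (h : u ≤ v) {k : ℕ} (h1 : len T u.1 ≤ k)
    (h2 : k ≤ len T v.1) : ∃ z : NC T c, u ≤ z ∧ z ≤ v ∧ len T z.1 = k := by
  obtain ⟨z, hz1, hz2, hz⟩ := hT.exists_between h h1 h2
  exact ⟨NC.of hT (hz2.trans v.2.2), hz1, hz2, hz⟩

/-- Length grows strictly along chains, which bounds the height from above; interpolation between 1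
and p supplies a chain through every smaller length. -/
theorem height_eq {c : W} (p : NC T c) : Order.height p = len T p.1 := by
  refine le_antisymm ?_ ?_
  · refine Order.height_le fun s hs => ?_
    have key : ∀ i : Fin (s.length + 1), i.val ≤ len T (s i).1 := by
      intro i
      induction i using Fin.induction with
      | zero => simp
      | succ i ih =>
        have := (hT.nc_lt_iff.1 (s.step i)).2
        simp only [Fin.val_succ, Fin.val_castSucc] at *
        omega
    have := key (Fin.last _)
    rw [show s (Fin.last _) = p from hs] at this
    exact_mod_cast this
  · obtain ⟨m, hm⟩ : ∃ m, len T p.1 = m := ⟨_, rfl⟩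
    rw [hm]
    induction m generalizing p with
    | zero => simp
    | succ m ih =>
      obtain ⟨z, -, hz2, hz⟩ := hT.nc_exists_between (u := NC.of hT (hT.one_absLE c)) (v := p)
        (hT.one_absLE p.1) (k := m) (by simp [NC.of, hT.len_one]) (by omega)
      have h1 := ih z hz
      have h2 := Order.height_add_one_le (a := z) (b := p) (hT.nc_lt_iff.2 ⟨hz2, by omega⟩)
      push_cast
      exact le_trans (by gcongr) h2

/-- On a maximal chain, length is injective and takes every value up to that of c: a missing value
could be filled by an interpolated element between its two neighbours in the chain, and that element
would be comparable with the whole chain. -/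
theorem isGradedOfRank (c : W) : IsGradedOfRank (NC T c) (len T c) := by
  refine ⟨fun a b => hT.nc_antisymm, fun C hC => ?_⟩
  have hinj : Set.InjOn (fun u : NC T c => len T u.1) C := by
    intro u hu v hv huv
    rcases hC.1.total hu hv with h | h
    · exact NC.ext (hT.eq_of_len_le h (le_of_eq huv.symm))
    · exact (NC.ext (hT.eq_of_len_le h (le_of_eq huv))).symm
  have hmax : ∀ z : NC T c, (∀ u ∈ C, u ≤ z ∨ z ≤ u) → z ∈ C := by
    intro z hz
    have : C = insert z C := hC.2 (hC.1.insert fun u hu _ => (hz u hu).symm) (Set.subset_insert _ _)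
    rw [this]
    exact Set.mem_insert _ _
  have him : (fun u : NC T c => len T u.1) '' C = ↑(Finset.range (len T c + 1)) := by
    ext k
    simp only [Set.mem_image, Finset.coe_range, Set.mem_Iio]
    constructor
    · rintro ⟨u, -, rfl⟩
      have := hT.len_le u.2.2
      omega
    · intro hk
      by_contra hno
      push Not at hno
      let bot : NC T c := NC.of hT (hT.one_absLE c)
      let top : NC T c := NC.of hT (AbsLE.refl T c)
      have hbot : bot ∈ C := hmax _ fun u _ => Or.inr (hT.one_absLE u.1)
      have htop : top ∈ C := hmax _ fun u _ => Or.inl u.2.2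
      have hbl : len T bot.1 = 0 := hT.len_one
      have htl : len T top.1 = len T c := rfl
      -- Lengths are truncated into `Fin (k + 1)` because `>` is not well founded on ℕ.
      obtain ⟨a, ⟨haC, hak⟩, ha⟩ := exists_maximalFor_of_wellFoundedGT
        (fun u : NC T c => u ∈ C ∧ len T u.1 < k)
        (fun u => (⟨min (len T u.1) k, by omega⟩ : Fin (k + 1)))
        ⟨bot, hbot, by have := hno bot hbot; omega⟩
      obtain ⟨b, ⟨hbC, hbk⟩, hb⟩ := exists_minimalFor_of_wellFoundedLT
        (fun u : NC T c => u ∈ C ∧ k < len T u.1) (fun u => len T u.1)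
        ⟨top, htop, by have := hno top htop; omega⟩
      have le_of_len : ∀ u ∈ C, ∀ v ∈ C, len T u.1 ≤ len T v.1 → u ≤ v := by
        intro u hu v hv huv
        rcases hC.1.total hu hv with h | h
        · exact h
        · rw [hinj hv hu (le_antisymm (hT.len_le h) huv)]
      obtain ⟨z, haz, hzb, hz⟩ := hT.nc_exists_between (le_of_len a haC b hbC (by omega))
        (k := k) (by omega) (by omega)
      refine hno z (hmax z fun u hu => ?_) hz
      rcases lt_trichotomy (len T u.1) k with h | h | h
      · refine Or.inl (le_trans (le_of_len u hu a haC ?_) haz)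
        by_contra hlt
        have := ha ⟨hu, h⟩ (by simp only [Fin.mk_le_mk]; omega)
        simp only [Fin.mk_le_mk] at this
        omega
      · exact absurd h (hno u hu)
      · refine Or.inr (le_trans hzb (le_of_len b hbC u hu ?_))
        by_contra hlt
        exact hlt (hb ⟨hu, h⟩ (by simp only; omega))
  rw [← hinj.encard_image, him, Set.encard_coe_eq_coe_finsetCard, Finset.card_range]

end IsReflSystem

end AbsoluteOrderTheory

end GddNC

namespace GddNC

/-! ### Length and intervals under homomorphisms and products -/

section Homs

variable {W W' : Type*} [Group W] [Group W'] {T : Set W} {T' : Set W'}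

theorem len_map_le (hT : IsReflSystem T) (hT' : IsReflSystem T') (F : W' →* W)
    (hF : ∀ t ∈ T', F t ∈ T) (u : W') : len T (F u) ≤ len T' u := by
  obtain ⟨l, h1, h2, h3⟩ := hT'.exists_word u
  refine hT.len_le_iff.2 ⟨l.map F, ?_, by rw [← map_list_prod, h2], by simp [h3]⟩
  intro t ht
  obtain ⟨s, hs, rfl⟩ := List.mem_map.1 ht
  exact hF s (h1 s hs)

/-- If all reflections below `F c` lift, then so do all elements below `F c`. -/
theorem exists_preimage (hT : IsReflSystem T) (hT' : IsReflSystem T') (F : W' →* W) {c : W}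
    (hr : ∀ t ∈ T, AbsLE T t c → ∃ t' ∈ T', F t' = t) {x : W} (hx : AbsLE T x c) :
    ∃ u, F u = x ∧ len T' u ≤ len T x := by
  obtain ⟨m, hm⟩ : ∃ m, len T x = m := ⟨_, rfl⟩
  induction m generalizing x with
  | zero => exact ⟨1, by rw [map_one, hT.eq_one_of_len hm], by rw [hT'.len_one]; omega⟩
  | succ m ih =>
    obtain ⟨t, ht, y, rfl, hy⟩ := hT.exists_eq_mul hm
    have h1 := hT.len_le_one ht
    have h2 := hT.len_mul_le t y
    obtain ⟨t', ht', rfl⟩ := hr t ht ((hT.absLE_mul_iff.2 (by omega)).trans hx)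
    obtain ⟨u, rfl, hu⟩ := ih ((hT.absLE_mul_right (by omega)).trans hx) hy
    refine ⟨t' * u, map_mul _ _ _, ?_⟩
    have h3 := hT'.len_le_one ht'
    have h4 := hT'.len_mul_le t' u
    omega

/-- F maps words to words, so it does not increase length. Conversely, a reduced word of F u
consists of reflections below c, which lift, and injectivity identifies the product of the lifts
with u. -/
theorem len_map_eq (hT : IsReflSystem T) (hT' : IsReflSystem T') {F : W' →* W}
    (hinj : Function.Injective F) (hF : ∀ t ∈ T', F t ∈ T) {c : W}
    (hr : ∀ t ∈ T, AbsLE T t c → ∃ t' ∈ T', F t' = t) {u : W'} (hx : AbsLE T (F u) c) :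
    len T (F u) = len T' u := by
  obtain ⟨v, hv, hl⟩ := exists_preimage hT hT' F hr hx
  rw [hinj hv] at hl
  exact le_antisymm (len_map_le hT hT' F hF u) hl

theorem map_absLE (hT : IsReflSystem T) (hT' : IsReflSystem T') {F : W' →* W}
    (hinj : Function.Injective F) (hF : ∀ t ∈ T', F t ∈ T) {c : W'}
    (hr : ∀ t ∈ T, AbsLE T t (F c) → ∃ t' ∈ T', F t' = t) {u : W'} (hx : AbsLE T' u c) :
    AbsLE T (F u) (F c) := by
  apply hT.absLE_of_le
  rw [← map_inv, ← map_mul, len_map_eq hT hT' hinj hF hr (AbsLE.refl T (F c)),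
    hT'.absLE_iff.1 hx]
  exact add_le_add (len_map_le hT hT' F hF u) (len_map_le hT hT' F hF _)

/-- The relation involves the lengths of u, v and u⁻¹ v. The images of all three lie below c, the
last one by `inv_mul_absLE`, so F preserves these lengths. -/
theorem map_absLE_map_iff (hT : IsReflSystem T) (hT' : IsReflSystem T') {F : W' →* W}
    (hinj : Function.Injective F) (hF : ∀ t ∈ T', F t ∈ T) {c : W}
    (hr : ∀ t ∈ T, AbsLE T t c → ∃ t' ∈ T', F t' = t) {u v : W'}
    (h : AbsLE T (F u) (F v)) (hv : AbsLE T (F v) c) : AbsLE T' u v := by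
  rw [hT'.absLE_iff, ← len_map_eq hT hT' hinj hF hr hv,
    ← len_map_eq hT hT' hinj hF hr (h.trans hv), ← len_map_eq hT hT' hinj hF hr (c := c),
    map_mul, map_inv]
  · exact hT.absLE_iff.1 h
  · rw [map_mul, map_inv]
    exact (hT.inv_mul_absLE h).trans hv

/-- An injective homomorphism of reflection systems induces an isomorphism of the intervals below
`c` and `F c` if all reflections below `F c` lift. -/
theorem nonempty_orderIso_map (hT : IsReflSystem T) (hT' : IsReflSystem T') {F : W' →* W}
    (hinj : Function.Injective F) (hF : ∀ t ∈ T', F t ∈ T) {c : W'}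
    (hr : ∀ t ∈ T, AbsLE T t (F c) → ∃ t' ∈ T', F t' = t) :
    Nonempty (NC T (F c) ≃o NC T' c) := by
  let f : NC T' c → NC T (F c) := fun u => NC.of hT (map_absLE hT hT' hinj hF hr u.2.2)
  have hf : Function.Bijective f := by
    refine ⟨fun u v h => NC.ext (hinj (congrArg Subtype.val h)), fun x => ?_⟩
    obtain ⟨u, hu, -⟩ := exists_preimage hT hT' F hr x.2.2
    refine ⟨NC.of hT' (u := u) ?_, NC.ext hu⟩
    exact map_absLE_map_iff hT hT' hinj hF hr (hu ▸ x.2.2) (AbsLE.refl T _)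
  refine ⟨OrderIso.symm ⟨Equiv.ofBijective f hf, ?_⟩⟩
  intro u v
  refine ⟨fun h => map_absLE_map_iff hT hT' hinj hF hr h (map_absLE hT hT' hinj hF hr v.2.2),
    fun h => ?_⟩
  refine map_absLE hT hT' hinj hF (fun t ht h' => hr t ht (h'.trans ?_)) h
  exact map_absLE hT hT' hinj hF hr v.2.2

/-- The reflections of a product. -/
def prodRefl (T : Set W) (T' : Set W') : Set (W × W') :=
  {p | (p.1 ∈ T ∧ p.2 = 1) ∨ (p.1 = 1 ∧ p.2 ∈ T')}

theorem isReflSystem_prod (hT : IsReflSystem T) (hT' : IsReflSystem T') :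
    IsReflSystem (prodRefl T T') where
  gen := by
    rintro ⟨u, v⟩
    obtain ⟨l, hl, rfl⟩ := hT.gen u
    obtain ⟨m, hm, rfl⟩ := hT'.gen v
    refine ⟨l.map (MonoidHom.inl W W') ++ m.map (MonoidHom.inr W W'), ?_, ?_⟩
    · intro t ht
      rcases List.mem_append.1 ht with h | h
      · obtain ⟨s, hs, rfl⟩ := List.mem_map.1 h
        exact Or.inl ⟨hl s hs, rfl⟩
      · obtain ⟨s, hs, rfl⟩ := List.mem_map.1 h
        exact Or.inr ⟨rfl, hm s hs⟩
    · rw [List.prod_append, ← map_list_prod, ← map_list_prod]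
      simp
  conj := by
    rintro ⟨g, h⟩ ⟨t, s⟩ (⟨h1, h2⟩ | ⟨h1, h2⟩)
    · exact Or.inl ⟨hT.conj g t h1, by simp_all⟩
    · exact Or.inr ⟨by simp_all, hT'.conj h s h2⟩

/-- Each reflection of the product lives in one factor, so a word splits into a word for each
coordinate. -/
theorem len_prod (hT : IsReflSystem T) (hT' : IsReflSystem T') (p : W × W') :
    len (prodRefl T T') p = len T p.1 + len T' p.2 := by
  have hP := isReflSystem_prod hT hT'
  refine le_antisymm ?_ ?_
  · have h1 := len_map_le hP hT (MonoidHom.inl W W') (fun t ht => Or.inl ⟨ht, rfl⟩) p.1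
    have h2 := len_map_le hP hT' (MonoidHom.inr W W') (fun t ht => Or.inr ⟨rfl, ht⟩) p.2
    have h3 := hP.len_mul_le (MonoidHom.inl W W' p.1) (MonoidHom.inr W W' p.2)
    rw [show MonoidHom.inl W W' p.1 * MonoidHom.inr W W' p.2 = p by simp] at h3
    omega
  · obtain ⟨l, h1, h2, h3⟩ := hP.exists_word p
    rw [← h3]
    clear h3
    induction l generalizing p with
    | nil => simp [← h2, hT.len_one, hT'.len_one]
    | cons t l ih =>
      have := ih l.prod (fun s hs => h1 s (by simp [hs])) rfl
      have a := hT.len_mul_le t.1 l.prod.1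
      have b := hT'.len_mul_le t.2 l.prod.2
      have hp : p = t * l.prod := by simp [← h2]
      rw [hp, List.length_cons, Prod.fst_mul, Prod.snd_mul]
      rcases h1 t (by simp) with ⟨c, d⟩ | ⟨c, d⟩
      · have e := hT.len_le_one c
        rw [d, hT'.len_one] at b
        rw [d]
        omega
      · have e := hT'.len_le_one d
        rw [c, hT.len_one] at a
        rw [c]
        omega

theorem absLE_prod_iff (hT : IsReflSystem T) (hT' : IsReflSystem T') {p q : W × W'} :
    AbsLE (prodRefl T T') p q ↔ AbsLE T p.1 q.1 ∧ AbsLE T' p.2 q.2 := by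
  rw [(isReflSystem_prod hT hT').absLE_iff, len_prod hT hT', len_prod hT hT', len_prod hT hT',
    hT.absLE_iff, hT'.absLE_iff]
  have a := hT.len_mul_le p.1 (p.1⁻¹ * q.1)
  have b := hT'.len_mul_le p.2 (p.2⁻¹ * q.2)
  rw [mul_inv_cancel_left] at a b
  simp only [Prod.fst_mul, Prod.snd_mul, Prod.fst_inv, Prod.snd_inv]
  omega

/-- Noncrossing partitions of a product. -/
def ncProd (hT : IsReflSystem T) (hT' : IsReflSystem T') (c : W × W') :
    NC (prodRefl T T') c ≃o NC T c.1 × NC T' c.2 where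
  toFun p := (NC.of hT ((absLE_prod_iff hT hT').1 p.2.2).1,
    NC.of hT' ((absLE_prod_iff hT hT').1 p.2.2).2)
  invFun q := NC.of (isReflSystem_prod hT hT') (u := (q.1.1, q.2.1))
    ((absLE_prod_iff hT hT').2 ⟨q.1.2.2, q.2.2.2⟩)
  left_inv _ := rfl
  right_inv _ := rfl
  map_rel_iff' := (absLE_prod_iff hT hT').symm

end Homs

/-! ### Parts of symmetric decompositions -/

section Parts

/-- The conditions on a single part of a symmetric decomposition. -/
structure IsSymPart {α : Type*} [Preorder α] (N : ℕ) (A : Set α) : Prop where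
  connected : IsConnectedPart A
  covBy : ∀ p q : A, p ⋖ q → (p : α) ⋖ (q : α)
  symmetric : ∃ φ : {p : α // Minimal (· ∈ A) p} ≃ {q : α // Maximal (· ∈ A) q},
    ∀ p, Order.height p.1 + Order.height (φ p).1 = N

theorem isSymmetricDecomposition_of {α : Type*} [Preorder α] {N : ℕ} {ι : Type*} {A : ι → Set α}
    (hg : IsGradedOfRank α N) (hd : Pairwise fun i j => Disjoint (A i) (A j))
    (hc : ∀ a, ∃ i, a ∈ A i) (h : ∀ i, IsSymPart N (A i)) : IsSymmetricDecomposition N A where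
  disjoint := hd
  cover := by
    ext a
    simpa using hc a
  connected i := (h i).connected
  covBy i := (h i).covBy
  graded := hg
  symmetric i := (h i).symmetric

variable {W : Type*} [Group W] {T : Set W} {c : W}

/-- A subset of `NC T c` in which ranks of comparable elements can be interpolated. -/
def IsSaturated (A : Set (NC T c)) : Prop :=
  ∀ p ∈ A, ∀ q ∈ A, p ≤ q → len T p.1 + 2 ≤ len T q.1 →
    ∃ z ∈ A, p ≤ z ∧ z ≤ q ∧ len T p.1 < len T z.1 ∧ len T z.1 < len T q.1

theorem IsSaturated.covBy (hT : IsReflSystem T) {A : Set (NC T c)} (hA : IsSaturated A)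
    (p q : A) (h : p ⋖ q) : (p : NC T c) ⋖ (q : NC T c) := by
  have hlt : (p : NC T c) < q := h.1
  refine ⟨hlt, fun z hpz hzq => ?_⟩
  have h1 := (hT.nc_lt_iff.1 hpz).2
  have h2 := (hT.nc_lt_iff.1 hzq).2
  obtain ⟨y, hy, hpy, hyq, h3, h4⟩ := hA p p.2 q q.2 hlt.le (by omega)
  exact h.2 (c := ⟨y, hy⟩) (hT.nc_lt_iff.2 ⟨hpy, h3⟩) (hT.nc_lt_iff.2 ⟨hyq, h4⟩)

theorem isConnectedPart_of_le {α : Type*} [Preorder α] {A : Set α} {a : α} (ha : a ∈ A)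
    (h : ∀ u ∈ A, a ≤ u) : IsConnectedPart A := by
  intro X hX ⟨x, hx⟩ ⟨y, hy⟩
  by_cases haX : a ∈ X
  · exact ⟨a, haX, y, hy, Or.inl (h y hy.1)⟩
  · exact ⟨x, hx, a, ⟨ha, haX⟩, Or.inr (h x (hX hx))⟩

/-- With a least and a greatest element the bijection of extremal elements is forced, and symmetry
becomes one equation. -/
theorem isSymPart_of_bounds (hT : IsReflSystem T) {N : ℕ} {A : Set (NC T c)} {a b : NC T c}
    (ha : a ∈ A) (hb : b ∈ A) (hA : ∀ u ∈ A, a ≤ u ∧ u ≤ b) (hN : len T a.1 + len T b.1 = N)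
    (hs : IsSaturated A) : IsSymPart N A where
  connected := isConnectedPart_of_le ha fun u hu => (hA u hu).1
  covBy := hs.covBy hT
  symmetric := by
    have hmin : ∀ p, Minimal (· ∈ A) p ↔ p = a := by
      intro p
      constructor
      · intro hp
        exact hT.nc_antisymm (hp.2 ha (hA p hp.1).1) (hA p hp.1).1
      · rintro rfl
        exact ⟨ha, fun u hu _ => (hA u hu).1⟩
    have hmax : ∀ p, Maximal (· ∈ A) p ↔ p = b := by
      intro p
      constructor
      · intro hp
        exact hT.nc_antisymm (hA p hp.1).2 (hp.2 hb (hA p hp.1).2)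
      · rintro rfl
        exact ⟨hb, fun u hu _ => (hA u hu).2⟩
    refine ⟨⟨fun _ => ⟨b, (hmax b).2 rfl⟩, fun _ => ⟨a, (hmin a).2 rfl⟩, fun p => ?_, fun q => ?_⟩,
      fun p => ?_⟩
    · exact Subtype.ext ((hmin _).1 p.2).symm
    · exact Subtype.ext ((hmax _).1 q.2).symm
    · rw [hT.height_eq, hT.height_eq, (hmin _).1 p.2, ← hN]
      push_cast
      rfl

/-- The elements `t * y` with `y` below `w`. -/
def translate (T : Set W) (c t w : W) : Set (NC T c) := {u | ∃ y, AbsLE T y w ∧ u.1 = t * y}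

/-- Translated intervals are convex: what lies above p lies above t, so t can be cancelled from v ≤
q. -/
theorem mem_translate_of_le_of_le (hT : IsReflSystem T) {t w : W}
    (hl : len T (t * w) = len T t + len T w) {p q v : NC T c} (hp : p ∈ translate T c t w)
    (hq : q ∈ translate T c t w) (hpv : p ≤ v) (hvq : v ≤ q) : v ∈ translate T c t w := by
  obtain ⟨y, hy, hp⟩ := hp
  obtain ⟨z, hz, hq⟩ := hq
  refine ⟨t⁻¹ * v.1, ?_, by simp⟩
  have h1 : AbsLE T t v.1 := by
    refine AbsLE.trans ?_ hpv
    rw [hp]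
    exact hT.absLE_mul_iff.2 (hT.len_mul_of_absLE hl hy)
  have h3 := hT.absLE_iff.1 h1
  have h4 : AbsLE T (t * (t⁻¹ * v.1)) (t * z) := by
    rw [mul_inv_cancel_left, ← hq]; exact hvq
  refine ((hT.mul_absLE_mul_iff ?_ (hT.len_mul_of_absLE hl hz)).1 h4).trans hz
  rwa [mul_inv_cancel_left]

theorem translate_isSymPart (hT : IsReflSystem T) {N : ℕ} {t w : W}
    (hl : len T (t * w) = len T t + len T w) (hc : AbsLE T (t * w) c)
    (hN : 2 * len T t + len T w = N) : IsSymPart N (translate T c t w) := by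
  have key : ∀ y, AbsLE T y w → AbsLE T (t * y) c := fun y hy => (hT.mul_absLE_mul hl hy).trans hc
  refine isSymPart_of_bounds hT (a := NC.of hT (hT.absLE_mul_iff.2 hl |>.trans hc))
    (b := NC.of hT hc) ⟨1, hT.one_absLE w, (mul_one t).symm⟩ ⟨w, AbsLE.refl T w, rfl⟩ ?_ ?_ ?_
  · rintro u ⟨y, hy, hu⟩
    rw [NC.le_def, NC.le_def, hu]
    exact ⟨hT.absLE_mul_iff.2 (hT.len_mul_of_absLE hl hy), hT.mul_absLE_mul hl hy⟩
  · change len T t + len T (t * w) = N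
    omega
  · intro p hp q hq hpq h2
    obtain ⟨v, hv1, hv2, hv⟩ := hT.nc_exists_between hpq (k := len T p.1 + 1) (by omega) (by omega)
    exact ⟨v, mem_translate_of_le_of_le hT hl hp hq hv1 hv2, hv1, hv2, by omega, by omega⟩

theorem nonempty_translate_orderIso (hT : IsReflSystem T) {t w : W}
    (hl : len T (t * w) = len T t + len T w) (hc : AbsLE T (t * w) c) :
    Nonempty (translate T c t w ≃o NC T w) := by
  let f : NC T w → translate T c t w := fun y =>
    ⟨NC.of hT ((hT.mul_absLE_mul hl y.2.2).trans hc), y.1, y.2.2, rfl⟩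
  have hf : Function.Bijective f := by
    refine ⟨fun y z h => NC.ext (mul_left_cancel (a := t) ?_), fun u => ?_⟩
    · exact congrArg (fun u : translate T c t w => u.1.1) h
    · obtain ⟨y, hy, hu⟩ := u.2
      exact ⟨NC.of hT hy, Subtype.ext (NC.ext hu.symm)⟩
  refine ⟨OrderIso.symm ⟨Equiv.ofBijective f hf, ?_⟩⟩
  intro y z
  exact hT.mul_absLE_mul_iff (hT.len_mul_of_absLE hl y.2.2) (hT.len_mul_of_absLE hl z.2.2)

/-- The hypotheses under which `t [1, w] ⊎ t r [1, w]` is a product of a two-element chain and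
`[1, w]`. -/
structure IsDoubled (T : Set W) (c t r w : W) : Prop where
  len_eq : len T (t * r * w) = len T t + 1 + len T w
  len_r : len T r = 1
  le : AbsLE T (t * r * w) c
  -- These two conditions give the order of a product with a chain: r y is never below an element of
  -- [1, w], and y is below r z only if it is already below z.
  not_le : ∀ y, AbsLE T y w → ¬ AbsLE T (r * y) w
  absLE : ∀ y z, AbsLE T y w → AbsLE T z w → AbsLE T y (r * z) → AbsLE T y z

namespace IsDoubled

variable (hT : IsReflSystem T) {t r w : W} (h : IsDoubled T c t r w)
include hT h

theorem len_t_mul (x : W) (hx : AbsLE T x (r * w)) : len T (t * x) = len T t + len T x := by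
  have h1 := h.len_eq
  have h2 := hT.len_mul_le t (r * w)
  have h3 := hT.len_mul_le r w
  rw [← mul_assoc] at h2
  have := h.len_r
  exact hT.len_mul_of_absLE (w := r * w) (by rw [← mul_assoc]; omega) hx

theorem len_rw : len T (r * w) = len T r + len T w := by
  have h1 := h.len_eq
  have h2 := hT.len_mul_le t (r * w)
  have h3 := hT.len_mul_le r w
  rw [← mul_assoc] at h2
  have := h.len_r
  omega

theorem absLE_rw {y : W} (hy : AbsLE T y w) : AbsLE T y (r * w) :=
  hy.trans (hT.absLE_mul_right (h.len_rw hT))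

theorem rabsLE_rw {y : W} (hy : AbsLE T y w) : AbsLE T (r * y) (r * w) :=
  hT.mul_absLE_mul (h.len_rw hT) hy

theorem len_r_mul {y : W} (hy : AbsLE T y w) : len T (r * y) = len T y + 1 := by
  rw [hT.len_mul_of_absLE (h.len_rw hT) hy, h.len_r, add_comm]

theorem t_absLE {x : W} (hx : AbsLE T x (r * w)) : AbsLE T (t * x) c := by
  refine (hT.mul_absLE_mul (h.len_t_mul hT _ (AbsLE.refl T _)) hx).trans ?_
  rw [← mul_assoc]
  exact h.le

theorem t_absLE_iff {x y : W} (hx : AbsLE T x (r * w)) (hy : AbsLE T y (r * w)) :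
    AbsLE T (t * x) (t * y) ↔ AbsLE T x y :=
  hT.mul_absLE_mul_iff (h.len_t_mul hT x hx) (h.len_t_mul hT y hy)

/-- The element of the doubled part with coordinates `b` and `y`. -/
def elt (b : Fin 2) (y : NC T w) : NC T c :=
  if b = 0 then NC.of hT (h.t_absLE hT (h.absLE_rw hT y.2.2))
  else NC.of hT (h.t_absLE hT (h.rabsLE_rw hT y.2.2))

theorem elt_le_elt_iff (a b : Fin 2) (y z : NC T w) :
    h.elt hT a y ≤ h.elt hT b z ↔ a ≤ b ∧ y ≤ z := by
  have hy := h.absLE_rw hT y.2.2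
  have hz := h.absLE_rw hT z.2.2
  have hry := h.rabsLE_rw hT y.2.2
  have hrz := h.rabsLE_rw hT z.2.2
  have key : ∀ {x x'} (hx : AbsLE T x c) (hx' : AbsLE T x' c),
    NC.of hT hx ≤ NC.of hT hx' ↔ AbsLE T x x' := fun _ _ => Iff.rfl
  have hr := hT.mul_absLE_mul_iff (t := r) (u := y.1) (v := z.1)
    (by rw [h.len_r_mul hT y.2.2, h.len_r, add_comm])
    (by rw [h.len_r_mul hT z.2.2, h.len_r, add_comm])
  fin_cases a <;> fin_cases b <;> simp [elt]
  · rw [key, h.t_absLE_iff hT hy hz]; rfl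
  · rw [key, h.t_absLE_iff hT hy hrz]
    refine ⟨h.absLE _ _ y.2.2 z.2.2, fun h' => AbsLE.trans h' (hT.absLE_mul_right ?_)⟩
    rw [h.len_r_mul hT z.2.2, h.len_r, add_comm]
  · rw [key, h.t_absLE_iff hT hry hz]
    exact fun h' => h.not_le _ y.2.2 (h'.trans z.2.2)
  · rw [key, h.t_absLE_iff hT hry hrz, hr]; rfl

theorem mem_iff {u : NC T c} :
    u ∈ translate T c t w ∪ translate T c (t * r) w ↔ ∃ b y, h.elt hT b y = u := by
  constructor
  · rintro (⟨y, hy, hu⟩ | ⟨y, hy, hu⟩)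
    · exact ⟨0, NC.of hT hy, NC.ext hu.symm⟩
    · exact ⟨1, NC.of hT hy, NC.ext (by rw [hu, mul_assoc]; rfl)⟩
  · rintro ⟨b, y, rfl⟩
    fin_cases b
    · exact Or.inl ⟨y.1, y.2.2, rfl⟩
    · exact Or.inr ⟨y.1, y.2.2, (mul_assoc t r y.1).symm⟩

theorem len_elt (b : Fin 2) (y : NC T w) :
    len T (h.elt hT b y).1 = len T t + b + len T y.1 := by
  fin_cases b
  · exact h.len_t_mul hT _ (h.absLE_rw hT y.2.2)
  · have := h.len_t_mul hT _ (h.rabsLE_rw hT y.2.2)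
    rw [h.len_r_mul hT y.2.2] at this
    change len T (t * (r * y.1)) = len T t + 1 + len T y.1
    omega

theorem isSymPart {N : ℕ} (hN : 2 * len T t + 1 + len T w = N) :
    IsSymPart N (translate T c t w ∪ translate T c (t * r) w) := by
  refine isSymPart_of_bounds hT (a := h.elt hT 0 (NC.of hT (hT.one_absLE w)))
    (b := h.elt hT 1 (NC.of hT (AbsLE.refl T w))) ((h.mem_iff hT).2 ⟨_, _, rfl⟩)
    ((h.mem_iff hT).2 ⟨_, _, rfl⟩) ?_ ?_ ?_
  · intro u hu
    obtain ⟨b, y, rfl⟩ := (h.mem_iff hT).1 hu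
    rw [h.elt_le_elt_iff hT, h.elt_le_elt_iff hT]
    exact ⟨⟨Fin.zero_le _, hT.one_absLE _⟩, Fin.le_last _, y.2.2⟩
  · rw [h.len_elt hT, h.len_elt hT]
    have : len T (NC.of hT (hT.one_absLE w)).1 = 0 := hT.len_one
    have : len T (NC.of hT (AbsLE.refl T w)).1 = len T w := rfl
    simp only [Fin.val_zero, Fin.val_one]
    omega
  · intro p hp q hq hpq hl
    obtain ⟨a, y, rfl⟩ := (h.mem_iff hT).1 hp
    obtain ⟨b, z, rfl⟩ := (h.mem_iff hT).1 hq
    rw [h.len_elt hT, h.len_elt hT] at hl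
    obtain ⟨hab, hyz⟩ := (h.elt_le_elt_iff hT _ _ _ _).1 hpq
    obtain ⟨x, hyx, hxz, hx⟩ := hT.nc_exists_between hyz (k := len T y.1 + 1) (by omega)
      (by omega)
    refine ⟨h.elt hT a x, (h.mem_iff hT).2 ⟨_, _, rfl⟩, (h.elt_le_elt_iff hT _ _ _ _).2
      ⟨le_rfl, hyx⟩, (h.elt_le_elt_iff hT _ _ _ _).2 ⟨hab, hxz⟩, ?_, ?_⟩
    · rw [h.len_elt hT, h.len_elt hT]; omega
    · rw [h.len_elt hT, h.len_elt hT]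
      have : (a : ℕ) ≤ b := hab
      omega

theorem nonempty_orderIso :
    Nonempty (↥(translate T c t w ∪ translate T c (t * r) w) ≃o Fin 2 × NC T w) := by
  let f : Fin 2 × NC T w → ↥(translate T c t w ∪ translate T c (t * r) w) := fun p =>
    ⟨h.elt hT p.1 p.2, (h.mem_iff hT).2 ⟨_, _, rfl⟩⟩
  have hle : ∀ p q, f p ≤ f q ↔ p ≤ q := fun p q => h.elt_le_elt_iff hT p.1 q.1 p.2 q.2
  have hf : Function.Bijective f := by
    refine ⟨fun p q hpq => ?_, fun u => ?_⟩
    · have h1 := (hle p q).1 (le_of_eq hpq)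
      have h2 := (hle q p).1 (le_of_eq hpq.symm)
      exact Prod.ext (le_antisymm h1.1 h2.1) (hT.nc_antisymm h1.2 h2.2)
    · obtain ⟨b, y, hu⟩ := (h.mem_iff hT).1 u.2
      exact ⟨(b, y), Subtype.ext hu⟩
  exact ⟨OrderIso.symm ⟨Equiv.ofBijective f hf, hle _ _⟩⟩

end IsDoubled

end Parts

end GddNC

namespace GddNC

/-! ### Coloured permutations, reflections and fixed vectors -/

section Monomial

variable {d n : ℕ}

/-- Lets membership be checked without exhibiting the permutation and the colours. The index map is
injective because two coloured integers with the same index differ by a colour shift, and w commutes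
with such shifts. -/
theorem mem_G_iff {w : Equiv.Perm (Fin n × ZMod d)} :
    w ∈ G d n ↔ (∀ k r, w (k, r) = ((w (k, 0)).1, (w (k, 0)).2 + r)) ∧
      ∑ k, (w (k, 0)).2 = 0 := by
  constructor
  · rintro ⟨π, t, ht, rfl⟩
    simp [monomialPerm, ht, add_comm]
  · rintro ⟨h1, h2⟩
    have hinj : Function.Injective fun k => (w (k, 0)).1 := by
      intro k k' hk
      have : w (k, 0) = w (k', (w (k, 0)).2 - (w (k', 0)).2) := by
        rw [h1 k']
        ext
        · exact congrArg _ hk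
        · simp
      exact congrArg Prod.fst (w.injective this)
    refine ⟨Equiv.ofBijective _ (Finite.injective_iff_bijective.1 hinj),
      fun k => (w (k, 0)).2, h2, ?_⟩
    ext ⟨k, r⟩
    · rw [h1]; simp [monomialPerm]
    · rw [h1]; simp [monomialPerm, add_comm]

theorem G.apply_eq (w : G d n) (k : Fin n) (r s : ZMod d) :
    w.1 (k, r) = ((w.1 (k, s)).1, (w.1 (k, s)).2 + (r - s)) := by
  have h := (mem_G_iff.1 w.2).1
  rw [h k r, h k s]
  ext <;> simp [add_assoc]

theorem G.sum_eq_zero (w : G d n) : ∑ k, (w.1 (k, 0)).2 = 0 := (mem_G_iff.1 w.2).2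

theorem G.ext' {u v : G d n} (h : ∀ k, u.1 (k, 0) = v.1 (k, 0)) : u = v := by
  refine Subtype.ext (Equiv.ext fun ⟨k, r⟩ => ?_)
  rw [G.apply_eq u k r 0, G.apply_eq v k r 0, h]

theorem G.mul_apply (u v : G d n) (x : Fin n × ZMod d) : (u * v).1 x = u.1 (v.1 x) := rfl

theorem G.one_apply (x : Fin n × ZMod d) : (1 : G d n).1 x = x := rfl

theorem G.inv_apply_eq {u : G d n} {x y : Fin n × ZMod d} : u⁻¹.1 x = y ↔ u.1 y = x :=
  ⟨fun h => by rw [← h]; simp, fun h => by rw [← h]; simp⟩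

theorem G.fst_eq_iff (w : G d n) (x y : Fin n × ZMod d) : (w.1 x).1 = (w.1 y).1 ↔ x.1 = y.1 := by
  obtain ⟨k, r⟩ := x
  obtain ⟨j, s⟩ := y
  constructor
  · intro h
    have : w.1 (k, r) = w.1 (j, s + ((w.1 (k, r)).2 - (w.1 (j, s)).2)) := by
      rw [G.apply_eq w j _ s]
      ext
      · exact congrArg Fin.val h
      · simp
    have h2 := w.1.injective this
    exact (Prod.ext_iff.1 h2).1
  · rintro rfl
    rw [G.apply_eq w k r s]

theorem G.fix_color {w : G d n} {k : Fin n} {r : ZMod d} (h : w.1 (k, r) = (k, r)) (s : ZMod d) :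
    w.1 (k, s) = (k, s) := by
  rw [G.apply_eq w k s r, h]; simp

theorem G.fst_ne_of_fix {w : G d n} {k i : Fin n} (hi : w.1 (i, 0) = (i, 0)) (hk : k ≠ i)
    (r : ZMod d) : (w.1 (k, r)).1 ≠ i := by
  intro h
  apply hk
  rw [← (G.fst_eq_iff w (k, r) (i, 0)), hi, h]

theorem colRefl_apply {a b : Fin n} (hab : a ≠ b) (s : ZMod d) (z : Fin n × ZMod d) :
    (colRefl a b s).1 z = if z.1 = a then (b, z.2 + s) else if z.1 = b then (a, z.2 - s) else z := by
  obtain ⟨k, r⟩ := z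
  simp only [colRefl, G.mk, monomialPerm, Equiv.coe_fn_mk, Pi.add_apply, Pi.single_apply]
  by_cases h1 : k = a
  · subst h1; simp [hab]
  · by_cases h2 : k = b
    · subst h2; simp [h1, sub_eq_add_neg]
    · simp [h1, h2, Equiv.swap_apply_of_ne_of_ne]

/-- The reflection that interchanges the coloured integers `x` and `y`. -/
def refl (x y : Fin n × ZMod d) : G d n := colRefl x.1 y.1 (y.2 - x.2)

theorem colRefl_eq_refl (a b : Fin n) (s : ZMod d) : colRefl a b s = refl (a, 0) (b, s) := by
  simp [refl]

theorem refl_apply {x y : Fin n × ZMod d} (h : x.1 ≠ y.1) (z : Fin n × ZMod d) :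
    (refl x y).1 z = if z.1 = x.1 then (y.1, z.2 + (y.2 - x.2)) else
      if z.1 = y.1 then (x.1, z.2 - (y.2 - x.2)) else z := colRefl_apply h _ z

theorem refl_left {x y : Fin n × ZMod d} (h : x.1 ≠ y.1) : (refl x y).1 x = y := by
  simp [refl_apply h]

theorem refl_right {x y : Fin n × ZMod d} (h : x.1 ≠ y.1) : (refl x y).1 y = x := by
  simp [refl_apply h, h.symm]

theorem refl_of_ne {x y z : Fin n × ZMod d} (h : x.1 ≠ y.1) (h1 : z.1 ≠ x.1) (h2 : z.1 ≠ y.1) :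
    (refl x y).1 z = z := by
  simp [refl_apply h, h1, h2]

theorem refl_mul_self {x y : Fin n × ZMod d} (h : x.1 ≠ y.1) : refl x y * refl x y = 1 := by
  refine G.ext' fun k => ?_
  rw [G.mul_apply, G.one_apply, refl_apply h (k, 0)]
  split_ifs with h1 h2
  · subst h1; simp [refl_apply h, h.symm]
  · subst h2; simp [refl_apply h]
  · rw [refl_of_ne h h1 h2]

theorem refl_inv {x y : Fin n × ZMod d} (h : x.1 ≠ y.1) : (refl x y)⁻¹ = refl x y :=
  inv_eq_of_mul_eq_one_left (refl_mul_self h)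

theorem refl_mul_cancel_left {x y : Fin n × ZMod d} (h : x.1 ≠ y.1) (w : G d n) :
    refl x y * (refl x y * w) = w := by
  rw [← mul_assoc, refl_mul_self h, one_mul]

theorem refl_comm {x y : Fin n × ZMod d} (h : x.1 ≠ y.1) : refl x y = refl y x := by
  refine G.ext' fun k => ?_
  rw [refl_apply h, refl_apply h.symm]
  dsimp only
  split_ifs with h1 h2
  · exact absurd (h1.symm.trans h2) h
  · simp
  · simp
  · rfl

theorem refl_congr {x y x' y' : Fin n × ZMod d} (hx : x.1 = x'.1) (hy : y.1 = y'.1)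
    (h : y.2 - x.2 = y'.2 - x'.2) : refl x y = refl x' y' := by
  unfold refl
  rw [hx, hy, h]

/-- Conjugation transports the two coloured integers that a reflection exchanges. This is the rule
by which reflections are moved past each other in all later computations. -/
theorem mul_refl (g : G d n) {x y : Fin n × ZMod d} (h : x.1 ≠ y.1) :
    g * refl x y = refl (g.1 x) (g.1 y) * g := by
  have h' : (g.1 x).1 ≠ (g.1 y).1 := by rwa [Ne, G.fst_eq_iff]
  refine G.ext' fun k => ?_
  rw [G.mul_apply, G.mul_apply, refl_apply h, refl_apply h']
  simp only [G.fst_eq_iff]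
  split_ifs with h1 h2
  · subst h1
    rw [G.apply_eq g y.1 _ y.2, G.apply_eq g x.1 0 x.2]
    ext
    · rfl
    · simp; ring
  · subst h2
    rw [G.apply_eq g x.1 _ x.2, G.apply_eq g y.1 0 y.2]
    ext
    · rfl
    · simp; ring
  · rfl

/-! ### Fixed vectors -/

section FixedSpace

variable [NeZero d]

theorem exp_pow_val (r : ZMod d) :
    Complex.exp (2 * Real.pi * Complex.I / d) ^ r.val = ZMod.stdAddChar r := by
  rw [← Complex.exp_nat_mul]
  have := ZMod.stdAddChar_coe (N := d) (r.val : ℤ)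
  simp only [Int.cast_natCast, ZMod.natCast_zmod_val] at this
  rw [this]
  congr 1
  ring

theorem mem_fixedSpace_iff {w : G d n} {v : Fin n → ℂ} :
    v ∈ fixedSpace w ↔
      ∀ k, ZMod.stdAddChar (w.1 (k, 0)).2 * v k = v (w.1 (k, 0)).1 := by
  have key : ∀ k, ((toMatrix w).mulVec v) (w.1 (k, 0)).1 = ZMod.stdAddChar (w.1 (k, 0)).2 * v k := by
    intro k
    simp only [Matrix.mulVec, dotProduct, toMatrix, Matrix.of_apply, exp_pow_val]
    rw [Finset.sum_eq_single k]
    · simp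
    · intro j _ hj
      rw [if_neg, zero_mul]
      rw [G.fst_eq_iff]
      exact fun h => hj h.symm
    · simp
  have hsurj : ∀ i, ∃ k, (w.1 (k, 0)).1 = i := by
    have : Function.Injective fun k => (w.1 (k, 0)).1 := fun a b h => (G.fst_eq_iff w _ _).1 h
    exact Finite.surjective_of_injective this
  unfold fixedSpace
  rw [LinearMap.mem_eqLocus]
  simp only [Matrix.mulVecLin_apply, LinearMap.id_apply]
  constructor
  · intro h k
    rw [← key, h]
  · intro h
    funext i
    obtain ⟨k, rfl⟩ := hsurj i
    rw [key, h]

/-- A vector v is read as the function x ↦ ζ^(-x.2) v(x.1) on coloured integers; being fixed means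
that this function is invariant under w, which is evidently compatible with products. -/
theorem mem_fixedSpace_iff' {w : G d n} {v : Fin n → ℂ} :
    v ∈ fixedSpace w ↔
      ∀ x, ZMod.stdAddChar (-(w.1 x).2) * v (w.1 x).1 = ZMod.stdAddChar (-x.2) * v x.1 := by
  rw [mem_fixedSpace_iff]
  constructor
  · rintro h ⟨k, r⟩
    rw [G.apply_eq w k r 0]
    dsimp only
    rw [← h, ← mul_assoc, ← AddChar.map_add_eq_mul]
    congr 2
    ring
  · intro h k
    have := h (k, 0)
    simp only [neg_zero, AddChar.map_zero_eq_one, one_mul] at this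
    rw [← this, ← mul_assoc, ← AddChar.map_add_eq_mul]
    simp

theorem mem_fixedSpace_mul {u w : G d n} {v : Fin n → ℂ} (hu : v ∈ fixedSpace u)
    (hw : v ∈ fixedSpace w) : v ∈ fixedSpace (u * w) := by
  rw [mem_fixedSpace_iff'] at *
  intro x
  rw [G.mul_apply, hu, hw]

theorem stdAddChar_eq_one_iff {r : ZMod d} : ZMod.stdAddChar r = 1 ↔ r = 0 := by
  rw [← AddChar.map_zero_eq_one (ZMod.stdAddChar (N := d))]
  exact (ZMod.injective_stdAddChar (N := d)).eq_iff

theorem stdAddChar_ne_zero (r : ZMod d) : ZMod.stdAddChar r ≠ (0 : ℂ) := by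
  intro h
  have := AddChar.map_add_eq_mul (ZMod.stdAddChar (N := d)) r (-r)
  simp [h] at this

theorem single_mem_fixedSpace_iff {w : G d n} {i : Fin n} :
    Pi.single i 1 ∈ fixedSpace w ↔ w.1 (i, 0) = (i, 0) := by
  rw [mem_fixedSpace_iff]
  constructor
  · intro h
    have h1 := h i
    rw [Pi.single_eq_same, mul_one] at h1
    by_cases hi : (w.1 (i, 0)).1 = i
    · rw [hi, Pi.single_eq_same, stdAddChar_eq_one_iff] at h1
      exact Prod.ext hi h1
    · rw [Pi.single_eq_of_ne hi] at h1
      exact absurd h1 (stdAddChar_ne_zero _)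
  · intro h k
    by_cases hk : k = i
    · subst hk; simp [h]
    · rw [Pi.single_eq_of_ne hk, Pi.single_eq_of_ne, mul_zero]
      intro h'
      apply hk
      rw [← (G.fst_eq_iff w (k, 0) (i, 0)), h, h']

/-- The linear form whose kernel is the hyperplane fixed by `colRefl k j s`. -/
noncomputable def form (k j : Fin n) (s : ZMod d) : (Fin n → ℂ) →ₗ[ℂ] ℂ :=
  ZMod.stdAddChar s • LinearMap.proj k - LinearMap.proj j

theorem mem_ker_form {k j : Fin n} {s : ZMod d} {v : Fin n → ℂ} :
    v ∈ LinearMap.ker (form k j s) ↔ ZMod.stdAddChar s * v k = v j := by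
  simp [form, sub_eq_zero]

theorem finrank_ker_form {k j : Fin n} {s : ZMod d} (h : (j, s) ≠ (k, 0)) :
    Module.finrank ℂ (LinearMap.ker (form k j s)) + 1 = n := by
  have : form k j s ≠ 0 := by
    intro h0
    have h1 := LinearMap.congr_fun h0 (Pi.single k 1)
    by_cases hjk : j = k
    · subst hjk
      simp only [form, LinearMap.sub_apply, LinearMap.smul_apply, LinearMap.proj_apply,
        Pi.single_eq_same, LinearMap.zero_apply, smul_eq_mul, mul_one, sub_eq_zero] at h1
      rw [stdAddChar_eq_one_iff] at h1
      exact h (by rw [h1])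
    · simp only [form, LinearMap.sub_apply, LinearMap.smul_apply, LinearMap.proj_apply,
        Pi.single_eq_same, LinearMap.zero_apply, smul_eq_mul, mul_one,
        Pi.single_eq_of_ne hjk, sub_zero] at h1
      exact stdAddChar_ne_zero _ h1
  have h2 := Module.Dual.finrank_ker_add_one_of_ne_zero (K := ℂ) (f := form k j s) this
  simpa using h2

theorem colRefl_mem_reflections {a b : Fin n} (hab : a ≠ b) (s : ZMod d) :
    colRefl a b s ∈ reflections d n := by
  have : fixedSpace (colRefl a b s) = LinearMap.ker (form a b s) := by
    ext v
    rw [mem_fixedSpace_iff, mem_ker_form]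
    constructor
    · intro h
      have := h a
      simpa [colRefl_apply hab] using this
    · intro h k
      rw [colRefl_apply hab]
      dsimp only
      split_ifs with h1 h2
      · subst h1; simpa using h
      · subst h2
        simp only [zero_sub]
        rw [← h, ← mul_assoc, ← AddChar.map_add_eq_mul]
        simp
      · simp
  change Module.finrank ℂ (fixedSpace _) + 1 = n
  rw [this]
  exact finrank_ker_form fun h => hab (congrArg Prod.fst h).symm

theorem refl_mem_reflections {x y : Fin n × ZMod d} (h : x.1 ≠ y.1) :
    refl x y ∈ reflections d n := colRefl_mem_reflections h _

/-- If w moves k^(0) to j^(s), the hyperplane of fixed vectors is the kernel of `form k j s`, so the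
basis vectors other than the k-th and the j-th are fixed. For j = k the product-one condition would
make s trivial; otherwise it makes the colour at j opposite to s. -/
theorem exists_eq_refl {w : G d n} (h : w ∈ reflections d n) :
    ∃ x y : Fin n × ZMod d, x.1 ≠ y.1 ∧ w = refl x y := by
  have h' : Module.finrank ℂ (fixedSpace w) + 1 = n := h
  obtain ⟨k, hk⟩ : ∃ k, w.1 (k, 0) ≠ (k, 0) := by
    by_contra hno
    push Not at hno
    have : fixedSpace w = ⊤ := by
      rw [eq_top_iff]
      intro v _
      rw [mem_fixedSpace_iff]
      intro k
      simp [hno k]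
    rw [this] at h'
    simp at h'
  obtain ⟨⟨j, s⟩, hjs⟩ : ∃ y, w.1 (k, 0) = y := ⟨_, rfl⟩
  rw [hjs] at hk
  have hle : fixedSpace w ≤ LinearMap.ker (form k j s) := by
    intro v hv
    rw [mem_ker_form]
    have := mem_fixedSpace_iff.1 hv k
    rwa [hjs] at this
  have heq := Submodule.eq_of_le_of_finrank_eq hle (by have := finrank_ker_form hk; omega)
  have hfix : ∀ i, i ≠ k → i ≠ j → w.1 (i, 0) = (i, 0) := by
    intro i hik hij
    rw [← single_mem_fixedSpace_iff, heq, mem_ker_form, Pi.single_eq_of_ne hik.symm,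
      Pi.single_eq_of_ne hij.symm, mul_zero]
  have hsum := G.sum_eq_zero w
  by_cases hjk : j = k
  · subst hjk
    rw [Finset.sum_eq_single j (fun i _ hi => by rw [hfix i hi hi]) (by simp), hjs] at hsum
    exact absurd (by rw [← hsum]) hk
  · have h1 : (w.1 (j, 0)).1 = k := by
      by_contra hne
      by_cases hj : (w.1 (j, 0)).1 = j
      · have := (G.fst_eq_iff w (k, 0) (j, 0)).1 (by rw [hjs, hj])
        exact hjk this.symm
      · exact G.fst_ne_of_fix (hfix _ hne hj) (fun h => hj h.symm) 0 rfl
    rw [← Finset.sum_subset (Finset.subset_univ {k, j}), Finset.sum_pair (Ne.symm hjk), hjs] at hsum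
    · refine ⟨(k, 0), (j, s), Ne.symm hjk, G.ext' fun i => ?_⟩
      have hkj : ((k, 0) : Fin n × ZMod d).1 ≠ ((j, s) : Fin n × ZMod d).1 := Ne.symm hjk
      by_cases hik : i = k
      · subst hik; rw [hjs, refl_left hkj]
      · by_cases hij : i = j
        · subst hij
          rw [refl_apply hkj]
          simp only [hik, if_false, if_true]
          ext
          · exact congrArg _ h1
          · simp only [sub_zero, zero_sub]
            exact eq_neg_of_add_eq_zero_right hsum
        · rw [hfix i hik hij, refl_of_ne hkj hik hij]
    · intro i _ hi
      simp only [Finset.mem_insert, Finset.mem_singleton, not_or] at hi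
      rw [hfix i hi.1 hi.2]

end FixedSpace

end Monomial

end GddNC

namespace GddNC

/-! ### Reflection length in G(d,d,n): cutting and tightness -/

section Length

variable {d n : ℕ}

/-- The indices that are moved by `w` (possibly only in their colour). -/
def moved (w : G d n) : Finset (Fin n) := {k | w.1 (k, 0) ≠ (k, 0)}

theorem mem_moved {w : G d n} {k : Fin n} : k ∈ moved w ↔ w.1 (k, 0) ≠ (k, 0) := by simp [moved]

variable [NeZero d]

/-- Induction on the number of moved indices. One reflection repairs an index sent to another index.
If k only changes its colour by r, the product-one condition provides a second moved index a, and
((k^(0) a^(0))) followed by ((k^(0) a^(r))) repairs k. -/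
theorem exists_reflection_word (w : G d n) :
    ∃ l : List (G d n), (∀ t ∈ l, t ∈ reflections d n) ∧ l.prod = w := by
  obtain ⟨m, hm⟩ : ∃ m, (moved w).card = m := ⟨_, rfl⟩
  induction m using Nat.strong_induction_on generalizing w with
  | _ m ih =>
    have step : ∀ (l : List (G d n)) (v : G d n), (∀ t ∈ l, t ∈ reflections d n) →
        l.prod * v = w → moved v ⊂ moved w →
        ∃ l : List (G d n), (∀ t ∈ l, t ∈ reflections d n) ∧ l.prod = w := by
      intro l v hl hv hlt
      obtain ⟨l', h1, h2⟩ := ih _ (hm ▸ Finset.card_lt_card hlt) v rfl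
      refine ⟨l ++ l', fun t ht => (List.mem_append.1 ht).elim (hl t) (h1 t), ?_⟩
      rw [List.prod_append, h2, hv]
    by_cases hw : moved w = ∅
    · refine ⟨[], by simp, G.ext' fun k => ?_⟩
      by_contra hk
      have : k ∈ moved w := mem_moved.2 fun h => hk h.symm
      simp [hw] at this
    obtain ⟨k, hk⟩ := Finset.nonempty_iff_ne_empty.2 hw
    have hk' := mem_moved.1 hk
    by_cases h : (w.1 (k, 0)).1 = k
    · obtain ⟨a, hak, ha⟩ : ∃ a, a ≠ k ∧ a ∈ moved w := by
        by_contra hno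
        push Not at hno
        have hs := G.sum_eq_zero w
        rw [Finset.sum_eq_single k] at hs
        · exact hk' (Prod.ext h hs)
        · intro j _ hj
          have := mt mem_moved.2 (hno j hj)
          rw [not_not] at this
          rw [this]
        · simp
      obtain ⟨r, hr⟩ : ∃ r, w.1 (k, 0) = (k, r) := ⟨_, Prod.ext h rfl⟩
      have h1 : ((k, 0) : Fin n × ZMod d).1 ≠ ((a, 0) : Fin n × ZMod d).1 := hak.symm
      have h2 : ((k, 0) : Fin n × ZMod d).1 ≠ ((a, r) : Fin n × ZMod d).1 := hak.symm
      refine step [refl (k, 0) (a, 0), refl (k, 0) (a, r)]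
        (refl (k, 0) (a, r) * (refl (k, 0) (a, 0) * w)) ?_ ?_ ?_
      · simp [refl_mem_reflections, hak.symm]
      · simp [mul_assoc, refl_mul_cancel_left h1, refl_mul_cancel_left h2]
      · refine (Finset.ssubset_iff_of_subset ?_).2 ⟨k, hk, ?_⟩
        · intro j hj
          by_contra hj'
          have hjk : j ≠ k := fun e => hj' (e ▸ hk)
          have hja : j ≠ a := fun e => hj' (e ▸ ha)
          rw [mem_moved, not_not] at hj'
          apply mem_moved.1 hj
          rw [G.mul_apply, G.mul_apply, hj', refl_of_ne h1 hjk hja, refl_of_ne h2 hjk hja]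
        · rw [mem_moved, not_not, G.mul_apply, G.mul_apply, hr, refl_apply h1]
          simp [refl_apply h2, hak]
    · have h1 : ((k, 0) : Fin n × ZMod d).1 ≠ (w.1 (k, 0)).1 := Ne.symm h
      refine step [refl (k, 0) (w.1 (k, 0))] (refl (k, 0) (w.1 (k, 0)) * w) ?_ ?_ ?_
      · simpa using refl_mem_reflections h1
      · simp [refl_mul_cancel_left h1]
      · refine (Finset.ssubset_iff_of_subset ?_).2 ⟨k, hk, ?_⟩
        · intro j hj
          by_contra hj'
          have hjk : j ≠ k := fun e => hj' (e ▸ hk)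
          rw [mem_moved, not_not] at hj'
          apply mem_moved.1 hj
          rw [G.mul_apply, hj', refl_of_ne h1 hjk]
          exact (G.fst_ne_of_fix hj' hjk.symm 0).symm
        · rw [mem_moved, not_not, G.mul_apply, refl_right h1]

theorem isReflSystem (d n : ℕ) [NeZero d] : IsReflSystem (reflections d n) where
  gen := exists_reflection_word
  conj g t ht := by
    obtain ⟨x, y, h, rfl⟩ := exists_eq_refl ht
    rw [mul_refl g h, mul_inv_cancel_right]
    exact refl_mem_reflections (by rwa [Ne, G.fst_eq_iff])

/-- The length function of `G(d,d,n)`. -/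
noncomputable abbrev lg (w : G d n) : ℕ := len (reflections d n) w

/-- The absolute order of `G(d,d,n)`. -/
abbrev ale (u v : G d n) : Prop := AbsLE (reflections d n) u v

theorem lg_refl_le {x y : Fin n × ZMod d} (h : x.1 ≠ y.1) : lg (refl x y) ≤ 1 :=
  (isReflSystem d n).len_le_one (refl_mem_reflections h)

theorem lg_refl {x y : Fin n × ZMod d} (h : x.1 ≠ y.1) : lg (refl x y) = 1 := by
  refine le_antisymm (lg_refl_le h) ?_
  by_contra h0
  have h1 := (isReflSystem d n).eq_one_of_len (w := refl x y) (by unfold lg at h0; omega)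
  have := refl_left h
  rw [h1, G.one_apply] at this
  exact h (by rw [this])

theorem lg_le_refl_mul {x y : Fin n × ZMod d} (h : x.1 ≠ y.1) (w : G d n) :
    lg w ≤ lg (refl x y * w) + 1 := by
  have h1 := (isReflSystem d n).len_mul_le (refl x y) (refl x y * w)
  rw [refl_mul_cancel_left h] at h1
  have h2 := lg_refl_le h
  unfold lg at *
  omega

theorem lg_refl_mul_le {x y : Fin n × ZMod d} (h : x.1 ≠ y.1) (w : G d n) :
    lg (refl x y * w) ≤ lg w + 1 := by
  have h1 := (isReflSystem d n).len_mul_le (refl x y) w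
  have h2 := lg_refl_le h
  unfold lg at *
  omega

/-- A reduced factorization of `x` whose first factor has length at most two and whose last factor
fixes `k`. -/
theorem exists_reduction (x : G d n) (k : Fin n) : ∃ y : G d n, y.1 (k, 0) = (k, 0) ∧
    (x = y ∨ (∃ j : Fin n × ZMod d, k ≠ j.1 ∧ x = refl (k, 0) j * y ∧ lg y + 1 ≤ lg x) ∨
      ∃ (a : Fin n × ZMod d) (r : ZMod d), k ≠ a.1 ∧ r ≠ 0 ∧
        x = refl (k, 0) a * (refl (k, 0) (a.1, a.2 + r) * y) ∧ lg y + 2 ≤ lg x) := by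
  have hT := isReflSystem d n
  obtain ⟨m, hm⟩ : ∃ m, len (reflections d n) x = m := ⟨_, rfl⟩
  induction m generalizing x with
  | zero => exact ⟨1, rfl, Or.inl (hT.eq_one_of_len hm)⟩
  | succ m ih =>
    obtain ⟨s, hs, x, rfl, hx⟩ := hT.exists_eq_mul hm
    have hle : ∀ y, lg (s * y) ≤ lg y + 1 := by
      intro y
      have h1 := hT.len_mul_le s y
      have h2 := hT.len_le_one hs
      unfold lg
      omega
    have hlg : ∀ {b c : Fin n × ZMod d}, b.1 ≠ c.1 → ∀ y, lg (refl b c * y) ≤ lg y + 1 :=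
      fun h y => lg_refl_mul_le h y
    obtain ⟨y, hy, h⟩ := ih x hx
    have hsx : lg (s * x) = lg x + 1 := by unfold lg; omega
    by_cases hsk : s.1 (k, 0) = (k, 0)
    -- If s fixes k, it is moved to the right by conjugation, which keeps the shape of the front
    -- factors, and is absorbed into y.
    · refine ⟨s * y, by rw [G.mul_apply, hy, hsk], ?_⟩
      have hs1 : ∀ c : Fin n × ZMod d, k ≠ c.1 → k ≠ (s.1 c).1 := fun c hc h' =>
        G.fst_ne_of_fix hsk (Ne.symm hc) c.2 h'.symm
      rcases h with rfl | ⟨j, hj, rfl, hl⟩ | ⟨a, r, ha, hr, rfl, hl⟩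
      · exact Or.inl rfl
      · refine Or.inr (Or.inl ⟨s.1 j, hs1 j hj, ?_, ?_⟩)
        · rw [← mul_assoc, mul_refl s (show ((k, 0) : Fin n × ZMod d).1 ≠ j.1 from hj), hsk,
            mul_assoc]
        · have := hle y; omega
      · refine Or.inr (Or.inr ⟨s.1 a, r, hs1 a ha, hr, ?_, ?_⟩)
        · rw [← mul_assoc, mul_refl s (show ((k, 0) : Fin n × ZMod d).1 ≠ a.1 from ha), hsk,
            mul_assoc, ← mul_assoc s,
            mul_refl s (show ((k, 0) : Fin n × ZMod d).1 ≠ (a.1, a.2 + r).1 from ha), hsk,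
            mul_assoc, G.apply_eq s a.1 (a.2 + r) a.2]
          simp
        · have := hle y; omega
    · obtain ⟨b, hb, rfl⟩ : ∃ b : Fin n × ZMod d, k ≠ b.1 ∧ s = refl (k, 0) b := by
        obtain ⟨x, y, hxy, rfl⟩ := exists_eq_refl hs
        by_cases h1 : k = x.1
        · subst h1
          exact ⟨(y.1, y.2 - x.2), hxy, refl_congr rfl rfl (by simp)⟩
        · by_cases h2 : k = y.1
          · subst h2
            refine ⟨(x.1, x.2 - y.2), hxy.symm, ?_⟩
            rw [refl_comm hxy]
            exact refl_congr rfl rfl (by simp)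
          · exact absurd (refl_of_ne hxy h1 h2) hsk
      have hb' : ((k, 0) : Fin n × ZMod d).1 ≠ b.1 := hb
      rcases h with rfl | ⟨j, hj, rfl, hl⟩ | ⟨a, r, ha, hr, rfl, hl⟩
      · exact ⟨x, hy, Or.inr (Or.inl ⟨b, hb, rfl, by omega⟩)⟩
      · have hj' : ((k, 0) : Fin n × ZMod d).1 ≠ j.1 := hj
        -- Two front reflections. With equal indices they cancel or form a colour-changing pair;
        -- otherwise ((k b))((k j)) = ((k j))((j b)), and ((j b)) fixes k.
        by_cases hbj : b.1 = j.1
        · refine ⟨y, hy, ?_⟩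
          by_cases h2 : b.2 = j.2
          · left
            rw [show b = j from Prod.ext hbj h2, refl_mul_cancel_left hj']
          · refine Or.inr (Or.inr ⟨b, j.2 - b.2, hb, sub_ne_zero.2 (Ne.symm h2), ?_, by omega⟩)
            rw [show (b.1, b.2 + (j.2 - b.2)) = j from Prod.ext hbj (by simp)]
        · refine ⟨refl j b * y, ?_, Or.inr (Or.inl ⟨j, hj, ?_, ?_⟩)⟩
          · rw [G.mul_apply, hy, refl_of_ne (Ne.symm hbj) hj hb]
          · rw [← mul_assoc, ← mul_assoc, mul_refl (refl (k, 0) j) (Ne.symm hbj), refl_right hj',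
              refl_of_ne hj' (Ne.symm hb) hbj]
          · have := hlg (Ne.symm hbj) y; omega
      · have ha' : ((k, 0) : Fin n × ZMod d).1 ≠ a.1 := ha
        have har : ((k, 0) : Fin n × ZMod d).1 ≠ ((a.1, a.2 + r) : Fin n × ZMod d).1 := ha
        -- Three front reflections. If b and a share the index, their product is the single
        -- reflection ((k b')), where b' is b with its colour raised by r. Otherwise ((k b))((k
        -- a))((k a')) = ((k b'))((b a))((b a')), with a' obtained from a likewise, and the last two
        -- factors fix k.
        by_cases hab : b.1 = a.1
        · refine ⟨y, hy, Or.inr (Or.inl ⟨(b.1, b.2 + r), hb, ?_, by omega⟩)⟩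
          rw [← mul_assoc, ← mul_assoc]
          congr 1
          refine G.ext' fun i => ?_
          rw [G.mul_apply, G.mul_apply, refl_apply har, refl_apply (x := (k, 0))
            (y := (b.1, b.2 + r)) (z := (i, 0)) hb]
          by_cases hi : i = k
          · subst hi
            simp [refl_apply ha', refl_apply hb', ha.symm, add_comm]
          · by_cases hi' : i = b.1
            · subst hi'
              simp only [hab, ha.symm, if_false, if_true, refl_apply ha', refl_apply hb']
              ext
              · rfl
              · simp
                ring
            · have hia : i ≠ a.1 := hab ▸ hi'
              simp [hi, hi', hia, refl_of_ne ha' (z := (i, 0)), refl_of_ne hb' (z := (i, 0))]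
        · have hba : b.1 ≠ ((a.1, a.2 + r) : Fin n × ZMod d).1 := hab
          refine ⟨refl b a * (refl b (a.1, a.2 + r) * y), ?_,
            Or.inr (Or.inl ⟨(b.1, b.2 + r), hb, ?_, ?_⟩)⟩
          · rw [G.mul_apply, G.mul_apply, hy, refl_of_ne hba hb har, refl_of_ne hab hb ha]
          · rw [← mul_assoc, mul_refl _ ha', refl_left hb', refl_of_ne hb' (Ne.symm ha)
              (Ne.symm hab), mul_assoc, ← mul_assoc (refl (k, 0) b), mul_refl _ har,
              refl_left hb', refl_of_ne hb' (z := (a.1, a.2 + r)) (Ne.symm ha) (Ne.symm hab)]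
            simp only [← mul_assoc]
            congr 1
            rw [mul_assoc, mul_refl (refl b (a.1, a.2 + r)) hb', ← mul_assoc,
              refl_of_ne hba hb ha, refl_left hba, mul_refl (refl b a) (by exact har),
              refl_of_ne hab hb ha]
            congr 2
            rw [refl_apply hab]
            simp only [Ne.symm hab, if_false, if_true]
            congr 2
            ring
          · have h1 := hlg hab (refl b (a.1, a.2 + r) * y)
            have h2 := hlg hba y
            omega

/-- The first and third forms in `exists_reduction` send k^(0) back to the index k. So x = ((k j'))
y with y shorter than x and fixing k, and evaluation at k^(0) gives j' = j. -/
theorem lg_refl_mul_of_apply {x : G d n} {k : Fin n} {j : Fin n × ZMod d} (hj : k ≠ j.1)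
    (hx : x.1 (k, 0) = j) : lg (refl (k, 0) j * x) + 1 = lg x := by
  have hj0 : ((k, 0) : Fin n × ZMod d).1 ≠ j.1 := hj
  refine le_antisymm ?_ (lg_le_refl_mul hj0 x)
  obtain ⟨y, hy, rfl | ⟨j', hj', rfl, hl⟩ | ⟨a, r, ha, hr, rfl, hl⟩⟩ := exists_reduction x k
  · rw [hy] at hx
    exact absurd (congrArg Prod.fst hx) hj
  · rw [G.mul_apply, hy, refl_left (by exact hj')] at hx
    subst hx
    rwa [refl_mul_cancel_left hj0]
  · rw [G.mul_apply, G.mul_apply, hy, refl_left (by exact ha), refl_apply (by exact ha)] at hx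
    simp only [ha.symm, if_true, if_false] at hx
    exact absurd (congrArg Prod.fst hx) hj

theorem refl_mul_of_fix_lg {y : G d n} {k : Fin n} {j : Fin n × ZMod d} (hj : k ≠ j.1)
    (hy : y.1 (k, 0) = (k, 0)) : lg (refl (k, 0) j * y) = lg y + 1 := by
  have hj0 : ((k, 0) : Fin n × ZMod d).1 ≠ j.1 := hj
  have := lg_refl_mul_of_apply (x := refl (k, 0) j * y) hj
    (by rw [G.mul_apply, hy, refl_left hj0])
  rwa [refl_mul_cancel_left hj0, eq_comm] at this

theorem exists_eq_of_color_change {x : G d n} {k : Fin n} {r : ZMod d} (hr : r ≠ 0)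
    (hx : x.1 (k, 0) = (k, r)) : ∃ (a : Fin n × ZMod d) (y : G d n), k ≠ a.1 ∧
      y.1 (k, 0) = (k, 0) ∧ x = refl (k, 0) a * (refl (k, 0) (a.1, a.2 + r) * y) ∧
      lg y + 2 ≤ lg x := by
  obtain ⟨y, hy, rfl | ⟨j', hj', rfl, hl⟩ | ⟨a, s, ha, hs, rfl, hl⟩⟩ := exists_reduction x k
  · rw [hy] at hx
    exact absurd (congrArg Prod.snd hx).symm hr
  · rw [G.mul_apply, hy, refl_left (by exact hj')] at hx
    exact absurd (congrArg Prod.fst hx).symm hj'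
  · rw [G.mul_apply, G.mul_apply, hy, refl_left (by exact ha), refl_apply (by exact ha)] at hx
    simp only [ha.symm, if_true, if_false] at hx
    have : s = r := by simpa using congrArg Prod.snd hx
    subst this
    exact ⟨a, y, ha, hy, rfl, hl⟩

/-- An element below `w` that fixes `k` stays below if `k` is cut out of `w`. -/
theorem ale_refl_mul {u w : G d n} {k : Fin n} {j : Fin n × ZMod d} (hj : k ≠ j.1)
    (hw : w.1 (k, 0) = j) (hu : u.1 (k, 0) = (k, 0)) (h : ale u w) :
    ale u (refl (k, 0) j * w) := by
  have hT := isReflSystem d n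
  have hj0 : ((k, 0) : Fin n × ZMod d).1 ≠ j.1 := hj
  have huk : u⁻¹.1 (k, 0) = (k, 0) := G.inv_apply_eq.2 hu
  -- The cut is made in u⁻¹ w, which maps k^(0) to u⁻¹ j. Since u fixes k, this is the same as
  -- cutting w by ((k j)) and then multiplying by u⁻¹.
  have h1 := lg_refl_mul_of_apply (x := u⁻¹ * w) (k := k) (j := u⁻¹.1 j)
    (fun h' => G.fst_ne_of_fix huk hj.symm j.2 h'.symm) (by rw [G.mul_apply, hw])
  have h2 : refl (k, 0) (u⁻¹.1 j) * (u⁻¹ * w) = u⁻¹ * (refl (k, 0) j * w) := by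
    rw [← mul_assoc u⁻¹, mul_refl u⁻¹ hj0, huk, mul_assoc]
  rw [h2] at h1
  have h3 := lg_refl_mul_of_apply hj hw
  have h4 := hT.absLE_iff.1 h
  apply hT.absLE_of_le
  unfold lg at *
  omega

/-! ### Elements whose length is the codimension of the fixed space -/

/-- The codimension of the fixed space is subadditive, and it is 1 for a reflection. -/
theorem lg_add_finrank_ge (w : G d n) : n ≤ lg w + Module.finrank ℂ (fixedSpace w) := by
  have hT := isReflSystem d n
  obtain ⟨m, hm⟩ : ∃ m, len (reflections d n) w = m := ⟨_, rfl⟩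
  induction m generalizing w with
  | zero =>
    have : fixedSpace w = ⊤ := by
      rw [hT.eq_one_of_len hm, eq_top_iff]
      intro v _
      rw [mem_fixedSpace_iff']
      exact fun _ => rfl
    rw [this]
    simp
  | succ m ih =>
    obtain ⟨t, ht, w, rfl, hw⟩ := hT.exists_eq_mul hm
    have h1 := ih w hw
    have h2 : Module.finrank ℂ (fixedSpace t) + 1 = n := ht
    have h3 := Submodule.finrank_sup_add_finrank_inf_eq (fixedSpace t) (fixedSpace w)
    have h4 := Submodule.finrank_le (fixedSpace t ⊔ fixedSpace w)
    have h5 : Module.finrank ℂ ↥(fixedSpace t ⊓ fixedSpace w) ≤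
        Module.finrank ℂ (fixedSpace (t * w)) :=
      Submodule.finrank_mono fun v hv => mem_fixedSpace_mul hv.1 hv.2
    rw [Module.finrank_fin_fun] at h4
    unfold lg at *
    omega

/-- The length of `w` is the codimension of its fixed space. -/
def IsTight (w : G d n) : Prop := lg w + Module.finrank ℂ (fixedSpace w) = n

/-- Vectors fixed by u and by u⁻¹ w are fixed by w. The codimensions of these two fixed spaces add
up to at most the length of w, that is, the codimension of Fix w, so all inequalities are
equalities. -/
theorem IsTight.of_ale {u w : G d n} (hw : IsTight w) (h : ale u w) :
    IsTight u ∧ fixedSpace w ≤ fixedSpace u := by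
  have hT := isReflSystem d n
  have h0 := hT.absLE_iff.1 h
  have h1 := lg_add_finrank_ge u
  have h2 := lg_add_finrank_ge (u⁻¹ * w)
  have h3 := Submodule.finrank_sup_add_finrank_inf_eq (fixedSpace u) (fixedSpace (u⁻¹ * w))
  have h4 := Submodule.finrank_le (fixedSpace u ⊔ fixedSpace (u⁻¹ * w))
  have hle : fixedSpace u ⊓ fixedSpace (u⁻¹ * w) ≤ fixedSpace w := fun v hv => by
    have := mem_fixedSpace_mul hv.1 hv.2
    rwa [mul_inv_cancel_left] at this
  have h5 := Submodule.finrank_mono hle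
  rw [Module.finrank_fin_fun] at h4
  unfold IsTight lg at *
  have heq := Submodule.eq_of_le_of_finrank_eq hle (by omega)
  exact ⟨by omega, heq ▸ inf_le_left⟩

open Classical in
/-- The indicator vector of a set that consists of one coloured copy of each index in `B`. -/
noncomputable def sectionVector (B : Set (Fin n)) (c : Fin n → ZMod d) (k : Fin n) : ℂ :=
  if k ∈ B then ZMod.stdAddChar (c k) else 0

theorem sectionVector_mem {w : G d n} {B : Set (Fin n)} {c : Fin n → ZMod d}
    (hB : ∀ k ∈ B, (w.1 (k, c k)).1 ∈ B ∧ (w.1 (k, c k)).2 = c (w.1 (k, c k)).1) :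
    sectionVector B c ∈ fixedSpace w := by
  have hmaps : Set.MapsTo (fun k => (w.1 (k, 0)).1) B B := by
    intro k hk
    have := (hB k hk).1
    rwa [G.apply_eq w k (c k) 0] at this
  have hsurj : Set.SurjOn (fun k => (w.1 (k, 0)).1) B B := by
    have hinj : Set.InjOn (fun k => (w.1 (k, 0)).1) B := fun a _ b _ h =>
      (G.fst_eq_iff w (a, 0) (b, 0)).1 h
    exact ((Set.toFinite B).injOn_iff_bijOn_of_mapsTo hmaps).1 hinj |>.surjOn
  rw [mem_fixedSpace_iff]
  intro k
  by_cases hk : k ∈ B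
  · have h1 := hB k hk
    rw [G.apply_eq w k (c k) 0] at h1
    simp only [sub_zero] at h1
    simp only [sectionVector, if_pos hk, if_pos h1.1]
    rw [← h1.2, AddChar.map_add_eq_mul]
  · have : (w.1 (k, 0)).1 ∉ B := by
      intro h'
      obtain ⟨j, hj, hjk⟩ := hsurj h'
      have e : j = k := (G.fst_eq_iff w (j, 0) (k, 0)).1 hjk
      exact hk (e ▸ hj)
    simp only [sectionVector, if_neg hk, if_neg this, mul_zero]

/-- If `w` preserves a set that consists of one coloured copy of each index in `B`, then so does
every element below `w`. -/
theorem IsTight.section_of_ale {u w : G d n} (hw : IsTight w) (h : ale u w) {B : Set (Fin n)}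
    {c : Fin n → ZMod d}
    (hB : ∀ k ∈ B, (w.1 (k, c k)).1 ∈ B ∧ (w.1 (k, c k)).2 = c (w.1 (k, c k)).1) {k : Fin n}
    (hk : k ∈ B) : (u.1 (k, c k)).1 ∈ B ∧ (u.1 (k, c k)).2 = c (u.1 (k, c k)).1 := by
  have hvu := mem_fixedSpace_iff'.1 ((hw.of_ale h).2 (sectionVector_mem hB)) (k, c k)
  simp only [sectionVector, if_pos hk, ← AddChar.map_add_eq_mul, neg_add_cancel,
    AddChar.map_zero_eq_one] at hvu
  have hmem : (u.1 (k, c k)).1 ∈ B := by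
    by_contra h'
    simp [if_neg h'] at hvu
  refine ⟨hmem, ?_⟩
  rw [if_pos hmem, ← AddChar.map_add_eq_mul, stdAddChar_eq_one_iff] at hvu
  exact (neg_add_eq_zero.1 hvu)

/-- The same indicator vector, now read at an index where it vanishes. -/
theorem IsTight.not_mem_of_ale {u w : G d n} (hw : IsTight w) (h : ale u w) {B : Set (Fin n)}
    {c : Fin n → ZMod d}
    (hB : ∀ k ∈ B, (w.1 (k, c k)).1 ∈ B ∧ (w.1 (k, c k)).2 = c (w.1 (k, c k)).1) {k : Fin n}
    (hk : k ∉ B) : (u.1 (k, 0)).1 ∉ B := by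
  intro h'
  have hvu := mem_fixedSpace_iff.1 ((hw.of_ale h).2 (sectionVector_mem hB)) k
  simp only [sectionVector, if_neg hk, if_pos h', mul_zero] at hvu
  exact stdAddChar_ne_zero _ hvu.symm

theorem IsTight.fix_of_ale {u w : G d n} (hw : IsTight w) (h : ale u w) {k : Fin n}
    (hk : w.1 (k, 0) = (k, 0)) : u.1 (k, 0) = (k, 0) := by
  have := hw.section_of_ale h (B := {k}) (c := 0) (by simp [hk]) rfl
  exact Prod.ext this.1 this.2

end Length

end GddNC

namespace GddNC

/-! ### Smaller groups embedded along coloured indices -/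

section Embedding

variable {d d' m n : ℕ}

/-- The map of coloured integers that is induced by `e` and `φ`. -/
def ext (e : Fin m → Fin n × ZMod d) (φ : ZMod d' →+ ZMod d) (x : Fin m × ZMod d') :
    Fin n × ZMod d := ((e x.1).1, (e x.1).2 + φ x.2)

theorem ext_fst (e : Fin m → Fin n × ZMod d) (φ : ZMod d' →+ ZMod d) (x : Fin m × ZMod d') :
    (ext e φ x).1 = (e x.1).1 := rfl

theorem ext_zero (e : Fin m → Fin n × ZMod d) (φ : ZMod d' →+ ZMod d) (k : Fin m) :
    ext e φ (k, 0) = e k := by simp [ext]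

open Classical in
/-- The action of `u` on `n` coloured integers, through `e` and `φ`. -/
noncomputable def embFun (e : Fin m → Fin n × ZMod d) (φ : ZMod d' →+ ZMod d) (u : G d' m)
    (x : Fin n × ZMod d) : Fin n × ZMod d :=
  if h : ∃ k, (e k).1 = x.1 then
    ((ext e φ (u.1 (h.choose, 0))).1,
      (ext e φ (u.1 (h.choose, 0))).2 + (x.2 - (e h.choose).2))
  else x

variable {e : Fin m → Fin n × ZMod d} (he : Function.Injective fun k => (e k).1)
  (φ : ZMod d' →+ ZMod d)

include he in
theorem embFun_apply (u : G d' m) (k : Fin m) (r : ZMod d) :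
    embFun e φ u ((e k).1, r) =
      ((ext e φ (u.1 (k, 0))).1, (ext e φ (u.1 (k, 0))).2 + (r - (e k).2)) := by
  have h : ∃ j, (e j).1 = (((e k).1, r) : Fin n × ZMod d).1 := ⟨k, rfl⟩
  have hk : h.choose = k := he h.choose_spec
  unfold embFun
  rw [dif_pos h, hk]

theorem embFun_of_forall_ne (u : G d' m) {x : Fin n × ZMod d} (h : ∀ k, (e k).1 ≠ x.1) :
    embFun e φ u x = x := by
  unfold embFun
  rw [dif_neg]
  rintro ⟨k, hk⟩
  exact h k hk

include he in
theorem embFun_mul (u v : G d' m) (x : Fin n × ZMod d) :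
    embFun e φ (u * v) x = embFun e φ u (embFun e φ v x) := by
  by_cases h : ∃ k, (e k).1 = x.1
  · obtain ⟨k, hk⟩ := h
    obtain ⟨i, r⟩ := x
    simp only at hk
    subst hk
    rw [embFun_apply he, embFun_apply he, G.mul_apply]
    conv_rhs => rw [show (ext e φ (v.1 (k, 0))).1 = (e (v.1 (k, 0)).1).1 from rfl, embFun_apply he]
    have := G.apply_eq u (v.1 (k, 0)).1 (v.1 (k, 0)).2 0
    rw [Prod.mk.eta] at this
    rw [this]
    ext
    · rfl
    · simp only [ext, map_add, sub_zero]
      ring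
  · push Not at h
    rw [embFun_of_forall_ne φ v h, embFun_of_forall_ne φ _ h, embFun_of_forall_ne φ _ h]

include he in
theorem embFun_one (x : Fin n × ZMod d) : embFun e φ (1 : G d' m) x = x := by
  by_cases h : ∃ k, (e k).1 = x.1
  · obtain ⟨k, hk⟩ := h
    obtain ⟨i, r⟩ := x
    simp only at hk
    subst hk
    rw [embFun_apply he, G.one_apply]
    simp [ext]
  · push Not at h
    exact embFun_of_forall_ne φ _ h

/-- The homomorphism `G(d',d',m) → G(d,d,n)` that is induced by `e` and `φ`. -/
noncomputable def emb : G d' m →* G d n :=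
  MonoidHom.mk' (fun u => ⟨⟨embFun e φ u, embFun e φ u⁻¹,
      fun x => by rw [← embFun_mul he, inv_mul_cancel, embFun_one he],
      fun x => by rw [← embFun_mul he, mul_inv_cancel, embFun_one he]⟩, by
      rw [mem_G_iff]
      constructor
      · intro i r
        simp only [Equiv.coe_fn_mk]
        by_cases h : ∃ k, (e k).1 = i
        · obtain ⟨k, rfl⟩ := h
          rw [embFun_apply he, embFun_apply he]
          ext
          · rfl
          · simp; ring
        · push Not at h
          rw [embFun_of_forall_ne φ u (x := (i, r)) h, embFun_of_forall_ne φ u (x := (i, 0)) h]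
          simp
      · simp only [Equiv.coe_fn_mk]
        have hb : Function.Bijective fun k : Fin m => (u.1 (k, 0)).1 :=
          Finite.injective_iff_bijective.1 fun a b h => (G.fst_eq_iff u (a, 0) (b, 0)).1 h
        rw [← Finset.sum_subset (Finset.subset_univ (Finset.univ.map ⟨fun k => (e k).1, he⟩)),
          Finset.sum_map]
        · simp only [Function.Embedding.coeFn_mk, embFun_apply he, ext, Finset.sum_add_distrib,
            zero_sub, Finset.sum_neg_distrib]
          -- The colour offsets of e enter once at the targets and once, with opposite sign, at the
          -- sources; u permutes the indices, so they cancel.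
          rw [hb.sum_comp (fun k => (e k).2), ← map_sum, G.sum_eq_zero]
          simp
        · intro i _ hi
          rw [embFun_of_forall_ne]
          intro k hk
          apply hi
          rw [Finset.mem_map]
          exact ⟨k, Finset.mem_univ _, hk⟩⟩)
    (fun u v => Subtype.ext (Equiv.ext fun x => embFun_mul he φ u v x))

theorem emb_ext (u : G d' m) (x : Fin m × ZMod d') :
    (emb he φ u).1 (ext e φ x) = ext e φ (u.1 x) := by
  change embFun e φ u ((e x.1).1, _) = _
  rw [embFun_apply he, ← Prod.mk.eta (p := x), G.apply_eq u x.1 x.2 0]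
  ext
  · rfl
  · simp only [ext, map_add, sub_zero]
    ring

theorem emb_apply (u : G d' m) (k : Fin m) :
    (emb he φ u).1 (e k) = ext e φ (u.1 (k, 0)) := by
  rw [← emb_ext he, ext_zero]

theorem emb_of_forall_ne (u : G d' m) {x : Fin n × ZMod d} (h : ∀ k, (e k).1 ≠ x.1) :
    (emb he φ u).1 x = x := embFun_of_forall_ne φ u h

theorem eq_emb {w : G d n} {u : G d' m} (h1 : ∀ k, w.1 (e k) = ext e φ (u.1 (k, 0)))
    (h2 : ∀ i, (∀ k, (e k).1 ≠ i) → w.1 (i, 0) = (i, 0)) : w = emb he φ u := by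
  refine G.ext' fun i => ?_
  by_cases h : ∃ k, (e k).1 = i
  · obtain ⟨k, rfl⟩ := h
    rw [G.apply_eq w _ _ (e k).2, G.apply_eq (emb he φ u) _ _ (e k).2, Prod.mk.eta, h1,
      emb_apply]
  · push Not at h
    rw [h2 i h, emb_of_forall_ne he φ u h]

include he in
theorem ext_injective (hφ : Function.Injective φ) : Function.Injective (ext e φ) := by
  intro x y h
  have h1 : x.1 = y.1 := he (Prod.ext_iff.1 h).1
  have h2 := congrArg Prod.snd h
  simp only [ext, h1, add_right_inj] at h2
  exact Prod.ext h1 (hφ h2)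

theorem emb_injective (hφ : Function.Injective φ) : Function.Injective (emb he φ) := by
  intro u v h
  refine G.ext' fun k => ext_injective he φ hφ ?_
  rw [← emb_ext he, h, emb_ext]

theorem emb_refl {x y : Fin m × ZMod d'} (h : x.1 ≠ y.1) :
    emb he φ (refl x y) = refl (ext e φ x) (ext e φ y) := by
  have h' : (ext e φ x).1 ≠ (ext e φ y).1 := fun h' => h (he h')
  refine (eq_emb he φ (fun k => ?_) fun i hi => ?_).symm
  · rw [← ext_zero e φ, refl_apply h', refl_apply h]
    simp only [ext_fst, he.eq_iff]
    split_ifs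
    · ext
      · rfl
      · simp only [ext, map_add, map_sub, map_zero, *]; ring
    · ext
      · rfl
      · simp only [ext, map_sub, map_zero, *]; ring
    · rfl
  · exact refl_of_ne h' (hi _).symm (hi _).symm

section

variable [NeZero d] [NeZero d']

theorem emb_mem_reflections (t : G d' m) (ht : t ∈ reflections d' m) :
    emb he φ t ∈ reflections d n := by
  obtain ⟨x, y, h, rfl⟩ := exists_eq_refl ht
  rw [emb_refl he φ h]
  exact refl_mem_reflections fun h' => h (he h')

theorem lg_emb_le (u : G d' m) : lg (emb he φ u) ≤ lg u :=
  len_map_le (isReflSystem d n) (isReflSystem d' m) _ (emb_mem_reflections he φ) u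

/-- A reflection below `w` that acts on indices in the image of `e` lifts. -/
theorem exists_lift_refl (hφ : Function.Surjective φ ∨ φ = 0) {w : G d n} (hw : IsTight w)
    {u : G d' m} (hu : ∀ k, w.1 (e k) = ext e φ (u.1 (k, 0))) {x y : Fin n × ZMod d}
    (hxy : x.1 ≠ y.1) (h : ale (refl x y) w) {k l : Fin m} (hk : (e k).1 = x.1)
    (hl : (e l).1 = y.1) : ∃ t ∈ reflections d' m, emb he φ t = refl x y := by
  have hkl : k ≠ l := fun h' => hxy (by rw [← hk, ← hl, h'])
  obtain ⟨s, hs⟩ : ∃ s, φ s = y.2 - x.2 + (e k).2 - (e l).2 := by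
    rcases hφ with hφ | rfl
    · exact hφ _
    -- For φ = 0 the coloured integers e k form a block preserved by w. By tightness the reflection
    -- preserves it too, hence sends e k to e l, and this determines its colour.
    · refine ⟨0, ?_⟩
      rcases isEmpty_or_nonempty (Fin m) with hm | hm
      · exact hm.elim k
      let g : Fin n → Fin m := Function.invFun fun k => (e k).1
      have hg : ∀ k, g (e k).1 = k := Function.leftInverse_invFun he
      have key := hw.section_of_ale h (B := Set.range fun k => (e k).1) (c := fun i => (e (g i)).2)
        (by
          rintro _ ⟨j, rfl⟩
          dsimp only
          rw [hg, Prod.mk.eta, hu, ext_fst, hg]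
          exact ⟨⟨_, rfl⟩, by simp [ext]⟩) ⟨k, rfl⟩
      dsimp only at key
      have e1 : (refl x y).1 (e k) = (y.1, (e k).2 + (y.2 - x.2)) := by simp [refl_apply hxy, hk]
      rw [hg, Prod.mk.eta, e1] at key
      have h2 := key.2
      dsimp only at h2
      rw [← hl, hg] at h2
      rw [map_zero, ← h2]
      ring
  have hkl' : ((k, 0) : Fin m × ZMod d').1 ≠ ((l, s) : Fin m × ZMod d').1 := hkl
  refine ⟨refl (k, 0) (l, s), refl_mem_reflections hkl', ?_⟩
  rw [emb_refl he φ hkl']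
  refine refl_congr hk hl ?_
  simp only [ext, map_zero, hs]
  ring

omit [NeZero d'] in
include he in
/-- If all colours are trivial, then no reflection below `w` leads out of the image of `e`. -/
theorem exists_index_of_refl_ale {w : G d n} (hw : IsTight w)
    {u : G d' m} (hu : ∀ k, w.1 (e k) = ext e (0 : ZMod d' →+ ZMod d) (u.1 (k, 0)))
    {x y : Fin n × ZMod d} (hxy : x.1 ≠ y.1) (h : ale (refl x y) w) {k : Fin m}
    (hk : (e k).1 = x.1) : ∃ l, (e l).1 = y.1 := by
  have : Nonempty (Fin m) := ⟨k⟩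
  let g : Fin n → Fin m := Function.invFun fun k => (e k).1
  have hg : ∀ k, g (e k).1 = k := Function.leftInverse_invFun he
  have key := hw.section_of_ale h (B := Set.range fun k => (e k).1) (c := fun i => (e (g i)).2)
    (by
      rintro _ ⟨j, rfl⟩
      dsimp only
      rw [hg, Prod.mk.eta, hu, ext_fst, hg]
      exact ⟨⟨_, rfl⟩, by simp [ext]⟩) ⟨k, rfl⟩
  obtain ⟨⟨l, hl⟩, -⟩ := key
  refine ⟨l, hl.trans ?_⟩
  simp [refl_apply hxy, hk]

theorem IsTight.index_of_refl_ale {w : G d n} (hw : IsTight w) {x y : Fin n × ZMod d}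
    (hxy : x.1 ≠ y.1) (h : ale (refl x y) w) : w.1 (x.1, 0) ≠ (x.1, 0) := by
  intro hx
  have h1 := hw.fix_of_ale h hx
  rw [refl_apply hxy] at h1
  simp only [if_true] at h1
  exact hxy (congrArg Prod.fst h1).symm

/-- Indices outside the image of e are fixed by the image of c, hence by everything below it; so
both indices of a reflection below it come from e. -/
theorem nonempty_nc_emb (hi : Function.Injective φ) (hφ : Function.Surjective φ ∨ φ = 0)
    {c : G d' m} (hw : IsTight (emb he φ c)) :
    Nonempty (NC (reflections d n) (emb he φ c) ≃o NC (reflections d' m) c) := by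
  refine nonempty_orderIso_map (isReflSystem d n) (isReflSystem d' m) (emb_injective he φ hi)
    (emb_mem_reflections he φ) fun t ht h => ?_
  obtain ⟨x, y, hxy, rfl⟩ := exists_eq_refl ht
  have hmem : ∀ {x y : Fin n × ZMod d}, x.1 ≠ y.1 → ale (refl x y) (emb he φ c) →
      ∃ k, (e k).1 = x.1 := by
    intro x y hxy h
    by_contra hno
    push Not at hno
    exact hw.index_of_refl_ale hxy h (emb_of_forall_ne he φ c hno)
  obtain ⟨k, hk⟩ := hmem hxy h
  obtain ⟨l, hl⟩ := hmem hxy.symm (refl_comm hxy ▸ h)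
  exact exists_lift_refl he φ hφ hw (emb_apply he φ c) hxy h hk hl

end

section Pair

variable {d₁ m₁ d₂ m₂ : ℕ} {e₁ : Fin m₁ → Fin n × ZMod d} {e₂ : Fin m₂ → Fin n × ZMod d}
  (he₁ : Function.Injective fun k => (e₁ k).1) (he₂ : Function.Injective fun k => (e₂ k).1)
  (φ₁ : ZMod d₁ →+ ZMod d) (φ₂ : ZMod d₂ →+ ZMod d) (hdis : ∀ k l, (e₁ k).1 ≠ (e₂ l).1)

include hdis in
theorem emb_commute (u : G d₁ m₁) (v : G d₂ m₂) : Commute (emb he₁ φ₁ u) (emb he₂ φ₂ v) := by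
  refine G.ext' fun i => ?_
  rw [G.mul_apply, G.mul_apply]
  by_cases h : ∃ k, (e₁ k).1 = i
  · obtain ⟨k, rfl⟩ := h
    rw [emb_of_forall_ne he₂ φ₂ (x := ((e₁ k).1, 0)) v fun l => (hdis k l).symm,
      emb_of_forall_ne he₂]
    intro l
    rw [G.apply_eq _ (e₁ k).1 0 (e₁ k).2, Prod.mk.eta, emb_apply]
    exact (hdis _ l).symm
  · push Not at h
    rw [emb_of_forall_ne he₁ φ₁ (x := (i, 0)) u h, emb_of_forall_ne he₁]
    intro l
    by_cases h' : ∃ k, (e₂ k).1 = i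
    · obtain ⟨k, rfl⟩ := h'
      rw [G.apply_eq _ (e₂ k).1 0 (e₂ k).2, Prod.mk.eta, emb_apply]
      exact hdis l _
    · push Not at h'
      rw [emb_of_forall_ne he₂ φ₂ v h']
      exact h l

/-- The homomorphism on a product that is induced by two embeddings with disjoint images. -/
noncomputable def emb₂ : G d₁ m₁ × G d₂ m₂ →* G d n :=
  MonoidHom.noncommCoprod (emb he₁ φ₁) (emb he₂ φ₂) (emb_commute he₁ he₂ φ₁ φ₂ hdis)

theorem emb₂_apply (p : G d₁ m₁ × G d₂ m₂) :
    emb₂ he₁ he₂ φ₁ φ₂ hdis p = emb he₁ φ₁ p.1 * emb he₂ φ₂ p.2 := rfl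

theorem emb₂_left (p : G d₁ m₁ × G d₂ m₂) (k : Fin m₁) :
    (emb₂ he₁ he₂ φ₁ φ₂ hdis p).1 (e₁ k) = ext e₁ φ₁ (p.1.1 (k, 0)) := by
  rw [emb₂_apply, G.mul_apply, emb_of_forall_ne he₂ φ₂ p.2 fun l => (hdis k l).symm, emb_apply]

theorem emb₂_right (p : G d₁ m₁ × G d₂ m₂) (k : Fin m₂) :
    (emb₂ he₁ he₂ φ₁ φ₂ hdis p).1 (e₂ k) = ext e₂ φ₂ (p.2.1 (k, 0)) := by
  rw [emb₂_apply, G.mul_apply, emb_apply]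
  exact emb_of_forall_ne he₁ φ₁ p.1 fun l => hdis l _

theorem emb₂_of_forall_ne (p : G d₁ m₁ × G d₂ m₂) {x : Fin n × ZMod d}
    (h1 : ∀ k, (e₁ k).1 ≠ x.1) (h2 : ∀ k, (e₂ k).1 ≠ x.1) :
    (emb₂ he₁ he₂ φ₁ φ₂ hdis p).1 x = x := by
  rw [emb₂_apply, G.mul_apply, emb_of_forall_ne he₂ φ₂ p.2 h2, emb_of_forall_ne he₁ φ₁ p.1 h1]

theorem eq_emb₂ {w : G d n} {u : G d₁ m₁} {v : G d₂ m₂}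
    (h1 : ∀ k, w.1 (e₁ k) = ext e₁ φ₁ (u.1 (k, 0))) (h2 : ∀ k, w.1 (e₂ k) = ext e₂ φ₂ (v.1 (k, 0)))
    (h3 : ∀ i, (∀ k, (e₁ k).1 ≠ i) → (∀ k, (e₂ k).1 ≠ i) → w.1 (i, 0) = (i, 0)) :
    w = emb₂ he₁ he₂ φ₁ φ₂ hdis (u, v) := by
  refine G.ext' fun i => ?_
  by_cases h : ∃ k, (e₁ k).1 = i
  · obtain ⟨k, rfl⟩ := h
    rw [G.apply_eq w _ _ (e₁ k).2, G.apply_eq (emb₂ _ _ _ _ _ _) _ _ (e₁ k).2, Prod.mk.eta, h1,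
      emb₂_left]
  · by_cases h' : ∃ k, (e₂ k).1 = i
    · obtain ⟨k, rfl⟩ := h'
      rw [G.apply_eq w _ _ (e₂ k).2, G.apply_eq (emb₂ _ _ _ _ _ _) _ _ (e₂ k).2, Prod.mk.eta, h2,
        emb₂_right]
    · push Not at h h'
      rw [h3 i h h', emb₂_of_forall_ne he₁ he₂ φ₁ φ₂ hdis _ h h']

theorem emb₂_injective (h₁ : Function.Injective φ₁) (h₂ : Function.Injective φ₂) :
    Function.Injective (emb₂ he₁ he₂ φ₁ φ₂ hdis) := by
  intro p q h
  refine Prod.ext (G.ext' fun k => ext_injective he₁ φ₁ h₁ ?_)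
    (G.ext' fun k => ext_injective he₂ φ₂ h₂ ?_)
  · rw [← emb₂_left he₁ he₂ φ₁ φ₂ hdis, h, emb₂_left]
  · rw [← emb₂_right he₁ he₂ φ₁ φ₂ hdis, h, emb₂_right]

variable [NeZero d] [NeZero d₁] [NeZero d₂]

theorem lg_emb₂_le (p : G d₁ m₁ × G d₂ m₂) :
    lg (emb₂ he₁ he₂ φ₁ φ₂ hdis p) ≤ lg p.1 + lg p.2 := by
  have h1 := lg_emb_le he₁ φ₁ p.1
  have h2 := lg_emb_le he₂ φ₂ p.2
  have h3 := (isReflSystem d n).len_mul_le (emb he₁ φ₁ p.1) (emb he₂ φ₂ p.2)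
  rw [← emb₂_apply he₁ he₂ φ₁ φ₂ hdis] at h3
  unfold lg at *
  omega

/-- Because φ₁ = 0, the first factor preserves one coloured copy of each of its indices. A
reflection below the image of c preserves this block as well, so it cannot join the two index sets.
-/
theorem nonempty_nc_emb₂ (h₁ : Function.Injective φ₁) (hφ₁ : φ₁ = 0)
    (h₂ : Function.Injective φ₂) (hφ₂ : Function.Surjective φ₂ ∨ φ₂ = 0)
    {c : G d₁ m₁ × G d₂ m₂} (hw : IsTight (emb₂ he₁ he₂ φ₁ φ₂ hdis c)) :
    Nonempty (NC (reflections d n) (emb₂ he₁ he₂ φ₁ φ₂ hdis c) ≃o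
      NC (reflections d₁ m₁) c.1 × NC (reflections d₂ m₂) c.2) := by
  have hT := isReflSystem d n
  have hT₁ := isReflSystem d₁ m₁
  have hT₂ := isReflSystem d₂ m₂
  have hF : ∀ t ∈ prodRefl (reflections d₁ m₁) (reflections d₂ m₂),
      emb₂ he₁ he₂ φ₁ φ₂ hdis t ∈ reflections d n := by
    rintro ⟨t, s⟩ (⟨h1, h2⟩ | ⟨h1, h2⟩)
    · rw [emb₂_apply, h2, map_one, mul_one]
      exact emb_mem_reflections he₁ φ₁ t h1
    · rw [emb₂_apply, h1, map_one, one_mul]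
      exact emb_mem_reflections he₂ φ₂ s h2
  obtain ⟨f⟩ := nonempty_orderIso_map hT (isReflSystem_prod hT₁ hT₂)
    (emb₂_injective he₁ he₂ φ₁ φ₂ hdis h₁ h₂) hF (c := c) fun t ht h => by
      obtain ⟨x, y, hxy, rfl⟩ := exists_eq_refl ht
      have hyx : ale (refl y x) (emb₂ he₁ he₂ φ₁ φ₂ hdis c) := refl_comm hxy ▸ h
      have hmem : ∀ {x y : Fin n × ZMod d}, x.1 ≠ y.1 →
          ale (refl x y) (emb₂ he₁ he₂ φ₁ φ₂ hdis c) →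
          (∃ k, (e₁ k).1 = x.1) ∨ ∃ k, (e₂ k).1 = x.1 := by
        intro x y hxy h
        by_contra! hno
        exact hw.index_of_refl_ale hxy h (emb₂_of_forall_ne he₁ he₂ φ₁ φ₂ hdis c hno.1 hno.2)
      have hstay : ∀ {x y : Fin n × ZMod d}, x.1 ≠ y.1 →
          ale (refl x y) (emb₂ he₁ he₂ φ₁ φ₂ hdis c) →
          (∃ k, (e₁ k).1 = x.1) → ∃ k, (e₁ k).1 = y.1 := by
        rintro x y hxy h ⟨k, hk⟩
        refine exists_index_of_refl_ale he₁ hw (u := c.1) (fun k => ?_) hxy h hk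
        rw [emb₂_left, hφ₁]
      by_cases hx : ∃ k, (e₁ k).1 = x.1
      · obtain ⟨l, hl⟩ := hstay hxy h hx
        obtain ⟨k, hk⟩ := hx
        obtain ⟨t, ht, he⟩ := exists_lift_refl he₁ φ₁ (Or.inr hφ₁) hw
          (emb₂_left he₁ he₂ φ₁ φ₂ hdis c) hxy h hk hl
        exact ⟨(t, 1), Or.inl ⟨ht, rfl⟩, by rw [emb₂_apply, map_one, mul_one, he]⟩
      · obtain ⟨k, hk⟩ := (hmem hxy h).resolve_left hx
        obtain ⟨l, hl⟩ := (hmem hxy.symm hyx).resolve_left fun hy => hx (hstay hxy.symm hyx hy)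
        obtain ⟨t, ht, he⟩ := exists_lift_refl he₂ φ₂ hφ₂ hw
          (emb₂_right he₁ he₂ φ₁ φ₂ hdis c) hxy h hk hl
        exact ⟨(1, t), Or.inr ⟨rfl, ht⟩, by rw [emb₂_apply, map_one, one_mul, he]⟩
  exact ⟨f.trans (ncProd hT₁ hT₂ c)⟩

end Pair

end Embedding

end GddNC

namespace GddNC

/-! ### Values and lengths of Coxeter elements and long cycles -/

section Coxeter

variable {d n : ℕ}

theorem gamma_lt {k : ℕ} (hk : k + 2 < n) (r : ZMod d) :
    (gamma d n).1 (⟨k, by omega⟩, r) = (⟨k + 1, by omega⟩, r) := by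
  have h2 : 2 ≤ n := by omega
  have h1 : (Fin.cycleRange ⟨n - 2, by omega⟩ : Equiv.Perm (Fin n)) ⟨k, by omega⟩ =
      ⟨k + 1, by omega⟩ := by
    ext
    rw [Fin.coe_cycleRange_of_lt]
    simp only [Fin.mk_lt_mk]; omega
  simp only [gamma, dif_pos h2, G.mk, monomialPerm, Equiv.coe_fn_mk, h1, Pi.add_apply,
    Pi.single_apply, Fin.mk.injEq]
  rw [if_neg (by omega), if_neg (by omega)]
  simp

theorem gamma_pred {k : ℕ} (hk : k + 2 = n) (r : ZMod d) :
    (gamma d n).1 (⟨k, by omega⟩, r) = (⟨0, by omega⟩, r + 1) := by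
  have h2 : 2 ≤ n := by omega
  have h1 : (Fin.cycleRange ⟨n - 2, by omega⟩ : Equiv.Perm (Fin n)) ⟨k, by omega⟩ =
      ⟨0, by omega⟩ := by
    ext
    rw [Fin.coe_cycleRange_of_le]
    · rw [if_pos]
      simp only [Fin.mk.injEq]; omega
    · simp only [Fin.mk_le_mk]; omega
  simp only [gamma, dif_pos h2, G.mk, monomialPerm, Equiv.coe_fn_mk, h1, Pi.add_apply,
    Pi.single_apply, Fin.mk.injEq]
  rw [if_pos (by omega), if_neg (by omega)]
  simp

theorem gamma_last (h2 : 2 ≤ n) {k : ℕ} (hk : k + 1 = n) (r : ZMod d) :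
    (gamma d n).1 (⟨k, by omega⟩, r) = (⟨k, by omega⟩, r - 1) := by
  have h1 : (Fin.cycleRange ⟨n - 2, by omega⟩ : Equiv.Perm (Fin n)) ⟨k, by omega⟩ =
      ⟨k, by omega⟩ := by
    rw [Fin.cycleRange_of_gt]
    simp only [Fin.mk_lt_mk]; omega
  simp only [gamma, dif_pos h2, G.mk, monomialPerm, Equiv.coe_fn_mk, h1, Pi.add_apply,
    Pi.single_apply, Fin.mk.injEq]
  rw [if_neg (by omega), if_pos (by omega)]
  simp [sub_eq_add_neg]

theorem longCycle_lt {m k : ℕ} (hk : k + 1 < m) (r : ZMod 1) :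
    (longCycle m).1 (⟨k, by omega⟩, r) = (⟨k + 1, hk⟩, r) := by
  obtain ⟨m, rfl⟩ : ∃ j, m = j + 1 := ⟨m - 1, by omega⟩
  simp only [longCycle, G.mk, monomialPerm, Equiv.coe_fn_mk]
  rw [finRotate_of_lt (by omega)]
  simp

theorem longCycle_last {m k : ℕ} (hk : k + 1 = m) (r : ZMod 1) :
    (longCycle m).1 (⟨k, by omega⟩, r) = (⟨0, by omega⟩, r) := by
  subst hk
  simp only [longCycle, G.mk, monomialPerm, Equiv.coe_fn_mk]
  rw [finRotate_last']
  simp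

theorem refl_mk_left {a b : ℕ} {ha : a < n} {hb : b < n} {r s : ZMod d} (hab : a ≠ b)
    (h : a < n) (t : ZMod d) :
    (refl (⟨a, ha⟩, r) (⟨b, hb⟩, s)).1 (⟨a, h⟩, t) = (⟨b, hb⟩, t + (s - r)) := by
  rw [refl_apply (by simpa using hab)]; simp

theorem refl_mk_right {a b : ℕ} {ha : a < n} {hb : b < n} {r s : ZMod d} (hab : a ≠ b)
    (h : b < n) (t : ZMod d) :
    (refl (⟨a, ha⟩, r) (⟨b, hb⟩, s)).1 (⟨b, h⟩, t) = (⟨a, ha⟩, t - (s - r)) := by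
  rw [refl_apply (by simpa using hab)]; simp [hab.symm]

theorem refl_mk_of_ne {a b c : ℕ} {ha : a < n} {hb : b < n} {r s : ZMod d} (hab : a ≠ b)
    (hca : c ≠ a) (hcb : c ≠ b) (h : c < n) (t : ZMod d) :
    (refl (⟨a, ha⟩, r) (⟨b, hb⟩, s)).1 (⟨c, h⟩, t) = (⟨c, h⟩, t) := by
  rw [refl_of_ne (by simpa using hab) (by simpa using hca) (by simpa using hcb)]

/-- The interval of indices that starts with `a` (counted from zero). -/
def arc (d : ℕ) {n : ℕ} (a m : ℕ) (h : a + m ≤ n) (k : Fin m) : Fin n × ZMod d :=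
  (⟨a + k, by omega⟩, 0)

theorem arc_injective (d : ℕ) {n : ℕ} (a m : ℕ) (h : a + m ≤ n) :
    Function.Injective fun k => (arc d a m h k).1 := by
  intro k l hkl
  simp only [arc, Fin.mk.injEq] at hkl
  exact Fin.ext (by omega)

theorem arc_fst_ne {d a m : ℕ} {h : a + m ≤ n} {i : ℕ} {hi : i < n}
    (hne : ∀ k, (arc d a m h k).1 ≠ ⟨i, hi⟩) : i < a ∨ a + m ≤ i := by
  by_contra hno
  refine hne ⟨i - a, by omega⟩ ?_
  simp only [arc, Fin.mk.injEq]
  omega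

/-- An interval of indices followed by the last index with colour `s`. -/
def arcTail {d : ℕ} {n : ℕ} (a m : ℕ) (h : a + m ≤ n) (s : ZMod d) (k : Fin m) : Fin n × ZMod d :=
  if (k : ℕ) + 1 < m then (⟨a + k, by omega⟩, 0) else (⟨n - 1, by have := k.2; omega⟩, s)

theorem arcTail_lt {a m : ℕ} (h : a + m ≤ n) (s : ZMod d) {k : ℕ} (hk : k + 1 < m) :
    arcTail a m h s ⟨k, by omega⟩ = (⟨a + k, by omega⟩, 0) := if_pos hk

theorem arcTail_last {a m : ℕ} (h : a + m ≤ n) (s : ZMod d) {k : ℕ} (hk : k + 1 = m) :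
    arcTail a m h s ⟨k, by omega⟩ = (⟨n - 1, by omega⟩, s) := if_neg (by simp only; omega)

theorem arcTail_injective {a m : ℕ} (h : a + m ≤ n) (s : ZMod d) :
    Function.Injective fun k => (arcTail a m h s k).1 := by
  rintro ⟨k, hk⟩ ⟨l, hl⟩ hkl
  ext
  simp only [arcTail] at hkl ⊢
  split_ifs at hkl <;> simp only [Fin.mk.injEq] at hkl <;> omega

theorem arcTail_fst_ne {a m : ℕ} {h : a + m ≤ n} {s : ZMod d} (hm : 1 ≤ m) {i : ℕ} {hi : i < n}
    (hne : ∀ k, (arcTail a m h s k).1 ≠ ⟨i, hi⟩) : (i < a ∨ a + m ≤ i + 1) ∧ i + 1 ≠ n := by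
  constructor
  · by_contra hno
    refine hne ⟨i - a, by omega⟩ ?_
    rw [arcTail_lt h s (k := i - a) (by omega)]
    simp only [Fin.mk.injEq]
    omega
  · intro hi'
    refine hne ⟨m - 1, by omega⟩ ?_
    rw [arcTail_last h s (k := m - 1) (by omega)]
    simp only [Fin.mk.injEq]
    omega

theorem longCycle_succ {m : ℕ} (hm : 1 ≤ m) : longCycle (m + 1) =
    refl (⟨0, by omega⟩, 0) (⟨1, by omega⟩, 0) *
      emb (arc_injective 1 1 m (by omega)) (AddMonoidHom.id (ZMod 1)) (longCycle m) := by
  refine G.ext' ?_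
  rintro ⟨k, hk⟩
  have he : ∀ j (hj : j < m) (r : ZMod 1), ((⟨1 + j, by omega⟩, r) : Fin (m + 1) × ZMod 1) =
      ext (arc 1 1 m (by omega)) (AddMonoidHom.id (ZMod 1)) (⟨j, hj⟩, r) := by
    intro j hj r
    simp [ext, arc]
  rw [G.mul_apply]
  by_cases h0 : k = 0
  · subst h0
    rw [emb_of_forall_ne _ _ _ (fun j => by simp [arc, Fin.ext_iff]), refl_mk_left (by omega),
      longCycle_lt (by omega)]
    simp
  · obtain ⟨j, rfl⟩ : ∃ j, k = 1 + j := ⟨k - 1, by omega⟩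
    rw [he j (by omega), emb_ext]
    by_cases hj : j + 1 < m
    · rw [longCycle_lt hj, ← he j (by omega), ← he (j + 1) (by omega), longCycle_lt (by omega),
        refl_mk_of_ne (by omega) (by omega) (by omega)]
      simp only [Prod.mk.injEq, Fin.mk.injEq, and_true]
      omega
    · rw [longCycle_last (k := j) (m := m) (by omega), ← he j (by omega), ← he 0 (by omega),
        longCycle_last (by omega), refl_mk_right (by omega)]
      simp

/-- An upper bound suffices: each cut lowers the length by at most one, which supplies the opposite
estimates where they are needed. -/
theorem lg_longCycle_le (m : ℕ) : lg (longCycle m) ≤ m - 1 := by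
  rcases Nat.eq_zero_or_pos m with rfl | hm
  · have : longCycle 0 = 1 := G.ext' fun k => k.elim0
    unfold lg
    rw [this, (isReflSystem 1 0).len_one]
  · induction m, hm using Nat.le_induction with
    | base =>
      have : longCycle 1 = 1 := G.ext' fun k => by
        obtain ⟨k, hk⟩ := k
        obtain rfl : k = 0 := by omega
        rw [longCycle_last rfl]; rfl
      unfold lg
      rw [this, (isReflSystem 1 1).len_one]
    | succ m hm ih =>
      rw [longCycle_succ hm]
      have h1 := lg_refl_mul_le (x := ((⟨0, by omega⟩, 0) : Fin (m + 1) × ZMod 1))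
        (y := (⟨1, by omega⟩, 0)) (by simp) (emb (arc_injective 1 1 m (by omega))
          (AddMonoidHom.id (ZMod 1)) (longCycle m))
      have h2 := lg_emb_le (arc_injective 1 1 m (Nat.add_comm 1 m).le)
        (AddMonoidHom.id (ZMod 1)) (longCycle m)
      omega

/-- Cutting the first index out of the Coxeter element. -/
theorem refl_mul_gamma (hn : 3 ≤ n) :
    refl (⟨0, by omega⟩, 0) (⟨1, by omega⟩, 0) * gamma d n =
      emb (arc_injective d 1 (n - 1) (by omega)) (AddMonoidHom.id (ZMod d))
        (gamma d (n - 1)) := by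
  refine eq_emb _ _ ?_ ?_
  · rintro ⟨k, hk⟩
    rw [G.mul_apply]
    simp only [arc]
    rcases lt_trichotomy (k + 2) (n - 1) with h | h | h
    · rw [gamma_lt h, gamma_lt (by omega), refl_mk_of_ne (by omega) (by omega) (by omega)]
      simp only [ext, arc, Prod.mk.injEq, Fin.mk.injEq, AddMonoidHom.id_apply, add_zero, and_true]
      omega
    · rw [gamma_pred h, gamma_pred (by omega), refl_mk_left (by omega)]
      simp [ext, arc]
    · rw [gamma_last (by omega) (by omega), gamma_last (by omega) (by omega),
        refl_mk_of_ne (by omega) (by omega) (by omega)]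
      simp [ext, arc]
  · rintro ⟨i, hi⟩ hne
    have := arc_fst_ne hne
    obtain rfl : i = 0 := by omega
    rw [G.mul_apply, gamma_lt (by omega), refl_mk_right (by omega)]
    simp

section

variable [NeZero d]

theorem lg_gamma_le (h2 : 2 ≤ n) : lg (gamma d n) ≤ n := by
  induction n, h2 using Nat.le_induction with
  | base =>
    have h01 : ((0 : Fin 2), (0 : ZMod d)).1 ≠ ((1 : Fin 2), (0 : ZMod d)).1 := by simp
    have h01' : ((0 : Fin 2), (0 : ZMod d)).1 ≠ ((1 : Fin 2), (1 : ZMod d)).1 := by simp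
    have : gamma d 2 = refl (0, 0) (1, 0) * refl (0, 0) (1, 1) := by
      refine G.ext' ?_
      rintro ⟨k, hk⟩
      rw [G.mul_apply]
      obtain rfl | rfl : k = 0 ∨ k = 1 := by omega
      · rw [gamma_pred rfl, Fin.zero_eta, refl_left h01', refl_apply h01]
        simp
      · rw [gamma_last le_rfl rfl, Fin.mk_one, refl_apply h01', refl_apply h01]
        simp
    have h1 := lg_refl_mul_le h01 (refl (0, 0) (1, 1))
    have h2 := lg_refl_le h01'
    rw [this]
    omega
  | succ n hn ih =>
    have h01 : ((⟨0, by omega⟩, 0) : Fin (n + 1) × ZMod d).1 ≠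
      ((⟨1, by omega⟩, 0) : Fin (n + 1) × ZMod d).1 := by simp
    have h1 := lg_le_refl_mul h01 (gamma d (n + 1))
    rw [refl_mul_gamma (by omega)] at h1
    have h2 := lg_emb_le (arc_injective d 1 (n + 1 - 1) (by omega : _ ≤ n + 1))
      (AddMonoidHom.id (ZMod d)) (gamma d (n + 1 - 1))
    have h3 : lg (gamma d (n + 1 - 1)) ≤ n := ih
    omega

theorem fixed_const {w : G d n} {v : Fin n → ℂ} (hv : v ∈ fixedSpace w) {a b : ℕ} (hb : b < n)
    (hab : a ≤ b)
    (step : ∀ k (hk : k < b), a ≤ k → w.1 (⟨k, by omega⟩, 0) = (⟨k + 1, by omega⟩, 0)) :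
    ∀ k (hk : k ≤ b), a ≤ k → v ⟨k, by omega⟩ = v ⟨a, by omega⟩ := by
  intro k hk hak
  induction k, hak using Nat.le_induction with
  | base => rfl
  | succ k hak ih =>
    rw [← ih (by omega)]
    have := mem_fixedSpace_iff.1 hv ⟨k, by omega⟩
    rw [step k (by omega) hak, AddChar.map_zero_eq_one, one_mul] at this
    exact this.symm

/-- A fixed vector is constant along the run a, …, b, and going once around multiplies the common
entry by ζ^s ≠ 1. -/
theorem fixed_eq_zero {w : G d n} {v : Fin n → ℂ} (hv : v ∈ fixedSpace w) {a b : ℕ} (hb : b < n)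
    (hab : a ≤ b) {s : ZMod d} (hs : s ≠ 0)
    (step : ∀ k (hk : k < b), a ≤ k → w.1 (⟨k, by omega⟩, 0) = (⟨k + 1, by omega⟩, 0))
    (last : w.1 (⟨b, hb⟩, 0) = (⟨a, by omega⟩, s)) :
    ∀ k (hk : k ≤ b), a ≤ k → v ⟨k, by omega⟩ = 0 := by
  have hc := fixed_const hv hb hab step
  have h1 := mem_fixedSpace_iff.1 hv ⟨b, hb⟩
  rw [last, hc b le_rfl hab] at h1
  have h0 : v ⟨a, by omega⟩ = 0 := by
    by_contra h0
    exact hs (stdAddChar_eq_one_iff.1 (mul_right_cancel₀ h0 (h1.trans (one_mul _).symm)))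
  intro k hk hak
  rw [hc k hk hak, h0]

theorem lg_eq_of_fixed_eq_zero {w : G d n} (h : ∀ v ∈ fixedSpace w, v = 0) : n ≤ lg w := by
  have h1 := lg_add_finrank_ge w
  have h2 : fixedSpace w = ⊥ := (Submodule.eq_bot_iff _).2 h
  rw [h2, finrank_bot] at h1
  exact h1

variable (hd : 2 ≤ d)
include hd

omit [NeZero d] in
theorem one_ne_zero_of_two_le : (1 : ZMod d) ≠ 0 := by
  have : Fact (1 < d) := ⟨hd⟩
  exact one_ne_zero

theorem gamma_fixed (h2 : 2 ≤ n) : ∀ v ∈ fixedSpace (gamma d n), v = 0 := by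
  intro v hv
  have h1 := one_ne_zero_of_two_le hd
  funext ⟨k, hk⟩
  by_cases hkn : k + 1 < n
  · refine fixed_eq_zero hv (a := 0) (b := n - 2) (by omega) (by omega) h1
      (fun j hj _ => gamma_lt (by omega) _) ?_ k (by omega) (by omega)
    rw [gamma_pred (by omega)]; simp
  · refine fixed_eq_zero hv (a := n - 1) (b := n - 1) (by omega) (by omega) (neg_ne_zero.2 h1)
      (fun j hj _ => by omega) ?_ k (by omega) (by omega)
    rw [gamma_last h2 (by omega)]; simp

theorem lg_gamma (h2 : 2 ≤ n) : lg (gamma d n) = n :=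
  le_antisymm (lg_gamma_le h2) (lg_eq_of_fixed_eq_zero (gamma_fixed hd h2))

theorem gamma_isTight (h2 : 2 ≤ n) : IsTight (gamma d n) := by
  unfold IsTight
  rw [lg_gamma hd h2, (Submodule.eq_bot_iff _).2 (gamma_fixed hd h2), finrank_bot, add_zero]

end

end Coxeter

/-! ### Two consecutive cuts and the translated interval they produce -/

section Cutting

variable {d n : ℕ}

/-- The data of two consecutive cuts at the index `k`: `c` maps `k` to `j₂`, and `w` arises from `c`
by multiplication with the reflections `((k j))` and `((k j₂))`, each of which shortens. -/
structure IsCut (c : G d n) (k : Fin n) (j j₂ : Fin n × ZMod d) (w : G d n) : Prop where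
  tight : IsTight c
  ne : k ≠ j.1
  ne₂ : k ≠ j₂.1
  ne' : j₂.1 ≠ j.1
  apply_eq : c.1 (k, 0) = j₂
  eq : w = refl (k, 0) j₂ * (refl (k, 0) j * c)
  lg_le : lg w + 2 ≤ lg c

namespace IsCut

variable {c w : G d n} {k : Fin n} {j j₂ : Fin n × ZMod d} (h : IsCut c k j j₂ w)
include h

theorem refl_mul : refl (k, 0) j * c = refl (k, 0) j₂ * w := by
  rw [h.eq, refl_mul_cancel_left (by exact h.ne₂)]

theorem mid_apply : (refl (k, 0) j * c).1 (k, 0) = j₂ := by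
  rw [G.mul_apply, h.apply_eq, refl_of_ne (by exact h.ne) h.ne₂.symm h.ne']

variable [NeZero d]

theorem lg_mid : lg (refl (k, 0) j * c) = lg w + 1 := by
  have := lg_refl_mul_of_apply h.ne₂ h.mid_apply
  rw [← h.eq] at this
  exact this.symm

theorem lg_eq : lg c = lg w + 2 := by
  have h1 := h.lg_mid
  have h2 := lg_le_refl_mul (x := (k, 0)) (y := j) (by exact h.ne) c
  have := h.lg_le
  omega

omit [NeZero d] in
theorem fix : w.1 (k, 0) = (k, 0) := by
  rw [h.eq, G.mul_apply, h.mid_apply, refl_right (by exact h.ne₂)]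

theorem lg_refl_mul : lg (refl (k, 0) j * w) = lg w + 1 :=
  refl_mul_of_fix_lg h.ne h.fix

/-- c = ((k j))((k j₂)) w = (((k j)) w)(w⁻¹ ((k j₂)) w), where the last factor is a conjugate of a
reflection and the lengths add up. -/
theorem refl_mul_ale : ale (refl (k, 0) j * w) c := by
  have hT := isReflSystem d n
  refine hT.absLE_of_len_add_le (b := w⁻¹ * refl (k, 0) j₂ * w⁻¹⁻¹) ?_ ?_
  · rw [inv_inv, mul_assoc w⁻¹, ← h.refl_mul, mul_assoc, mul_inv_cancel_left,
      refl_mul_cancel_left (by exact h.ne)]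
  · rw [hT.len_conj]
    have h1 := h.lg_refl_mul
    have h2 := h.lg_eq
    have h3 := lg_refl (d := d) (x := (k, 0)) (y := j₂) (by exact h.ne₂)
    unfold lg at *
    omega

theorem reduced : lg (refl (k, 0) j * w) = lg (refl (k, 0) j) + lg w := by
  rw [h.lg_refl_mul, lg_refl (by exact h.ne), add_comm]

theorem ale_w : ale w c :=
  ((isReflSystem d n).absLE_mul_right h.reduced).trans h.refl_mul_ale

theorem tight_w : IsTight w := (h.tight.of_ale h.ale_w).1

/-- Dividing u by ((k j)) leaves an element that fixes k and lies below ((k j)) c. The latter maps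
k^(0) to j₂, so the quotient survives the second cut. Conversely, w is tight and fixes k, so every y
below w fixes k. -/
theorem ale_and_apply_iff (u : G d n) :
    (ale u c ∧ u.1 (k, 0) = j) ↔ ∃ y, ale y w ∧ u = refl (k, 0) j * y := by
  have hT := isReflSystem d n
  have hk : ((k, 0) : Fin n × ZMod d).1 ≠ j.1 := h.ne
  constructor
  · rintro ⟨hu, hj⟩
    have h1 := lg_refl_mul_of_apply h.ne hj
    have hy : (refl (k, 0) j * u).1 (k, 0) = (k, 0) := by
      rw [G.mul_apply, hj, refl_right hk]
    refine ⟨refl (k, 0) j * u, ?_, by rw [refl_mul_cancel_left hk]⟩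
    have h2 := (hT.absLE_inv_mul (t := refl (k, 0) j) (y := refl (k, 0) j * u) (c := c) ?_ ?_).1
    · rw [refl_inv hk] at h2
      rw [h.eq]
      exact ale_refl_mul h.ne₂ h.mid_apply hy h2
    · rw [refl_mul_cancel_left hk]
      have := lg_refl hk
      unfold lg at *
      omega
    · rwa [refl_mul_cancel_left hk]
  · rintro ⟨y, hy, rfl⟩
    refine ⟨(hT.mul_absLE_mul h.reduced hy).trans h.refl_mul_ale, ?_⟩
    rw [G.mul_apply, h.tight_w.fix_of_ale hy h.fix, refl_left hk]

end IsCut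

end Cutting

end GddNC

namespace GddNC

/-! ### The cut elements as products over disjoint index sets -/

section Elements

variable {d n : ℕ}

/-- The Coxeter element, cut at the first index by `((1^(0) i^(s)))` and `((1^(0) 2^(0)))` (where
indices are counted from zero). -/
def cutGamma (hn : 3 ≤ n) (i : ℕ) (hi : i < n) (s : ZMod d) : G d n :=
  refl (⟨0, by omega⟩, 0) (⟨1, by omega⟩, 0) * (refl (⟨0, by omega⟩, 0) (⟨i, hi⟩, s) * gamma d n)

section Values

variable (hn : 3 ≤ n) {i : ℕ} (hi : i < n) (s : ZMod d)

theorem cutGamma_lt {k : ℕ} (h1 : 1 ≤ k) (hk : k + 2 < n) (hki : k + 1 ≠ i) (hi2 : 2 ≤ i)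
    (r : ZMod d) :
    (cutGamma hn i hi s).1 (⟨k, by omega⟩, r) = (⟨k + 1, by omega⟩, r) := by
  unfold cutGamma
  rw [G.mul_apply, G.mul_apply, gamma_lt hk, refl_mk_of_ne (by omega) (by omega) hki,
    refl_mk_of_ne (by omega) (by omega) (by omega)]

theorem cutGamma_pred {k : ℕ} (hk : k + 2 < n) (hki : k + 1 = i) (r : ZMod d) :
    (cutGamma hn i hi s).1 (⟨k, by omega⟩, r) = (⟨1, by omega⟩, r - s) := by
  subst hki
  unfold cutGamma
  rw [G.mul_apply, G.mul_apply, gamma_lt hk, refl_mk_right (by omega),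
    refl_mk_left (by omega)]
  simp

theorem cutGamma_end {k : ℕ} (hk : k + 2 = n) (hi2 : 2 ≤ i) (r : ZMod d) :
    (cutGamma hn i hi s).1 (⟨k, by omega⟩, r) = (⟨i, hi⟩, r + 1 + s) := by
  unfold cutGamma
  rw [G.mul_apply, G.mul_apply, gamma_pred hk, refl_mk_left (by omega),
    refl_mk_of_ne (by omega) (by omega) (by omega)]
  simp

theorem cutGamma_last {k : ℕ} (hk : k + 1 = n) (hi2 : i + 1 < n) (h0 : i ≠ 0) (r : ZMod d) :
    (cutGamma hn i hi s).1 (⟨k, by omega⟩, r) = (⟨k, by omega⟩, r - 1) := by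
  unfold cutGamma
  rw [G.mul_apply, G.mul_apply, gamma_last (by omega) hk,
    refl_mk_of_ne (c := k) (by omega) (by omega) (by omega), refl_mk_of_ne (by omega) (by omega) (by omega)]

theorem cutGamma_last' {k : ℕ} (hk : k + 1 = n) (hi2 : i = k) (r : ZMod d) :
    (cutGamma hn i hi s).1 (⟨k, by omega⟩, r) = (⟨1, by omega⟩, r - 1 - s) := by
  subst hi2
  unfold cutGamma
  rw [G.mul_apply, G.mul_apply, gamma_last (by omega) hk, refl_mk_right (by omega),
    refl_mk_left (by omega)]
  simp

theorem cutGamma_zero (hi2 : 2 ≤ i) (r : ZMod d) :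
    (cutGamma hn i hi s).1 (⟨0, by omega⟩, r) = (⟨0, by omega⟩, r) := by
  unfold cutGamma
  rw [G.mul_apply, G.mul_apply, gamma_lt (by omega), refl_mk_of_ne (c := 0 + 1) (by omega) (by omega) (by omega),
    refl_mk_right (by omega)]
  simp

end Values

theorem arc_arc_disjoint {a m b l : ℕ} (h : a + m ≤ n) (h' : b + l ≤ n) (hab : a + m ≤ b) :
    ∀ k j, (arc d a m h k).1 ≠ (arc d b l h' j).1 := by
  rintro ⟨k, hk⟩ ⟨j, hj⟩ hkj
  simp only [arc, Fin.mk.injEq] at hkj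
  omega

theorem arc_arcTail_disjoint {a m b l : ℕ} (h : a + m ≤ n) (h' : b + l ≤ n) (s : ZMod d)
    (hab : b + l ≤ a + 1) (hn : a + m < n) :
    ∀ k j, (arc d a m h k).1 ≠ (arcTail b l h' s j).1 := by
  rintro ⟨k, hk⟩ ⟨j, hj⟩ hkj
  simp only [arc, arcTail] at hkj
  split_ifs at hkj <;> simp only [Fin.mk.injEq] at hkj <;> omega

/-- The cut by i^(0) closes the run 2, …, i-1 without a colour shift; the run i, …, n-1 keeps the
shift +1 of γ, balanced by the shift -1 at n. -/
theorem cutGamma_first (hn : 3 ≤ n) {i : ℕ} (hi : 3 ≤ i) (hi' : i + 1 ≤ n) :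
    cutGamma hn (i - 1) (by omega) (0 : ZMod d) =
      emb₂ (arc_injective d 1 (i - 2) (by omega)) (arc_injective d (i - 1) (n - i + 1) (by omega))
        (0 : ZMod 1 →+ ZMod d) (AddMonoidHom.id (ZMod d))
        (arc_arc_disjoint _ _ (by omega)) (longCycle (i - 2), gamma d (n - i + 1)) := by
  refine eq_emb₂ _ _ _ _ _ ?_ ?_ ?_
  · rintro ⟨k, hk⟩
    simp only [arc]
    by_cases h : k + 1 < i - 2
    · rw [longCycle_lt h, cutGamma_lt hn _ _ (by omega) (by omega) (by omega) (by omega)]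
      simp [ext, arc]
      omega
    · rw [longCycle_last (k := k) (m := i - 2) (by omega),
        cutGamma_pred hn _ _ (by omega) (by omega)]
      simp [ext, arc]
  · rintro ⟨k, hk⟩
    simp only [arc]
    rcases lt_trichotomy (k + 2) (n - i + 1) with h | h | h
    · rw [gamma_lt h, cutGamma_lt hn _ _ (by omega) (by omega) (by omega) (by omega)]
      simp [ext, arc]
      omega
    · rw [gamma_pred h, cutGamma_end hn _ _ (by omega) (by omega)]
      simp [ext, arc]
    · rw [gamma_last (by omega) (k := k) (by omega),
        cutGamma_last hn _ _ (by omega) (by omega) (by omega)]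
      simp [ext, arc]
  · rintro ⟨j, hj⟩ h1 h2
    have h1 := arc_fst_ne h1
    have h2 := arc_fst_ne h2
    obtain rfl : j = 0 := by omega
    exact cutGamma_zero hn _ _ (by omega) _

/-- The colour -1 transfers the shift +1 to the other run: now i, …, n-1 closes without a shift, and
2, …, i-1 pairs with n to form the Coxeter element. -/
theorem cutGamma_neg_one (hn : 3 ≤ n) {i : ℕ} (hi : 3 ≤ i) (hi' : i + 1 ≤ n) :
    cutGamma hn (i - 1) (by omega) (-1 : ZMod d) =
      emb₂ (arc_injective d (i - 1) (n - i) (by omega))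
        (arcTail_injective (a := 1) (m := i - 1) (by omega) 0)
        (0 : ZMod 1 →+ ZMod d) (AddMonoidHom.id (ZMod d))
        (arc_arcTail_disjoint _ _ _ (by omega) (by omega)) (longCycle (n - i), gamma d (i - 1)) := by
  refine eq_emb₂ _ _ _ _ _ ?_ ?_ ?_
  · rintro ⟨k, hk⟩
    simp only [arc]
    by_cases h : k + 1 < n - i
    · rw [longCycle_lt h, cutGamma_lt hn _ _ (by omega) (by omega) (by omega) (by omega)]
      simp [ext, arc]
      omega
    · rw [longCycle_last (k := k) (m := n - i) (by omega),
        cutGamma_end hn _ _ (by omega) (by omega)]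
      simp [ext, arc]
  · rintro ⟨k, hk⟩
    rcases lt_trichotomy (k + 2) (i - 1) with h | h | h
    · rw [gamma_lt h, arcTail_lt _ _ (by omega),
        cutGamma_lt hn _ _ (by omega) (by omega) (by omega) (by omega), ext,
        arcTail_lt _ _ (by omega)]
      simp
      omega
    · rw [gamma_pred h, arcTail_lt _ _ (by omega), cutGamma_pred hn _ _ (by omega) (by omega), ext,
        arcTail_lt _ _ (by omega)]
      simp
    · rw [gamma_last (by omega) (k := k) (by omega), arcTail_last _ _ (by omega),
        cutGamma_last hn _ _ (by omega) (by omega) (by omega), ext, arcTail_last _ _ (by omega)]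
      simp
  · rintro ⟨j, hj⟩ h1 h2
    have h1 := arc_fst_ne h1
    have h2 := arcTail_fst_ne (by omega) h2
    obtain rfl : j = 0 := by omega
    exact cutGamma_zero hn _ _ (by omega) _

/-- The last index joins the run 2, …, n-1 and its shift cancels that of the run. The tail colour s
+ 1 is the one in which the cycle reaches n after leaving n-1 in colour 0. -/
theorem cutGamma_top (hn : 3 ≤ n) (s : ZMod d) :
    cutGamma hn (n - 1) (by omega) s =
      emb (arcTail_injective (a := 1) (m := n - 1) (by omega) (s + 1)) (0 : ZMod 1 →+ ZMod d)
        (longCycle (n - 1)) := by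
  refine eq_emb _ _ ?_ ?_
  · rintro ⟨k, hk⟩
    rcases lt_trichotomy (k + 2) (n - 1) with h | h | h
    · rw [longCycle_lt (m := n - 1) (by omega), arcTail_lt _ _ (by omega),
        cutGamma_lt hn _ _ (by omega) (by omega) (by omega) (by omega), ext,
        arcTail_lt _ _ (by omega)]
      simp
      omega
    · rw [longCycle_lt (m := n - 1) (by omega), arcTail_lt _ _ (by omega),
        cutGamma_end hn _ _ (by omega) (by omega), ext, arcTail_last _ _ (by omega)]
      simp [add_comm]
    · rw [longCycle_last (k := k) (m := n - 1) (by omega), arcTail_last _ _ (by omega),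
        cutGamma_last' hn _ _ (by omega) rfl, ext, arcTail_lt _ _ (by omega)]
      simp
  · rintro ⟨j, hj⟩ h1
    have h1 := arcTail_fst_ne (by omega) h1
    obtain rfl : j = 0 := by omega
    exact cutGamma_zero hn _ _ (by omega) _

/-- The cycle `(2 3 … n-1)`. -/
def innerCycle (d : ℕ) (hn : 3 ≤ n) : G d n :=
  refl (⟨n - 1, by omega⟩, 0) (⟨1, by omega⟩, 0) * cutGamma hn (n - 1) (by omega) (-1)

theorem innerCycle_eq (hn : 3 ≤ n) :
    innerCycle d hn = emb (arc_injective d 1 (n - 2) (by omega)) (0 : ZMod 1 →+ ZMod d)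
      (longCycle (n - 2)) := by
  refine eq_emb _ _ ?_ ?_
  · rintro ⟨k, hk⟩
    simp only [arc, innerCycle]
    rw [G.mul_apply]
    by_cases h : k + 1 < n - 2
    · rw [longCycle_lt h, cutGamma_lt hn _ _ (by omega) (by omega) (by omega) (by omega),
        refl_mk_of_ne (by omega) (by omega) (by omega)]
      simp [ext, arc]
      omega
    · rw [longCycle_last (k := k) (m := n - 2) (by omega),
        cutGamma_end hn _ _ (by omega) (by omega), refl_mk_left (by omega)]
      simp [ext, arc]
  · rintro ⟨j, hj⟩ h1
    have h1 := arc_fst_ne h1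
    rw [innerCycle, G.mul_apply]
    obtain rfl | h : j = 0 ∨ j = n - 1 := by omega
    · rw [cutGamma_zero hn _ _ (by omega), refl_mk_of_ne (by omega) (by omega) (by omega)]
    · subst h
      rw [cutGamma_last' hn _ _ (by omega) rfl, refl_mk_right (by omega)]
      simp

/-- The product of the cycles `(2 3 … i-1)` and `(i i+1 … n-1)`. -/
def twoCycles (d : ℕ) (hn : 3 ≤ n) (i : ℕ) (hi : i ≤ n) : G d n :=
  refl (⟨n - 1, by omega⟩, 0) (⟨1, by omega⟩, 0) *
    (refl (⟨n - 1, by omega⟩, 0) (⟨i - 1, by omega⟩, 0) * cutGamma hn (n - 1) (by omega) (-1))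

theorem twoCycles_eq (hn : 3 ≤ n) {i : ℕ} (hi : 3 ≤ i) (hi' : i + 1 ≤ n) :
    twoCycles d hn i (by omega) =
      emb₂ (arc_injective d 1 (i - 2) (by omega)) (arc_injective d (i - 1) (n - i) (by omega))
        (0 : ZMod 1 →+ ZMod d) (0 : ZMod 1 →+ ZMod d)
        (arc_arc_disjoint _ _ (by omega)) (longCycle (i - 2), longCycle (n - i)) := by
  refine eq_emb₂ _ _ _ _ _ ?_ ?_ ?_
  · rintro ⟨k, hk⟩
    simp only [arc, twoCycles]
    rw [G.mul_apply, G.mul_apply,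
      cutGamma_lt hn _ _ (by omega) (by omega) (by omega) (by omega)]
    by_cases h : k + 1 < i - 2
    · rw [longCycle_lt h, refl_mk_of_ne (c := 1 + k + 1) (by omega) (by omega) (by omega),
        refl_mk_of_ne (by omega) (by omega) (by omega)]
      simp [ext, arc]
      omega
    · obtain rfl : i = 1 + k + 1 + 1 := by omega
      rw [longCycle_last (k := k) (m := 1 + k + 1 + 1 - 2) (by omega)]
      simp only [Nat.add_sub_cancel]
      rw [refl_mk_right (by omega), refl_mk_left (by omega)]
      simp [ext, arc]
  · rintro ⟨k, hk⟩
    simp only [arc, twoCycles]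
    rw [G.mul_apply, G.mul_apply]
    by_cases h : k + 1 < n - i
    · rw [longCycle_lt h, cutGamma_lt hn _ _ (by omega) (by omega) (by omega) (by omega),
        refl_mk_of_ne (c := i - 1 + k + 1) (by omega) (by omega) (by omega),
        refl_mk_of_ne (by omega) (by omega) (by omega)]
      simp [ext, arc]
      omega
    · rw [longCycle_last (k := k) (m := n - i) (by omega),
        cutGamma_end hn _ _ (by omega) (by omega), refl_mk_left (by omega),
        refl_mk_of_ne (by omega) (by omega) (by omega)]
      simp [ext, arc]
  · rintro ⟨j, hj⟩ h1 h2
    have h1 := arc_fst_ne h1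
    have h2 := arc_fst_ne h2
    rw [twoCycles, G.mul_apply, G.mul_apply]
    obtain rfl | h : j = 0 ∨ j = n - 1 := by omega
    · rw [cutGamma_zero hn _ _ (by omega), refl_mk_of_ne (c := 0) (by omega) (by omega) (by omega),
        refl_mk_of_ne (by omega) (by omega) (by omega)]
    · subst h
      rw [cutGamma_last' hn _ _ (by omega) rfl, refl_mk_of_ne (c := 1) (by omega) (by omega) (by omega),
        refl_mk_right (by omega)]
      simp

end Elements

/-! ### Lengths of the cut elements and their intervals -/

section Cuts

variable {d n : ℕ} [NeZero d] (hd : 2 ≤ d) (hn : 3 ≤ n)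
include hd

/-- Only the length estimate depends on i and s; it says that both multiplications shorten. -/
theorem isCut_gamma {i : ℕ} (hi : 2 ≤ i) (hi' : i < n) (s : ZMod d)
    (hl : lg (cutGamma hn i hi' s) + 2 ≤ n) :
    IsCut (gamma d n) ⟨0, by omega⟩ (⟨i, hi'⟩, s) (⟨1, by omega⟩, 0) (cutGamma hn i hi' s) where
  tight := gamma_isTight hd (by omega)
  ne := by simp only [ne_eq, Fin.mk.injEq]; omega
  ne₂ := by simp only [ne_eq, Fin.mk.injEq]; omega
  ne' := by simp only [ne_eq, Fin.mk.injEq]; omega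
  apply_eq := gamma_lt (by omega) 0
  eq := rfl
  lg_le := by rwa [lg_gamma hd (by omega)]

omit [NeZero d] hd in
theorem injective_zero : Function.Injective (0 : ZMod 1 →+ ZMod d) :=
  fun _ _ _ => Subsingleton.elim _ _

theorem isCut_first {i : ℕ} (hi : 3 ≤ i) (hi' : i + 1 ≤ n) :
    IsCut (gamma d n) ⟨0, by omega⟩ (⟨i - 1, by omega⟩, 0) (⟨1, by omega⟩, 0)
      (cutGamma hn (i - 1) (by omega) 0) := by
  refine isCut_gamma hd hn (by omega) _ _ ?_
  rw [cutGamma_first hn hi hi']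
  have h := lg_emb₂_le (arc_injective d 1 (i - 2) (show _ ≤ n by omega))
    (arc_injective d (i - 1) (n - i + 1) (by omega)) (0 : ZMod 1 →+ ZMod d)
    (AddMonoidHom.id (ZMod d)) (arc_arc_disjoint _ _ (by omega))
    (longCycle (i - 2), gamma d (n - i + 1))
  have h1 := lg_longCycle_le (i - 2)
  have h2 := lg_gamma_le (d := d) (n := n - i + 1) (by omega)
  dsimp only at h
  omega

theorem nonempty_nc_first {i : ℕ} (hi : 3 ≤ i) (hi' : i + 1 ≤ n) :
    Nonempty (NC (reflections d n) (cutGamma hn (i - 1) (by omega) (0 : ZMod d)) ≃o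
      NCD d (n - i + 1) × NCA (i - 2)) := by
  have ht := (isCut_first hd hn hi hi').tight_w
  rw [cutGamma_first hn hi hi'] at ht ⊢
  obtain ⟨f⟩ := nonempty_nc_emb₂ _ _ _ _ _ injective_zero rfl Function.injective_id
    (Or.inl Function.surjective_id) ht
  exact ⟨f.trans OrderIso.prodComm⟩

theorem isCut_neg_one {i : ℕ} (hi : 3 ≤ i) (hi' : i + 1 ≤ n) :
    IsCut (gamma d n) ⟨0, by omega⟩ (⟨i - 1, by omega⟩, -1) (⟨1, by omega⟩, 0)
      (cutGamma hn (i - 1) (by omega) (-1)) := by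
  refine isCut_gamma hd hn (by omega) _ _ ?_
  rw [cutGamma_neg_one hn hi hi']
  have h := lg_emb₂_le (arc_injective d (i - 1) (n - i) (show _ ≤ n by omega))
    (arcTail_injective (a := 1) (m := i - 1) (by omega) 0) (0 : ZMod 1 →+ ZMod d)
    (AddMonoidHom.id (ZMod d)) (arc_arcTail_disjoint _ _ _ (by omega) (by omega))
    (longCycle (n - i), gamma d (i - 1))
  have h1 := lg_longCycle_le (n - i)
  have h2 := lg_gamma_le (d := d) (n := i - 1) (by omega)
  dsimp only at h
  omega

theorem nonempty_nc_neg_one {i : ℕ} (hi : 3 ≤ i) (hi' : i + 1 ≤ n) :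
    Nonempty (NC (reflections d n) (cutGamma hn (i - 1) (by omega) (-1 : ZMod d)) ≃o
      NCA (n - i) × NCD d (i - 1)) := by
  have ht := (isCut_neg_one hd hn hi hi').tight_w
  rw [cutGamma_neg_one hn hi hi'] at ht ⊢
  exact nonempty_nc_emb₂ _ _ _ _ _ injective_zero rfl Function.injective_id
    (Or.inl Function.surjective_id) ht

theorem isCut_top (s : ZMod d) :
    IsCut (gamma d n) ⟨0, by omega⟩ (⟨n - 1, by omega⟩, s) (⟨1, by omega⟩, 0)
      (cutGamma hn (n - 1) (by omega) s) := by
  refine isCut_gamma hd hn (by omega) _ _ ?_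
  rw [cutGamma_top hn]
  have h := lg_emb_le (arcTail_injective (a := 1) (m := n - 1) (show _ ≤ n by omega) (s + 1))
    (0 : ZMod 1 →+ ZMod d) (longCycle (n - 1))
  have h1 := lg_longCycle_le (n - 1)
  omega

theorem nonempty_nc_top (s : ZMod d) :
    Nonempty (NC (reflections d n) (cutGamma hn (n - 1) (by omega) s) ≃o NCA (n - 1)) := by
  have ht := (isCut_top hd hn s).tight_w
  rw [cutGamma_top hn] at ht ⊢
  exact nonempty_nc_emb _ _ injective_zero (Or.inr rfl) ht

theorem isCut_twoCycles {i : ℕ} (hi : 3 ≤ i) (hi' : i + 1 ≤ n) :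
    IsCut (cutGamma hn (n - 1) (by omega) (-1 : ZMod d)) ⟨n - 1, by omega⟩
      (⟨i - 1, by omega⟩, 0) (⟨1, by omega⟩, 0) (twoCycles d hn i (by omega)) where
  tight := (isCut_top hd hn (-1)).tight_w
  ne := by simp only [ne_eq, Fin.mk.injEq]; omega
  ne₂ := by simp only [ne_eq, Fin.mk.injEq]; omega
  ne' := by simp only [ne_eq, Fin.mk.injEq]; omega
  apply_eq := by rw [cutGamma_last' hn _ _ (by omega) rfl]; simp
  eq := rfl
  lg_le := by
    have h0 := (isCut_top hd hn (-1)).lg_eq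
    rw [lg_gamma hd (by omega)] at h0
    rw [twoCycles_eq hn hi hi']
    have h := lg_emb₂_le (arc_injective d 1 (i - 2) (show _ ≤ n by omega))
      (arc_injective d (i - 1) (n - i) (by omega)) (0 : ZMod 1 →+ ZMod d)
      (0 : ZMod 1 →+ ZMod d) (arc_arc_disjoint _ _ (by omega))
      (longCycle (i - 2), longCycle (n - i))
    have h1 := lg_longCycle_le (i - 2)
    have h2 := lg_longCycle_le (n - i)
    dsimp only at h
    omega

theorem nonempty_nc_twoCycles {i : ℕ} (hi : 3 ≤ i) (hi' : i + 1 ≤ n) :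
    Nonempty (NC (reflections d n) (twoCycles d hn i (by omega)) ≃o NCA (i - 2) × NCA (n - i)) := by
  have ht := (isCut_twoCycles hd hn hi hi').tight_w
  rw [twoCycles_eq hn hi hi'] at ht ⊢
  exact nonempty_nc_emb₂ _ _ _ _ _ injective_zero rfl injective_zero (Or.inr rfl) ht

theorem lg_innerCycle : lg (innerCycle d hn) + 3 = n := by
  have h0 := (isCut_top hd hn (-1)).lg_eq
  rw [lg_gamma hd (by omega)] at h0
  have h1 := lg_refl_mul_of_apply (x := cutGamma hn (n - 1) (by omega) (-1 : ZMod d))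
    (k := ⟨n - 1, by omega⟩) (j := (⟨1, by omega⟩, 0))
    (by simp only [ne_eq, Fin.mk.injEq]; omega)
    (by rw [cutGamma_last' hn _ _ (by omega) rfl]; simp)
  rw [innerCycle]
  omega

theorem innerCycle_ale : ale (innerCycle d hn) (cutGamma hn (n - 1) (by omega) (-1)) := by
  have h0 := (isCut_top hd hn (-1)).lg_eq
  rw [lg_gamma hd (by omega)] at h0
  have hne : ((⟨n - 1, by omega⟩, 0) : Fin n × ZMod d).1 ≠ ((⟨1, by omega⟩, 0) : Fin n × ZMod d).1 :=
    by simp only [ne_eq, Fin.mk.injEq]; omega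
  have h1 := (isReflSystem d n).absLE_mul_right
    (a := refl (⟨n - 1, by omega⟩, 0) (⟨1, by omega⟩, 0)) (b := innerCycle d hn) ?_
  · rwa [innerCycle, refl_mul_cancel_left hne] at h1
  · have h2 := lg_innerCycle hd hn
    have h3 := lg_refl hne
    rw [show refl _ _ * innerCycle d hn = _ from refl_mul_cancel_left hne _]
    unfold lg at *
    omega

theorem innerCycle_isTight : IsTight (innerCycle d hn) :=
  ((isCut_top hd hn (-1)).tight_w.of_ale (innerCycle_ale hd hn)).1

theorem nonempty_nc_innerCycle :
    Nonempty (NC (reflections d n) (innerCycle d hn) ≃o NCA (n - 2)) := by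
  have ht := innerCycle_isTight hd hn
  rw [innerCycle_eq hn] at ht ⊢
  exact nonempty_nc_emb _ _ injective_zero (Or.inr rfl) ht

end Cuts

end GddNC

namespace GddNC

/-! ### Identities between products of few reflections -/

section Identities

variable {d n : ℕ} {z o l : Fin n}

/-- Both products are the diagonal element [z]_r [o]_{-r}, which does not depend on s. -/
theorem refl_mul_refl_same (hzo : z ≠ o) (s t r : ZMod d) :
    refl (z, 0) (o, s) * refl (z, 0) (o, s + r) = refl (z, 0) (o, t) * refl (z, 0) (o, t + r) := by
  have h : ∀ a b : ZMod d, ((z, a) : Fin n × ZMod d).1 ≠ ((o, b) : Fin n × ZMod d).1 :=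
    fun _ _ => hzo
  refine G.ext' fun k => ?_
  rw [G.mul_apply, G.mul_apply, refl_apply (h 0 (s + r)), refl_apply (h 0 (t + r))]
  dsimp only
  split_ifs with h1 h2
  · simp [refl_apply (h _ _), hzo.symm]
  · simp [refl_apply (h _ _)]
  · rw [refl_of_ne (h 0 s) h1 h2, refl_of_ne (h 0 t) h1 h2]

theorem refl_mul_refl_swap (hzo : z ≠ o) (hzl : z ≠ l) (hol : o ≠ l) :
    refl (z, 0) (l, 0) * refl (z, 0) (o, 0) =
      (refl (z, 0) (o, 0) * refl (l, 0) (o, 0) : G d n) := by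
  have h1 : ((l, 0) : Fin n × ZMod d).1 ≠ ((o, 0) : Fin n × ZMod d).1 := hol.symm
  have h2 : ((z, 0) : Fin n × ZMod d).1 ≠ ((o, 0) : Fin n × ZMod d).1 := hzo
  have h3 : ((l, 0) : Fin n × ZMod d).1 ≠ ((z, 0) : Fin n × ZMod d).1 := hzl.symm
  rw [mul_refl _ h1, refl_right h2, refl_of_ne h2 h3 h1, refl_comm h3]

theorem refl_neg_one_mul_refl (hzo : z ≠ o) (hzl : z ≠ l) (hol : o ≠ l) :
    refl (z, 0) (l, -1) * refl (l, 0) (o, 0) =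
      (refl (z, 0) (o, -1) * refl (z, 0) (l, -1) : G d n) := by
  have h1 : ((l, 0) : Fin n × ZMod d).1 ≠ ((o, 0) : Fin n × ZMod d).1 := hol.symm
  have h2 : ((z, 0) : Fin n × ZMod d).1 ≠ ((l, -1) : Fin n × ZMod d).1 := hzl
  rw [mul_refl _ h1, refl_of_ne h2 (z := (o, 0)) hzo.symm hol, refl_apply h2]
  simp only [hzl.symm, if_false, if_true]
  congr 1
  exact refl_congr rfl rfl (by simp)

theorem refl_mul_refl_neg_one (hzo : z ≠ o) (hzl : z ≠ l) (hol : o ≠ l) :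
    refl (o, 0) (l, 0) * refl (z, 0) (o, -1) =
      (refl (z, 0) (o, -1) * refl (z, 0) (l, -1) : G d n) := by
  have h1 : ((z, 0) : Fin n × ZMod d).1 ≠ ((l, -1) : Fin n × ZMod d).1 := hzl
  have h2 : ((z, 0) : Fin n × ZMod d).1 ≠ ((o, -1) : Fin n × ZMod d).1 := hzo
  rw [mul_refl _ h1, refl_left h2, refl_of_ne h2 hzl.symm hol.symm]
  congr 1
  exact refl_congr rfl rfl (by simp)

theorem diag_mul_refl (hzo : z ≠ o) (hzl : z ≠ l) (hol : o ≠ l) :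
    refl (z, 0) (l, -1) * (refl (z, 0) (l, 0) * refl (z, 0) (o, 0)) =
      (refl (z, 0) (o, -1) * (refl (z, 0) (l, -1) * refl (z, 0) (l, 0)) : G d n) := by
  have h1 : ((z, 0) : Fin n × ZMod d).1 ≠ ((l, -1) : Fin n × ZMod d).1 := hzl
  have h2 : ((z, 0) : Fin n × ZMod d).1 ≠ ((l, 0) : Fin n × ZMod d).1 := hzl
  have h3 : ((z, 0) : Fin n × ZMod d).1 ≠ ((o, 0) : Fin n × ZMod d).1 := hzo
  rw [← mul_assoc, mul_refl _ h3, G.mul_apply, G.mul_apply, refl_left h2,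
    refl_of_ne h2 hzo.symm hol, refl_of_ne h1 (z := (o, 0)) hzo.symm hol, refl_apply h1]
  simp only [hzl.symm, if_false, if_true]
  congr 1
  exact refl_congr rfl rfl (by simp)

/-- The element `[1]_1 [n]_{-1}` commutes with the elements that fix `1^(0)` and whose inverse image
of `n` has index `n`. -/
theorem diag_commute (hzl : z ≠ l) {y : G d n} (hz : y.1 (z, 0) = (z, 0))
    (hl : (y.1 (l, 0)).1 = l) :
    y * (refl (z, 0) (l, -1) * refl (z, 0) (l, 0)) =
      refl (z, 0) (l, -1) * refl (z, 0) (l, 0) * y := by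
  have h1 : ((z, 0) : Fin n × ZMod d).1 ≠ ((l, -1) : Fin n × ZMod d).1 := hzl
  have h2 : ((z, 0) : Fin n × ZMod d).1 ≠ ((l, 0) : Fin n × ZMod d).1 := hzl
  obtain ⟨c, hc⟩ : ∃ c, y.1 (l, 0) = (l, c) := ⟨_, Prod.ext hl rfl⟩
  have hc' : y.1 (l, -1) = (l, c - 1) := by
    rw [G.apply_eq y l (-1) 0, hc]
    simp [sub_eq_add_neg]
  rw [← mul_assoc, mul_refl y h1, hz, hc', mul_assoc, mul_refl y h2, hz, hc, ← mul_assoc]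
  congr 1
  have := refl_mul_refl_same hzl (c - 1) (-1) 1
  rwa [sub_add_cancel, neg_add_cancel] at this

end Identities

/-! ### Doubled intervals from a fixed index -/

section Doubled

variable {d n : ℕ} [NeZero d]

/-- Everything below w fixes k, while ((k j)) moves it. So ((k j)) y cannot lie below w, and cutting
k out of ((k j)) x leaves x. -/
theorem isDoubled_of_fix {c t w : G d n} {k : Fin n} {j : Fin n × ZMod d} (hj : k ≠ j.1)
    (hw : IsTight w) (hk : w.1 (k, 0) = (k, 0)) (hle : ale (t * refl (k, 0) j * w) c)
    (hl : lg (t * refl (k, 0) j * w) = lg t + 1 + lg w) :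
    IsDoubled (reflections d n) c t (refl (k, 0) j) w where
  len_eq := hl
  len_r := lg_refl (by exact hj)
  le := hle
  not_le y hy h := by
    have h1 := hw.fix_of_ale h hk
    rw [G.mul_apply, hw.fix_of_ale hy hk, refl_left (by exact hj)] at h1
    exact hj (congrArg Prod.fst h1).symm
  absLE y x hy hx h := by
    have h1 := ale_refl_mul hj (w := refl (k, 0) j * x)
      (by rw [G.mul_apply, hw.fix_of_ale hx hk, refl_left (by exact hj)]) (hw.fix_of_ale hy hk) h
    rwa [refl_mul_cancel_left (by exact hj)] at h1

end Doubled

/-! ### Factorizations of γ through the cycle (2 3 … n-1) -/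

section Setup

variable {d n : ℕ}

/-- The first index. -/
abbrev i₀ (hn : 3 ≤ n) : Fin n := ⟨0, by omega⟩

/-- The second index. -/
abbrev i₁ (hn : 3 ≤ n) : Fin n := ⟨1, by omega⟩

/-- The last index. -/
abbrev iₙ (hn : 3 ≤ n) : Fin n := ⟨n - 1, by omega⟩

variable (hn : 3 ≤ n)

theorem i₀_ne_i₁ : i₀ hn ≠ i₁ hn := by simp

theorem i₀_ne_iₙ : i₀ hn ≠ iₙ hn := by
  simp only [ne_eq, Fin.mk.injEq]; omega

theorem i₁_ne_iₙ : i₁ hn ≠ iₙ hn := by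
  simp only [ne_eq, Fin.mk.injEq]; omega

/-- The first two factors multiply to [1]_1 [n]_{-1}, the factor split off from the elements of
R_1^(1). Omitting the third gives the top element of D₁. -/
theorem gamma_eq_mul : gamma d n = refl (i₀ hn, 0) (iₙ hn, -1) * (refl (i₀ hn, 0) (iₙ hn, 0) *
    (refl (i₀ hn, 0) (i₁ hn, 0) * innerCycle d hn)) := by
  have h1 : ((i₀ hn, 0) : Fin n × ZMod d).1 ≠ ((iₙ hn, -1) : Fin n × ZMod d).1 := i₀_ne_iₙ hn
  have h2 : ((iₙ hn, 0) : Fin n × ZMod d).1 ≠ ((i₁ hn, 0) : Fin n × ZMod d).1 :=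
    (i₁_ne_iₙ hn).symm
  have h3 : ((i₀ hn, 0) : Fin n × ZMod d).1 ≠ ((i₁ hn, 0) : Fin n × ZMod d).1 := i₀_ne_i₁ hn
  rw [← mul_assoc (refl (i₀ hn, 0) (iₙ hn, 0)),
    refl_mul_refl_swap (i₀_ne_i₁ hn) (i₀_ne_iₙ hn) (i₁_ne_iₙ hn), innerCycle, mul_assoc,
    refl_mul_cancel_left h2, cutGamma, refl_mul_cancel_left h3, refl_mul_cancel_left h1]

/-- The same factorization with ((1^(0) 2^(0))) moved to the front; passing [1]_1 [n]_{-1} turns its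
colour into -1. Omitting the third factor gives the top element of D₂. -/
theorem gamma_eq_mul' : gamma d n = refl (i₀ hn, 0) (i₁ hn, -1) * (refl (i₀ hn, 0) (iₙ hn, -1) *
    (refl (i₀ hn, 0) (iₙ hn, 0) * innerCycle d hn)) := by
  have h := diag_mul_refl (d := d) (i₀_ne_i₁ hn) (i₀_ne_iₙ hn) (i₁_ne_iₙ hn)
  calc gamma d n = refl (i₀ hn, 0) (iₙ hn, -1) * (refl (i₀ hn, 0) (iₙ hn, 0) *
        refl (i₀ hn, 0) (i₁ hn, 0)) * innerCycle d hn := by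
        rw [gamma_eq_mul hn]; simp only [mul_assoc]
    _ = _ := by rw [h]; simp only [mul_assoc]

theorem innerCycle_zero : (innerCycle d hn).1 (i₀ hn, 0) = (i₀ hn, 0) := by
  rw [innerCycle_eq, emb_of_forall_ne]
  intro k
  simp [arc]

theorem innerCycle_last : (innerCycle d hn).1 (iₙ hn, 0) = (iₙ hn, 0) := by
  rw [innerCycle_eq, emb_of_forall_ne]
  rintro ⟨k, hk⟩
  simp only [arc, ne_eq, Fin.mk.injEq]
  omega

theorem innerCycle_inner {k : Fin n} (h1 : 1 ≤ (k : ℕ)) (h2 : (k : ℕ) + 1 < n) :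
    1 ≤ ((((innerCycle d hn).1 (k, 0)).1 : Fin n) : ℕ) ∧
      ((((innerCycle d hn).1 (k, 0)).1 : Fin n) : ℕ) + 1 < n ∧
      ((innerCycle d hn).1 (k, 0)).2 = 0 := by
  have hk : ((k, 0) : Fin n × ZMod d) = arc d 1 (n - 2) (by omega) ⟨k - 1, by omega⟩ := by
    simp only [arc]
    ext
    · simp only; omega
    · rfl
  rw [hk, innerCycle_eq, emb_apply]
  simp only [ext, arc]
  refine ⟨by omega, by have := ((longCycle (n - 2)).1 (⟨k - 1, by omega⟩, 0)).1.2; omega, by simp⟩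

/-- The cycle `(2 3 … n)` preserves the colour of all indices other than the first one. -/
theorem cutGamma_ne_zero {k : Fin n} (hk : k ≠ i₀ hn) :
    ((cutGamma hn (n - 1) (by omega) (-1 : ZMod d)).1 (k, 0)).1 ≠ i₀ hn ∧
      ((cutGamma hn (n - 1) (by omega) (-1 : ZMod d)).1 (k, 0)).2 = 0 := by
  refine ⟨?_, ?_⟩
  · exact G.fst_ne_of_fix (cutGamma_zero hn _ _ (by omega) _) hk 0
  · obtain ⟨k, hkn⟩ := k
    have hk0 : k ≠ 0 := fun h => hk (Fin.ext h)
    rcases lt_trichotomy (k + 2) n with h | h | h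
    · rw [cutGamma_lt hn _ _ (by omega) (by omega) (by omega) (by omega)]
    · rw [cutGamma_end hn _ _ (by omega) (by omega)]; simp
    · rw [cutGamma_last' hn _ _ (by omega) (by omega)]; simp

theorem twoCycles_inner {i : ℕ} (hi : 3 ≤ i) (hi' : i + 1 ≤ n) {k : Fin n} (h1 : 1 ≤ (k : ℕ))
    (h2 : (k : ℕ) + 1 < i) :
    (1 ≤ ((((twoCycles d hn i (by omega)).1 (k, 0)).1 : Fin n) : ℕ) ∧
      ((((twoCycles d hn i (by omega)).1 (k, 0)).1 : Fin n) : ℕ) + 1 < i) ∧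
      ((twoCycles d hn i (by omega)).1 (k, 0)).2 = 0 := by
  have hk : ((k, 0) : Fin n × ZMod d) = arc d 1 (i - 2) (by omega) ⟨k - 1, by omega⟩ := by
    simp only [arc]
    ext
    · simp only; omega
    · rfl
  rw [hk, twoCycles_eq hn hi hi', emb₂_left]
  simp only [ext, arc]
  refine ⟨⟨by omega, ?_⟩, by simp⟩
  have := ((longCycle (i - 2)).1 (⟨k - 1, by omega⟩, 0)).1.2
  omega

end Setup

/-! ### Which images of 1^(0) occur below γ -/

section Exclusion

variable {d n : ℕ} [NeZero d] (hd : 2 ≤ d) (hn : 3 ≤ n)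
include hd

/-- The reflection breaks the run 1, …, n-1 of γ into two runs with colour shifts -s and 1 + s,
beside the shift -1 at n. If no shift vanishes, there is no nonzero fixed vector, and the length is
at least n instead of n - 1. -/
theorem color_of_refl_ale_gamma {i : ℕ} (h1 : 1 ≤ i) (h2 : i + 2 ≤ n) {s : ZMod d}
    (h : ale (refl (i₀ hn, 0) (⟨i, by omega⟩, s)) (gamma d n)) : s = 0 ∨ s = -1 := by
  by_contra! hs
  have hne : ((i₀ hn, 0) : Fin n × ZMod d).1 ≠ ((⟨i, by omega⟩, s) : Fin n × ZMod d).1 := by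
    simp only [ne_eq, Fin.mk.injEq]; omega
  have hl := (isReflSystem d n).absLE_iff.1 h
  rw [refl_inv hne] at hl
  have e1 := lg_refl hne
  have e2 := lg_gamma (n := n) hd (by omega)
  have hneg : (-1 : ZMod d) ≠ 0 := neg_ne_zero.2 (one_ne_zero_of_two_le hd)
  have := lg_eq_of_fixed_eq_zero (w := refl (i₀ hn, 0) (⟨i, by omega⟩, s) * gamma d n) ?_
  · unfold lg at *; omega
  intro v hv
  funext ⟨k, hk⟩
  by_cases hk1 : k < i
  · refine fixed_eq_zero hv (a := 0) (b := i - 1) (s := -s) (by omega) (by omega)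
      (neg_ne_zero.2 hs.1) ?_ ?_ k (by omega) (by omega)
    · intro j hj _
      rw [G.mul_apply, gamma_lt (by omega), refl_mk_of_ne (by omega) (by omega) (by omega)]
    · obtain ⟨i, rfl⟩ : ∃ j, i = j + 1 := ⟨i - 1, by omega⟩
      simp only [Nat.add_sub_cancel]
      rw [G.mul_apply, gamma_lt (by omega), refl_mk_right (by omega)]
      simp
  · by_cases hk2 : k + 1 < n
    · refine fixed_eq_zero hv (a := i) (b := n - 2) (s := 1 + s) (by omega) (by omega)
        (fun h0 => hs.2 (eq_neg_of_add_eq_zero_right h0)) ?_ ?_ k (by omega) (by omega)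
      · intro j hj _
        rw [G.mul_apply, gamma_lt (by omega), refl_mk_of_ne (by omega) (by omega) (by omega)]
      · rw [G.mul_apply, gamma_pred (by omega), refl_mk_left (by omega)]
        simp
    · refine fixed_eq_zero hv (a := n - 1) (b := n - 1) (s := -1) (by omega) (by omega) hneg ?_ ?_ k
        (by omega) (by omega)
      · intro j hj _
        omega
      · rw [G.mul_apply, gamma_last (by omega) (by omega),
          refl_mk_of_ne (by omega) (by omega) (by omega)]
        simp

/-- Removing any other such diagonal element from γ leaves an element without nonzero fixed vectors,
hence of length at least n, although its length has to be smaller than that of γ. -/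
theorem eq_last_of_diag_ale_gamma {a : Fin n × ZMod d} {s : ZMod d} (ha : i₀ hn ≠ a.1)
    (hs : s ≠ 0)
    (h : ale (refl (i₀ hn, 0) a * refl (i₀ hn, 0) (a.1, a.2 + s)) (gamma d n)) :
    a.1 = iₙ hn ∧ s = 1 := by
  obtain ⟨⟨i, hi⟩, c⟩ := a
  dsimp only at h ha ⊢
  have hi0 : i ≠ 0 := fun h => ha (Fin.ext h.symm)
  by_contra hno
  have h1 : ((i₀ hn, 0) : Fin n × ZMod d).1 ≠ ((⟨i, hi⟩, c) : Fin n × ZMod d).1 := ha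
  have h2 : ((i₀ hn, 0) : Fin n × ZMod d).1 ≠ ((⟨i, hi⟩, c + s) : Fin n × ZMod d).1 := ha
  set q := refl (i₀ hn, 0) (⟨i, hi⟩, c) * refl (i₀ hn, 0) (⟨i, hi⟩, c + s) with hq
  have hl := (isReflSystem d n).absLE_iff.1 h
  have hqinv : q⁻¹ = refl (i₀ hn, 0) (⟨i, hi⟩, c + s) * refl (i₀ hn, 0) (⟨i, hi⟩, c) := by
    rw [hq, mul_inv_rev, refl_inv h1, refl_inv h2]
  have v0 : ∀ r, q⁻¹.1 (i₀ hn, r) = (i₀ hn, r - s) := by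
    intro r
    rw [hqinv, G.mul_apply, refl_mk_left (by omega), refl_mk_right (by omega)]
    ext
    · rfl
    · simp only; ring
  have vi : ∀ (h : i < n) r, q⁻¹.1 (⟨i, h⟩, r) = (⟨i, h⟩, r + s) := by
    intro h r
    rw [hqinv, G.mul_apply, refl_mk_right (by omega), refl_mk_left (by omega)]
    ext
    · rfl
    · simp only; ring
  have vk : ∀ k (hk : k < n) r, k ≠ 0 → k ≠ i → q⁻¹.1 (⟨k, hk⟩, r) = (⟨k, hk⟩, r) := by
    intro k hk r hk0 hki
    rw [hqinv, G.mul_apply, refl_mk_of_ne (c := k) (by omega) (by omega) (by omega),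
      refl_mk_of_ne (by omega) (by omega) (by omega)]
  have hq1 : q ≠ 1 := by
    intro h1
    have := v0 0
    rw [h1, inv_one, G.one_apply] at this
    exact hs (by simpa using congrArg Prod.snd this)
  have hq0 : len (reflections d n) q ≠ 0 := fun h0 => hq1 ((isReflSystem d n).eq_one_of_len h0)
  have e2 := lg_gamma (n := n) hd (by omega)
  have hone := one_ne_zero_of_two_le hd
  have := lg_eq_of_fixed_eq_zero (w := q⁻¹ * gamma d n) ?_
  · unfold lg at *; omega
  clear hl h hq1 hq0 hqinv
  clear_value q
  intro v hv
  by_cases hin : i + 1 = n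
  · obtain rfl : i = n - 1 := by omega
    have hs1 : s ≠ 1 := fun h => hno ⟨rfl, h⟩
    funext ⟨k, hk⟩
    by_cases hk2 : k + 1 < n
    · refine fixed_eq_zero hv (a := 0) (b := n - 2) (s := 1 - s) (by omega) (by omega)
        (sub_ne_zero.2 hs1.symm) ?_ ?_ k (by omega) (by omega)
      · intro j hj _
        rw [G.mul_apply, gamma_lt (by omega), vk _ _ _ (by omega) (by omega)]
      · rw [G.mul_apply, gamma_pred (by omega), v0]
        simp
    · refine fixed_eq_zero hv (a := n - 1) (b := n - 1) (s := s - 1) (by omega) (by omega)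
        (sub_ne_zero.2 hs1) ?_ ?_ k (by omega) (by omega)
      · intro j hj _
        omega
      · rw [G.mul_apply, gamma_last (by omega) (by omega), vi]
        ext
        · rfl
        · simp only; ring
  -- Here both changed colours belong to the run 1, …, n-1: the shifts s and 1 - s met on the way
  -- around add up to 1, so the vector vanishes on that run.
  · have c1 := fixed_const hv (a := 0) (b := i - 1) (by omega) (by omega) (by
      intro j hj _
      rw [G.mul_apply, gamma_lt (by omega), vk _ _ _ (by omega) (by omega)])
    have c2 := fixed_const hv (a := i) (b := n - 2) (by omega) (by omega) (by
      intro j hj _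
      rw [G.mul_apply, gamma_lt (by omega), vk _ _ _ (by omega) (by omega)])
    have m1 := mem_fixedSpace_iff.1 hv ⟨i - 1, by omega⟩
    have m2 := mem_fixedSpace_iff.1 hv ⟨n - 2, by omega⟩
    rw [G.mul_apply, gamma_lt (by omega)] at m1
    simp only [Nat.sub_add_cancel (Nat.one_le_iff_ne_zero.2 hi0)] at m1
    rw [vi, c1 _ le_rfl (by omega)] at m1
    rw [G.mul_apply, gamma_pred (by omega), v0, c2 _ le_rfl (by omega)] at m2
    have hz : v (i₀ hn) = 0 := by
      by_contra hz
      rw [← m1, ← mul_assoc, ← AddChar.map_add_eq_mul] at m2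
      have := stdAddChar_eq_one_iff.1 (mul_right_cancel₀ hz (m2.trans (one_mul _).symm))
      apply hone
      rw [← this]
      ring
    have hzi : v ⟨i, hi⟩ = 0 := by
      rw [← m1, hz, mul_zero]
    funext ⟨k, hk⟩
    by_cases hk1 : k < i
    · exact (c1 k (by omega) (by omega)).trans hz
    · by_cases hk2 : k + 1 < n
      · exact (c2 k (by omega) (by omega)).trans hzi
      · refine fixed_eq_zero hv (a := n - 1) (b := n - 1) (s := -1) (by omega) (by omega)
          (neg_ne_zero.2 hone) ?_ ?_ k (by omega) (by omega)
        · intro j hj _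
          omega
        · rw [G.mul_apply, gamma_last (by omega) (by omega), vk _ _ _ (by omega) (by omega)]
          simp

end Exclusion

end GddNC

namespace GddNC

/-! ### The classes R_i^(s) as translated intervals -/

section PartsOfNC

theorem mem_R_iff {d n i : ℕ} (h1 : 1 ≤ i) (h2 : i ≤ n) {s : ZMod d} {u : NCD d n} :
    u ∈ R d n i s ↔ u.1.1 (⟨0, by omega⟩, 0) = (⟨i - 1, by omega⟩, s) := by
  constructor
  · rintro ⟨a, b, ha, hb, h⟩
    have ha' : a = ⟨0, by omega⟩ := Fin.ext (by simp only; omega)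
    have hb' : b = ⟨i - 1, by omega⟩ := Fin.ext (by simp only; omega)
    rw [← ha', ← hb']
    exact h
  · intro h
    exact ⟨_, _, rfl, by simp only; omega, h⟩

variable {d n : ℕ} [NeZero d] (hd : 2 ≤ d) (hn : 3 ≤ n)

theorem R_eq_translate {i : ℕ} (h1 : 1 ≤ i) (h2 : i ≤ n) {s : ZMod d} {j₂ : Fin n × ZMod d}
    {w : G d n}
    (h : IsCut (gamma d n) ⟨0, by omega⟩ (⟨i - 1, by omega⟩, s) j₂ w) :
    R d n i s = translate (reflections d n) (gamma d n)
      (refl (⟨0, by omega⟩, 0) (⟨i - 1, by omega⟩, s)) w := by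
  ext u
  rw [mem_R_iff h1 h2]
  have := h.ale_and_apply_iff u.1
  exact ⟨fun hu => this.1 ⟨u.2.2, hu⟩, fun hu => (this.2 hu).2⟩

include hd

theorem IsCut.isSymPart {k : Fin n} {j j₂ : Fin n × ZMod d} {w : G d n}
    (h : IsCut (gamma d n) k j j₂ w) :
    IsSymPart n (translate (reflections d n) (gamma d n) (refl (k, 0) j) w) := by
  have h1 := h.lg_eq
  have h2 := lg_refl (d := d) (x := (k, 0)) (y := j) (by exact h.ne)
  have h3 : 2 ≤ n := by
    have := h.tight
    unfold IsTight at this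
    unfold lg at *
    omega
  rw [lg_gamma hd h3] at h1
  refine translate_isSymPart (isReflSystem d n) h.reduced h.refl_mul_ale ?_
  unfold lg at *
  omega

/-! ### The part `R_1^(0) ⊎ R_2^(0)` -/

theorem lg_refl_mul_gamma : lg (refl (i₀ hn, 0) (i₁ hn, 0) * gamma d n) + 1 = n := by
  have h1 := lg_refl_mul_of_apply (x := gamma d n) (k := i₀ hn) (j := (i₁ hn, 0)) (by simp)
    (gamma_lt (by omega) 0)
  rwa [lg_gamma hd (by omega)] at h1

theorem refl_mul_gamma_ale : ale (refl (i₀ hn, 0) (i₁ hn, 0) * gamma d n) (gamma d n) := by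
  have h := lg_refl_mul_gamma (d := d) hd hn
  have hne : ((i₀ hn, 0) : Fin n × ZMod d).1 ≠ ((i₁ hn, 0) : Fin n × ZMod d).1 := i₀_ne_i₁ hn
  have h1 := (isReflSystem d n).absLE_mul_right (a := refl (i₀ hn, 0) (i₁ hn, 0))
    (b := refl (i₀ hn, 0) (i₁ hn, 0) * gamma d n) ?_
  · rwa [refl_mul_cancel_left hne] at h1
  · have h2 := lg_refl hne
    have h3 := lg_gamma (d := d) (n := n) hd (by omega)
    rw [refl_mul_cancel_left hne]
    unfold lg at *
    omega

omit [NeZero d] hd in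
theorem refl_mul_gamma_fix :
    (refl (i₀ hn, 0) (i₁ hn, 0) * gamma d n).1 (i₀ hn, 0) = (i₀ hn, 0) := by
  rw [G.mul_apply, gamma_lt (by omega), refl_mk_right (by omega)]
  simp

theorem refl_mul_gamma_isTight : IsTight (refl (i₀ hn, 0) (i₁ hn, 0) * gamma d n) :=
  ((gamma_isTight hd (by omega)).of_ale (refl_mul_gamma_ale hd hn)).1

theorem isDoubled_base : IsDoubled (reflections d n) (gamma d n) 1 (refl (i₀ hn, 0) (i₁ hn, 0))
    (refl (i₀ hn, 0) (i₁ hn, 0) * gamma d n) := by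
  have hne : ((i₀ hn, 0) : Fin n × ZMod d).1 ≠ ((i₁ hn, 0) : Fin n × ZMod d).1 := i₀_ne_i₁ hn
  refine isDoubled_of_fix (by simp) (refl_mul_gamma_isTight hd hn) (refl_mul_gamma_fix hn) ?_ ?_
  · rw [one_mul, refl_mul_cancel_left hne]
    exact AbsLE.refl _ _
  · rw [one_mul, refl_mul_cancel_left hne]
    have h := lg_refl_mul_gamma (d := d) hd hn
    have h1 := (isReflSystem d n).len_one
    have h3 := lg_gamma (d := d) (n := n) hd (by omega)
    unfold lg at *
    omega

theorem R_one_zero : R d n 1 0 = translate (reflections d n) (gamma d n) 1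
    (refl (i₀ hn, 0) (i₁ hn, 0) * gamma d n) := by
  ext u
  rw [mem_R_iff le_rfl (by omega)]
  constructor
  · intro hu
    exact ⟨u.1, ale_refl_mul (by simp) (gamma_lt (by omega) 0) hu u.2.2, (one_mul _).symm⟩
  · rintro ⟨y, hy, hu⟩
    rw [hu, one_mul]
    exact (refl_mul_gamma_isTight hd hn).fix_of_ale hy (refl_mul_gamma_fix hn)

theorem R_two_zero : R d n 2 0 = translate (reflections d n) (gamma d n)
    (1 * refl (i₀ hn, 0) (i₁ hn, 0)) (refl (i₀ hn, 0) (i₁ hn, 0) * gamma d n) := by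
  have hT := isReflSystem d n
  have hne : ((i₀ hn, 0) : Fin n × ZMod d).1 ≠ ((i₁ hn, 0) : Fin n × ZMod d).1 := i₀_ne_i₁ hn
  ext u
  rw [mem_R_iff (by omega) (by omega)]
  constructor
  · intro hu
    have hu : u.1.1 (i₀ hn, 0) = (i₁ hn, 0) := hu
    refine ⟨refl (i₀ hn, 0) (i₁ hn, 0) * u.1, ?_, by rw [one_mul, refl_mul_cancel_left hne]⟩
    have h1 := lg_refl_mul_of_apply (k := i₀ hn) (i₀_ne_i₁ hn) hu
    have h2 := lg_refl hne
    have h3 := (hT.absLE_inv_mul (t := refl (i₀ hn, 0) (i₁ hn, 0))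
      (y := refl (i₀ hn, 0) (i₁ hn, 0) * u.1) (c := gamma d n) ?_ ?_).1
    · rwa [refl_inv hne] at h3
    · rw [refl_mul_cancel_left hne]
      unfold lg at *
      omega
    · rw [refl_mul_cancel_left hne]
      exact u.2.2
  · rintro ⟨y, hy, hu⟩
    rw [hu, one_mul, G.mul_apply]
    have := (refl_mul_gamma_isTight hd hn).fix_of_ale hy (refl_mul_gamma_fix hn)
    rw [this, refl_left hne]

theorem nonempty_nc_refl_mul_gamma :
    Nonempty (NC (reflections d n) (refl (i₀ hn, 0) (i₁ hn, 0) * gamma d n) ≃o NCD d (n - 1)) := by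
  have ht := refl_mul_gamma_isTight (d := d) hd hn
  rw [refl_mul_gamma hn] at ht ⊢
  exact nonempty_nc_emb _ _ Function.injective_id (Or.inl Function.surjective_id) ht

/-! ### The parts `D₁` and `D₂` -/

/-- γ has length n and (2 3 … n-1) has length n - 3, so a factorization with only three reflections
in addition has no slack. -/
theorem mul_innerCycle_ale {a : G d n} {x y : Fin n × ZMod d} (hxy : x.1 ≠ y.1) (ha : lg a ≤ 2)
    (h : a * (refl x y * innerCycle d hn) = gamma d n) :
    ale (a * innerCycle d hn) (gamma d n) ∧ lg (a * innerCycle d hn) + 1 = n ∧ lg a = 2 := by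
  have hT := isReflSystem d n
  have h1 := lg_innerCycle (d := d) hd hn
  have h2 := lg_gamma (d := d) (n := n) hd (by omega)
  have h3 := lg_refl hxy
  have h4 : a * innerCycle d hn *
      ((innerCycle d hn)⁻¹ * refl x y * (innerCycle d hn)⁻¹⁻¹) = gamma d n := by
    rw [← h]; group
  have h5 := hT.len_conj (innerCycle d hn)⁻¹ (refl x y)
  have h6 := hT.len_mul_le (a * innerCycle d hn)
    ((innerCycle d hn)⁻¹ * refl x y * (innerCycle d hn)⁻¹⁻¹)
  have h7 := hT.len_mul_le a (innerCycle d hn)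
  rw [h4] at h6
  have h8 : lg (a * innerCycle d hn) + 1 = n ∧ lg a = 2 := by
    unfold lg at *
    omega
  refine ⟨hT.absLE_of_len_add_le h4 ?_, h8⟩
  unfold lg at *
  omega

omit hd in
theorem lg_refl_mul_refl_le {x y x' y' : Fin n × ZMod d} (h : x.1 ≠ y.1) (h' : x'.1 ≠ y'.1) :
    lg (refl x y * refl x' y') ≤ 2 := by
  have h1 := lg_refl_mul_le h (refl x' y')
  have h2 := lg_refl_le h'
  omega

theorem mul_innerCycle_one :
    ale (refl (i₀ hn, 0) (iₙ hn, -1) * refl (i₀ hn, 0) (iₙ hn, 0) * innerCycle d hn) (gamma d n) ∧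
    lg (refl (i₀ hn, 0) (iₙ hn, -1) * refl (i₀ hn, 0) (iₙ hn, 0) * innerCycle d hn) + 1 = n ∧
    lg (refl (i₀ hn, 0) (iₙ hn, (-1 : ZMod d)) * refl (i₀ hn, 0) (iₙ hn, 0)) = 2 := by
  refine mul_innerCycle_ale hd hn (x := (i₀ hn, 0)) (y := (i₁ hn, 0)) (i₀_ne_i₁ hn)
    (lg_refl_mul_refl_le (i₀_ne_iₙ hn) (i₀_ne_iₙ hn)) ?_
  rw [mul_assoc]
  exact (gamma_eq_mul hn).symm

theorem mul_innerCycle_two :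
    ale (refl (i₀ hn, 0) (i₁ hn, -1) * refl (i₀ hn, 0) (iₙ hn, -1) * innerCycle d hn) (gamma d n) ∧
    lg (refl (i₀ hn, 0) (i₁ hn, -1) * refl (i₀ hn, 0) (iₙ hn, -1) * innerCycle d hn) + 1 = n ∧
    lg (refl (i₀ hn, 0) (i₁ hn, (-1 : ZMod d)) * refl (i₀ hn, 0) (iₙ hn, -1)) = 2 := by
  refine mul_innerCycle_ale hd hn (x := (i₀ hn, 0)) (y := (iₙ hn, 0)) (i₀_ne_iₙ hn)
    (lg_refl_mul_refl_le (i₀_ne_i₁ hn) (i₀_ne_iₙ hn)) ?_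
  rw [mul_assoc]
  exact (gamma_eq_mul' hn).symm

theorem isDoubled_one : IsDoubled (reflections d n) (gamma d n) (refl (i₀ hn, 0) (iₙ hn, -1))
    (refl (i₀ hn, 0) (iₙ hn, 0)) (innerCycle d hn) := by
  obtain ⟨h1, h2, -⟩ := mul_innerCycle_one (d := d) hd hn
  refine isDoubled_of_fix (i₀_ne_iₙ hn) (innerCycle_isTight hd hn) (innerCycle_zero hn) h1 ?_
  have h3 := lg_innerCycle (d := d) hd hn
  have h4 := lg_refl (x := (i₀ hn, 0)) (y := (iₙ hn, (-1 : ZMod d))) (i₀_ne_iₙ hn)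
  unfold lg at *
  omega

theorem isDoubled_two : IsDoubled (reflections d n) (gamma d n) (refl (i₀ hn, 0) (i₁ hn, -1))
    (refl (i₀ hn, 0) (iₙ hn, -1)) (innerCycle d hn) := by
  obtain ⟨h1, h2, -⟩ := mul_innerCycle_two (d := d) hd hn
  refine isDoubled_of_fix (i₀_ne_iₙ hn) (innerCycle_isTight hd hn) (innerCycle_zero hn) h1 ?_
  have h3 := lg_innerCycle (d := d) hd hn
  have h4 := lg_refl (x := (i₀ hn, 0)) (y := (i₁ hn, (-1 : ZMod d))) (i₀_ne_i₁ hn)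
  unfold lg at *
  omega

theorem innerCycle_fix_zero {y : G d n} (hy : ale y (innerCycle d hn)) :
    y.1 (i₀ hn, 0) = (i₀ hn, 0) :=
  (innerCycle_isTight hd hn).fix_of_ale hy (innerCycle_zero hn)

theorem innerCycle_fix_last {y : G d n} (hy : ale y (innerCycle d hn)) :
    y.1 (iₙ hn, 0) = (iₙ hn, 0) :=
  (innerCycle_isTight hd hn).fix_of_ale hy (innerCycle_last hn)

omit [NeZero d] hd in
theorem diag_apply_zero :
    (refl (i₀ hn, 0) (iₙ hn, -1) * refl (i₀ hn, 0) (iₙ hn, 0) : G d n).1 (i₀ hn, 0) =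
      (i₀ hn, 1) := by
  have hne := i₀_ne_iₙ hn
  rw [G.mul_apply, refl_left hne, refl_apply hne]
  simp [hne.symm]

/-- A colour change at 1 splits off a diagonal element [1]_s [a]_{-s} below γ, which must be [1]_1
[n]_{-1}. The rest fixes 1 and lies below ((1^(0) 2^(0)))(2 … n-1), from which 1 is cut out. -/
theorem color_of_apply_zero {u : G d n} (hu : ale u (gamma d n)) {s : ZMod d} (hs : s ≠ 0)
    (h : u.1 (i₀ hn, 0) = (i₀ hn, s)) : s = 1 ∧
      ∃ y, ale y (innerCycle d hn) ∧
        u = refl (i₀ hn, 0) (iₙ hn, -1) * refl (i₀ hn, 0) (iₙ hn, 0) * y := by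
  have hT := isReflSystem d n
  obtain ⟨a, y, ha, hy, rfl, hl⟩ := exists_eq_of_color_change hs h
  rw [← mul_assoc] at hu hl ⊢
  have h2 := lg_refl_mul_refl_le (x := (i₀ hn, 0)) (y := a) (x' := (i₀ hn, 0))
    (y' := (a.1, a.2 + s)) ha ha
  have h3 := hT.len_mul_le (refl (i₀ hn, 0) a * refl (i₀ hn, 0) (a.1, a.2 + s)) y
  have h4 : len (reflections d n) (refl (i₀ hn, 0) a * refl (i₀ hn, 0) (a.1, a.2 + s) * y) =
      len (reflections d n) (refl (i₀ hn, 0) a * refl (i₀ hn, 0) (a.1, a.2 + s)) +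
        len (reflections d n) y := by
    unfold lg at *; omega
  obtain ⟨ha', rfl⟩ := eq_last_of_diag_ale_gamma hd hn ha hs ((hT.absLE_mul_iff.2 h4).trans hu)
  have hq : refl (i₀ hn, 0) a * refl (i₀ hn, 0) (a.1, a.2 + 1) =
      refl (i₀ hn, 0) (iₙ hn, -1) * refl (i₀ hn, 0) (iₙ hn, 0) := by
    obtain ⟨j, c⟩ := a
    obtain rfl : j = iₙ hn := ha'
    have := refl_mul_refl_same (i₀_ne_iₙ hn) c (-1) 1
    rwa [neg_add_cancel] at this
  rw [hq] at h4 hu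
  refine ⟨rfl, y, ?_, by rw [hq]⟩
  have h5 := (hT.absLE_inv_mul h4 hu).1
  have h6 : (refl (i₀ hn, 0) (iₙ hn, -1) * refl (i₀ hn, 0) (iₙ hn, 0) : G d n)⁻¹ * gamma d n =
      refl (i₀ hn, 0) (i₁ hn, 0) * innerCycle d hn := by
    rw [gamma_eq_mul hn]; group
  rw [h6] at h5
  have h7 := ale_refl_mul (j := (i₁ hn, 0)) (i₀_ne_i₁ hn)
    (by rw [G.mul_apply, innerCycle_zero, refl_left (i₀_ne_i₁ hn)]) hy h5
  rwa [refl_mul_cancel_left (i₀_ne_i₁ hn)] at h7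

theorem R_one_one : R d n 1 1 = translate (reflections d n) (gamma d n)
    (refl (i₀ hn, 0) (iₙ hn, -1) * refl (i₀ hn, 0) (iₙ hn, 0)) (innerCycle d hn) := by
  ext u
  rw [mem_R_iff le_rfl (by omega)]
  constructor
  · intro hu
    exact (color_of_apply_zero hd hn u.2.2 (one_ne_zero_of_two_le hd) hu).2
  · rintro ⟨y, hy, hu⟩
    rw [hu, G.mul_apply]
    have := innerCycle_fix_zero hd hn hy
    rw [this]
    exact diag_apply_zero hn

omit [NeZero d] hd in
-- [1]_1 [n]_{-1} also factors with ((1^(0) n^(-2))) in front and ((1^(0) n^(-1))) behind, so f₁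
-- cancels the front factor.
theorem f₁_mul (y : G d n) :
    f₁ hn (refl (i₀ hn, 0) (iₙ hn, -1) * refl (i₀ hn, 0) (iₙ hn, 0) * y) =
      refl (i₀ hn, 0) (iₙ hn, -1) * y := by
  have h := refl_mul_refl_same (d := d) (i₀_ne_iₙ hn) (-1) (-2) 1
  rw [neg_add_cancel, show (-2 + 1 : ZMod d) = -1 by norm_num] at h
  rw [f₁, h, colRefl_eq_refl, mul_assoc, refl_mul_cancel_left (i₀_ne_iₙ hn)]

theorem E₁_eq : E₁ d n hn = translate (reflections d n) (gamma d n)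
    (refl (i₀ hn, 0) (iₙ hn, -1)) (innerCycle d hn) := by
  have hD := isDoubled_one (d := d) hd hn
  have hT := isReflSystem d n
  ext u
  constructor
  · rintro ⟨x, hx, hu⟩
    rw [R_one_one hd hn] at hx
    obtain ⟨y, hy, hx⟩ := hx
    refine ⟨y, hy, ?_⟩
    rw [← hu, hx, f₁_mul]
  · rintro ⟨y, hy, hu⟩
    refine ⟨NC.of hT (hD.t_absLE hT (hD.rabsLE_rw hT hy)), ?_, ?_⟩
    · rw [R_one_one hd hn]
      exact ⟨y, hy, (mul_assoc _ _ _).symm⟩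
    · change f₁ hn (refl (i₀ hn, 0) (iₙ hn, -1) * (refl (i₀ hn, 0) (iₙ hn, 0) * y)) = u.1
      rw [hu, ← mul_assoc, f₁_mul]

/-- An element below `[1]_1 [n]_{-1} (2 … n-1)` that fixes `1^(0)` is below `(2 … n-1)`. -/
theorem ale_innerCycle_of_fix {y : G d n} (hy : y.1 (i₀ hn, 0) = (i₀ hn, 0))
    (h : ale y (refl (i₀ hn, 0) (iₙ hn, -1) * refl (i₀ hn, 0) (iₙ hn, 0) * innerCycle d hn)) :
    ale y (innerCycle d hn) := by
  have hT := isReflSystem d n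
  obtain ⟨h1, h2, h3⟩ := mul_innerCycle_one (d := d) hd hn
  have hic := lg_innerCycle (d := d) hd hn
  set p := refl (i₀ hn, 0) (iₙ hn, (-1 : ZMod d)) * refl (i₀ hn, 0) (iₙ hn, 0) with hp
  have htight : IsTight (p * innerCycle d hn) := ((gamma_isTight hd (by omega)).of_ale h1).1
  have hp0 : p.1 (i₀ hn, 0) = (i₀ hn, 1) := diag_apply_zero hn
  have hpk : ∀ k : Fin n, 1 ≤ (k : ℕ) → (k : ℕ) + 1 < n → p.1 (k, 0) = (k, 0) := by
    intro k hk1 hk2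
    have e1 : k ≠ i₀ hn := fun h => by rw [h] at hk1; simp at hk1
    have e2 : k ≠ iₙ hn := fun h => by rw [h] at hk2; simp only at hk2; omega
    rw [hp, G.mul_apply, refl_of_ne (i₀_ne_iₙ hn) (z := (k, 0)) e1 e2,
      refl_of_ne (i₀_ne_iₙ hn) (z := (k, 0)) e1 e2]
  -- The colour 0 copy of {2, …, n-1} is preserved by the whole element, hence by everything below
  -- it.
  have hB : ∀ k ∈ {k : Fin n | 1 ≤ (k : ℕ) ∧ (k : ℕ) + 1 < n},
      ((p * innerCycle d hn).1 (k, (0 : Fin n → ZMod d) k)).1 ∈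
        {k : Fin n | 1 ≤ (k : ℕ) ∧ (k : ℕ) + 1 < n} ∧
      ((p * innerCycle d hn).1 (k, (0 : Fin n → ZMod d) k)).2 =
        (0 : Fin n → ZMod d) ((p * innerCycle d hn).1 (k, (0 : Fin n → ZMod d) k)).1 := by
    rintro k ⟨hk1, hk2⟩
    obtain ⟨e1, e2, e3⟩ := innerCycle_inner (d := d) hn hk1 hk2
    have e4 : (innerCycle d hn).1 (k, 0) = (((innerCycle d hn).1 (k, 0)).1, 0) :=
      Prod.ext rfl e3
    have e5 : (p * innerCycle d hn).1 (k, 0) = (((innerCycle d hn).1 (k, 0)).1, 0) := by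
      rw [G.mul_apply, e4, hpk _ e1 e2]
    simp only [Pi.zero_apply, e5, Set.mem_ofPred_eq, and_true]
    exact ⟨e1, e2⟩
  have hy' : y⁻¹.1 (i₀ hn, 0) = (i₀ hn, 0) := G.inv_apply_eq.2 hy
  have hyz : (y⁻¹ * (p * innerCycle d hn)).1 (i₀ hn, 0) = (i₀ hn, 1) := by
    rw [G.mul_apply, G.mul_apply, innerCycle_zero, hp0, G.fix_color hy']
  -- The complement of y carries the whole colour change at 1, so it starts with two reflections on
  -- the indices 1 and a.
  obtain ⟨a, x, ha, hx, hax, hl⟩ := exists_eq_of_color_change (one_ne_zero_of_two_le hd) hyz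
  have hale : ale (refl (i₀ hn, 0) a) (p * innerCycle d hn) := by
    refine AbsLE.trans (v := y⁻¹ * (p * innerCycle d hn)) ?_ (hT.inv_mul_absLE h)
    refine hT.absLE_of_len_add_le hax.symm ?_
    have e1 := lg_refl_mul_le (x := (i₀ hn, 0)) (y := (a.1, a.2 + 1)) ha x
    have e2 := lg_refl_le (x := (i₀ hn, 0)) (y := a) ha
    unfold lg at *
    omega
  -- The first of these reflections lies below and preserves {2, …, n-1}; only the index n is left
  -- for a.
  have hal : a.1 = iₙ hn := by
    by_contra hal
    have hmem : a.1 ∈ {k : Fin n | 1 ≤ (k : ℕ) ∧ (k : ℕ) + 1 < n} := by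
      have e1 : (a.1 : ℕ) ≠ 0 := fun h => ha (Fin.ext h.symm)
      have e2 : (a.1 : ℕ) ≠ n - 1 := fun h => hal (Fin.ext h)
      have := a.1.2
      exact ⟨by omega, by omega⟩
    have := (htight.section_of_ale hale hB hmem).1
    rw [refl_apply (by exact ha)] at this
    simp [Ne.symm ha] at this
  have hyl : (y.1 (iₙ hn, 0)).1 = iₙ hn := by
    have e1 := htight.not_mem_of_ale h hB (k := iₙ hn)
      (by simp only [Set.mem_ofPred_eq]; omega)
    have e2 : (y.1 (iₙ hn, 0)).1 ≠ i₀ hn := G.fst_ne_of_fix hy (i₀_ne_iₙ hn).symm 0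
    have e3 : ((y.1 (iₙ hn, 0)).1 : ℕ) ≠ 0 := fun h => e2 (Fin.ext h)
    simp only [Set.mem_ofPred_eq] at e1
    apply Fin.ext
    simp only
    omega
  -- y fixes 1 and maps the index n to itself, so it commutes with p = [1]_1 [n]_{-1}, and p can be
  -- cancelled. The loss of two in length is exactly the difference between p (2 … n-1) and (2 …
  -- n-1).
  have hcomm : y * p = p * y := diag_commute (i₀_ne_iₙ hn) hy hyl
  have hpa : refl (i₀ hn, 0) a * (refl (i₀ hn, 0) (a.1, a.2 + 1) * x) = p * x := by
    rw [← mul_assoc]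
    congr 1
    obtain ⟨j, c⟩ := a
    obtain rfl : j = iₙ hn := hal
    have := refl_mul_refl_same (i₀_ne_iₙ hn) c (-1) 1
    rwa [neg_add_cancel] at this
  have hxe : x = y⁻¹ * innerCycle d hn := by
    rw [hpa] at hax
    have : x = p⁻¹ * (y⁻¹ * (p * innerCycle d hn)) := by rw [hax]; group
    have h' : p⁻¹ * y⁻¹ * p = y⁻¹ := by
      rw [← mul_inv_rev, hcomm, mul_inv_rev]; group
    rw [this, ← mul_assoc, ← mul_assoc, h']
  rw [hxe] at hl
  have := hT.absLE_iff.1 h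
  apply hT.absLE_of_le
  unfold lg at *
  omega

/-- After division by ((1^(0) 2^(-1))) the bound is [1]_1 [n]_{-1} (2 … n-1). It does not change the
index 1, so a single cut is unavailable and `ale_innerCycle_of_fix` takes its place. -/
theorem R_two_neg_one : R d n 2 (-1) = translate (reflections d n) (gamma d n)
    (refl (i₀ hn, 0) (i₁ hn, -1)) (innerCycle d hn) := by
  have hT := isReflSystem d n
  have hne : ((i₀ hn, 0) : Fin n × ZMod d).1 ≠ ((i₁ hn, -1) : Fin n × ZMod d).1 := i₀_ne_i₁ hn
  ext u
  rw [mem_R_iff (by omega) (by omega)]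
  constructor
  · intro hu
    have hu : u.1.1 (i₀ hn, 0) = (i₁ hn, -1) := hu
    refine ⟨refl (i₀ hn, 0) (i₁ hn, -1) * u.1, ?_, by rw [refl_mul_cancel_left hne]⟩
    have h1 := lg_refl_mul_of_apply (k := i₀ hn) (i₀_ne_i₁ hn) hu
    have h2 := lg_refl hne
    have h3 := (hT.absLE_inv_mul (t := refl (i₀ hn, 0) (i₁ hn, -1))
      (y := refl (i₀ hn, 0) (i₁ hn, -1) * u.1) (c := gamma d n) ?_ ?_).1
    · refine ale_innerCycle_of_fix hd hn ?_ ?_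
      · rw [G.mul_apply]
        exact (congrArg _ hu).trans (refl_right hne)
      · have e : (refl (i₀ hn, 0) (i₁ hn, -1))⁻¹ * gamma d n =
            refl (i₀ hn, 0) (iₙ hn, -1) * refl (i₀ hn, 0) (iₙ hn, 0) * innerCycle d hn := by
          rw [refl_inv hne, gamma_eq_mul' hn, refl_mul_cancel_left hne, ← mul_assoc]
        rwa [e] at h3
    · rw [refl_mul_cancel_left hne]
      unfold lg at *
      omega
    · rw [refl_mul_cancel_left hne]
      exact u.2.2
  · rintro ⟨y, hy, hu⟩
    rw [hu, G.mul_apply]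
    have := innerCycle_fix_zero hd hn hy
    rw [this, refl_left hne]

omit [NeZero d] hd in
theorem f₂_mul (y : G d n) : f₂ hn (refl (i₀ hn, 0) (i₁ hn, -1) * y) =
    refl (i₀ hn, 0) (i₁ hn, -1) * refl (i₀ hn, 0) (iₙ hn, -1) * y := by
  rw [f₂, colRefl_eq_refl, ← refl_mul_refl_neg_one (i₀_ne_i₁ hn) (i₀_ne_iₙ hn) (i₁_ne_iₙ hn),
    mul_assoc]

theorem E₂_eq : E₂ d n hn = translate (reflections d n) (gamma d n)
    (refl (i₀ hn, 0) (i₁ hn, -1) * refl (i₀ hn, 0) (iₙ hn, -1)) (innerCycle d hn) := by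
  have hD := isDoubled_two (d := d) hd hn
  have hT := isReflSystem d n
  ext u
  constructor
  · rintro ⟨x, hx, hu⟩
    rw [R_two_neg_one hd hn] at hx
    obtain ⟨y, hy, hx⟩ := hx
    refine ⟨y, hy, ?_⟩
    rw [← hu, hx, f₂_mul]
  · rintro ⟨y, hy, hu⟩
    refine ⟨NC.of hT (hD.t_absLE hT (hD.absLE_rw hT hy)), ?_, ?_⟩
    · rw [R_two_neg_one hd hn]
      exact ⟨y, hy, rfl⟩
    · change f₂ hn (refl (i₀ hn, 0) (i₁ hn, -1) * y) = u.1
      rw [hu, f₂_mul]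

theorem E₁_apply {u : NCD d n} (hu : u ∈ E₁ d n hn) :
    u.1.1 (i₀ hn, 0) = (iₙ hn, -1) ∧ u.1.1 (iₙ hn, 0) = (i₀ hn, 1) := by
  rw [E₁_eq hd hn] at hu
  obtain ⟨y, hy, hu⟩ := hu
  have hne := i₀_ne_iₙ hn
  rw [hu, G.mul_apply, G.mul_apply]
  constructor
  · rw [innerCycle_fix_zero hd hn hy, refl_left hne]
  · rw [innerCycle_fix_last hd hn hy, refl_apply hne]
    simp [hne.symm]

theorem E₂_apply {u : NCD d n} (hu : u ∈ E₂ d n hn) :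
    u.1.1 (i₀ hn, 0) = (iₙ hn, -1) ∧ u.1.1 (iₙ hn, 0) = (i₁ hn, 0) := by
  rw [E₂_eq hd hn] at hu
  obtain ⟨y, hy, hu⟩ := hu
  have hne := i₀_ne_iₙ hn
  have hne' := i₀_ne_i₁ hn
  have hne'' := i₁_ne_iₙ hn
  rw [hu, G.mul_apply, G.mul_apply, G.mul_apply, G.mul_apply]
  constructor
  · rw [innerCycle_fix_zero hd hn hy, refl_left hne, refl_of_ne hne' hne.symm hne''.symm]
  · rw [innerCycle_fix_last hd hn hy, refl_apply (x := (i₀ hn, 0)) (y := (iₙ hn, -1)) hne]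
    simp [hne.symm, refl_apply (x := (i₀ hn, 0)) (y := (i₁ hn, -1)) hne']

theorem E₁_subset : E₁ d n hn ⊆ R d n n (-1) := fun u hu => by
  rw [mem_R_iff (by omega) le_rfl]
  exact (E₁_apply hd hn hu).1

theorem E₂_subset : E₂ d n hn ⊆ R d n n (-1) := fun u hu => by
  rw [mem_R_iff (by omega) le_rfl]
  exact (E₂_apply hd hn hu).1

end PartsOfNC

end GddNC

/-! ### The part D and its pieces -/

namespace GddNC

/-- Equal ranks at the bottom and at the top make the a i and b i exactly the extremal elements;
disjointness makes i ↦ a i and i ↦ b i injective, and a i is paired with b i. Connectedness runs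
through p. For empty ι nothing is required of p. -/
theorem isSymPart_iUnion {W : Type*} [Group W] {T : Set W} {c : W} (hT : IsReflSystem T)
    {ι : Type*} {N : ℕ} {A : ι → Set (NC T c)} {a b : ι → NC T c} {m m' : ℕ}
    (ha : ∀ i, a i ∈ A i) (hb : ∀ i, b i ∈ A i) (hA : ∀ i, ∀ u ∈ A i, a i ≤ u ∧ u ≤ b i)
    (hm : ∀ i, len T (a i).1 = m) (hm' : ∀ i, len T (b i).1 = m') (hN : m + m' = N)
    (hdisj : ∀ i j u, u ∈ A i → u ∈ A j → i = j) {p : NC T c}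
    (hp : ∀ i, p ∈ ⋃ i, A i ∧ a i ≤ p) (hs : IsSaturated (⋃ i, A i)) :
    IsSymPart N (⋃ i, A i) where
  connected := by
    intro X hX ⟨x, hx⟩ ⟨y, hy⟩
    obtain ⟨i, hi⟩ := Set.mem_iUnion.1 (hX hx)
    obtain ⟨j, hj⟩ := Set.mem_iUnion.1 hy.1
    have hai := Set.mem_iUnion.2 ⟨i, ha i⟩
    have haj := Set.mem_iUnion.2 ⟨j, ha j⟩
    by_cases hpX : p ∈ X
    · by_cases h : a j ∈ X
      · exact ⟨_, h, y, hy, Or.inl (hA j y hj).1⟩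
      · exact ⟨p, hpX, _, ⟨haj, h⟩, Or.inr (hp j).2⟩
    · by_cases h : a i ∈ X
      · exact ⟨_, h, p, ⟨(hp i).1, hpX⟩, Or.inl (hp i).2⟩
      · exact ⟨x, hx, _, ⟨hai, h⟩, Or.inr (hA i x hi).1⟩
  covBy := hs.covBy hT
  symmetric := by
    have hmin : ∀ i, Minimal (· ∈ ⋃ i, A i) (a i) := by
      refine fun i => ⟨Set.mem_iUnion.2 ⟨i, ha i⟩, fun v hv hvi => ?_⟩
      obtain ⟨j, hj⟩ := Set.mem_iUnion.1 hv
      have h1 := (hA j v hj).1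
      have h2 : a j = a i := NC.ext (hT.eq_of_len_le (h1.trans hvi) (by rw [hm, hm]))
      rwa [← h2]
    have hmax : ∀ i, Maximal (· ∈ ⋃ i, A i) (b i) := by
      refine fun i => ⟨Set.mem_iUnion.2 ⟨i, hb i⟩, fun v hv hvi => ?_⟩
      obtain ⟨j, hj⟩ := Set.mem_iUnion.1 hv
      have h1 := (hA j v hj).2
      have h2 : b i = b j := NC.ext (hT.eq_of_len_le (hvi.trans h1) (by rw [hm', hm']))
      rwa [h2]
    let f : ι → {p : NC T c // Minimal (· ∈ ⋃ i, A i) p} := fun i => ⟨a i, hmin i⟩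
    let g : ι → {p : NC T c // Maximal (· ∈ ⋃ i, A i) p} := fun i => ⟨b i, hmax i⟩
    have hf : Function.Bijective f := by
      refine ⟨fun i j h => ?_, fun ⟨v, hv⟩ => ?_⟩
      · have h' : a i = a j := congrArg Subtype.val h
        exact hdisj i j (a i) (ha i) (h' ▸ ha j)
      · obtain ⟨i, hi⟩ := Set.mem_iUnion.1 hv.1
        have h1 := (hA i v hi).1
        exact ⟨i, Subtype.ext (hT.nc_antisymm h1 (hv.2 (hmin i).1 h1))⟩
    have hg : Function.Bijective g := by
      refine ⟨fun i j h => ?_, fun ⟨v, hv⟩ => ?_⟩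
      · have h' : b i = b j := congrArg Subtype.val h
        exact hdisj i j (b i) (hb i) (h' ▸ hb j)
      · obtain ⟨i, hi⟩ := Set.mem_iUnion.1 hv.1
        have h1 := (hA i v hi).2
        exact ⟨i, Subtype.ext (hT.nc_antisymm (hv.2 (hmax i).1 h1) h1)⟩
    refine ⟨(Equiv.ofBijective f hf).symm.trans (Equiv.ofBijective g hg), fun v => ?_⟩
    obtain ⟨i, rfl⟩ := hf.2 v
    have : (Equiv.ofBijective f hf).symm (f i) = i :=
      (Equiv.ofBijective f hf).symm_apply_apply i
    rw [Equiv.trans_apply, this]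
    change Order.height (a i) + Order.height (b i) = N
    rw [hT.height_eq, hT.height_eq, hm, hm', ← hN]
    norm_cast

theorem refl_commute {d n : ℕ} {x y z w : Fin n × ZMod d} (hzw : z.1 ≠ w.1) (hxy : x.1 ≠ y.1)
    (h1 : x.1 ≠ z.1)
    (h2 : x.1 ≠ w.1) (h3 : y.1 ≠ z.1) (h4 : y.1 ≠ w.1) :
    refl z w * refl x y = (refl x y * refl z w : G d n) := by
  rw [mul_refl _ hxy, refl_of_ne hzw h1 h2, refl_of_ne hzw h3 h4]

section PiecesOfD

/-- The cycle `(2 3 … n)` of length `n - 1`. -/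
abbrev outerCycle {n : ℕ} (d : ℕ) (hn : 3 ≤ n) : G d n := cutGamma hn (n - 1) (by omega) (-1)

/-- The reflection `((1^(0) n^(-1)))`. -/
abbrev cornerRefl {n : ℕ} (d : ℕ) (hn : 3 ≤ n) : G d n := refl (i₀ hn, 0) (iₙ hn, -1)

variable {d n : ℕ} [NeZero d] (hd : 2 ≤ d) (hn : 3 ≤ n)

omit [NeZero d] in
theorem outerCycle_last : (outerCycle d hn).1 (iₙ hn, 0) = (i₁ hn, 0) := by
  rw [cutGamma_last' hn _ _ (by omega) rfl]; simp

omit [NeZero d] in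
theorem cornerRefl_of_ne {k : Fin n} (h0 : k ≠ i₀ hn) (hl : k ≠ iₙ hn) (s : ZMod d) :
    (cornerRefl d hn).1 (k, s) = (k, s) :=
  refl_of_ne (x := (i₀ hn, 0)) (y := (iₙ hn, -1)) (i₀_ne_iₙ hn) (z := (k, s)) h0 hl

include hd

theorem lg_outerCycle : lg (outerCycle d hn) + 2 = n := by
  have h0 := (isCut_top hd hn (-1)).lg_eq
  rw [lg_gamma hd (by omega)] at h0
  exact h0.symm

theorem mem_R_last_iff {u : NCD d n} :
    u ∈ R d n n (-1) ↔ ∃ y, ale y (outerCycle d hn) ∧ u.1 = cornerRefl d hn * y := by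
  rw [R_eq_translate hn (by omega) le_rfl (isCut_top hd hn (-1))]
  rfl

theorem outerCycle_section {y : G d n} (hy : ale y (outerCycle d hn)) :
    (y.1 (iₙ hn, 0)).1 ≠ i₀ hn ∧ (y.1 (iₙ hn, 0)).2 = 0 := by
  have h := (isCut_top hd hn (-1)).tight_w.section_of_ale hy (B := {k | k ≠ i₀ hn}) (c := 0)
    (fun k hk => cutGamma_ne_zero hn hk) (k := iₙ hn) (i₀_ne_iₙ hn).symm
  exact h

theorem mem_E₁_of_fix {u : NCD d n} {y : G d n} (hy : ale y (outerCycle d hn))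
    (hu : u.1 = cornerRefl d hn * y) (h : y.1 (iₙ hn, 0) = (iₙ hn, 0)) : u ∈ E₁ d n hn := by
  rw [E₁_eq hd hn]
  exact ⟨y, ale_refl_mul (j := (i₁ hn, 0)) (i₁_ne_iₙ hn).symm (outerCycle_last hn) h hy, hu⟩

theorem mem_E₂_of_apply {u : NCD d n} {y : G d n} (hy : ale y (outerCycle d hn))
    (hu : u.1 = cornerRefl d hn * y) (h : y.1 (iₙ hn, 0) = (i₁ hn, 0)) : u ∈ E₂ d n hn := by
  have hT := isReflSystem d n
  have hne : ((iₙ hn, 0) : Fin n × ZMod d).1 ≠ ((i₁ hn, 0) : Fin n × ZMod d).1 :=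
    (i₁_ne_iₙ hn).symm
  rw [E₂_eq hd hn]
  refine ⟨refl (iₙ hn, 0) (i₁ hn, 0) * y, ?_, ?_⟩
  · have h1 := lg_refl_mul_of_apply (k := iₙ hn) (j := (i₁ hn, 0)) hne h
    have h2 := lg_refl hne
    have h3 := (hT.absLE_inv_mul (t := refl (iₙ hn, 0) (i₁ hn, 0))
      (y := refl (iₙ hn, 0) (i₁ hn, 0) * y) (c := outerCycle d hn) ?_ ?_).1
    · rwa [refl_inv hne] at h3
    · rw [refl_mul_cancel_left hne]
      unfold lg at *
      omega
    · rwa [refl_mul_cancel_left hne]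
  · rw [hu, ← refl_neg_one_mul_refl (i₀_ne_i₁ hn) (i₀_ne_iₙ hn) (i₁_ne_iₙ hn), mul_assoc,
      refl_mul_cancel_left hne]

omit [NeZero d] hd in
theorem mem_DPiece_iff {i : ℕ} (hi : 3 ≤ i) (hi' : i + 1 ≤ n) {u : NCD d n} :
    u ∈ DPiece d n i ↔ u ∈ R d n n (-1) ∧ u.1.1 (iₙ hn, 0) = (⟨i - 1, by omega⟩, 0) := by
  refine and_congr_right fun _ => ⟨?_, fun h => ⟨_, _, ?_, ?_, h⟩⟩
  · rintro ⟨a, b, ha, hb, h⟩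
    have ha' : a = iₙ hn := Fin.ext (by simp only; omega)
    have hb' : b = ⟨i - 1, by omega⟩ := Fin.ext (by simp only; omega)
    rw [← ha', ← hb']
    exact h
  · simp only; omega
  · simp only; omega

theorem mem_DPiece_iff_exists {i : ℕ} (hi : 3 ≤ i) (hi' : i + 1 ≤ n) {u : NCD d n} :
    u ∈ DPiece d n i ↔ ∃ y, ale y (outerCycle d hn) ∧ u.1 = cornerRefl d hn * y ∧
      y.1 (iₙ hn, 0) = (⟨i - 1, by omega⟩, 0) := by
  have hr : ((i₀ hn, 0) : Fin n × ZMod d).1 ≠ ((iₙ hn, -1) : Fin n × ZMod d).1 := i₀_ne_iₙ hn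
  have hf : (cornerRefl d hn).1 (⟨i - 1, by omega⟩, 0) = (⟨i - 1, by omega⟩, 0) :=
    cornerRefl_of_ne hn (by simp only [ne_eq, Fin.mk.injEq]; omega)
      (by simp only [ne_eq, Fin.mk.injEq]; omega) 0
  rw [mem_DPiece_iff hn hi hi', mem_R_last_iff hd hn]
  constructor
  · rintro ⟨⟨y, hy, hu⟩, h⟩
    refine ⟨y, hy, hu, ?_⟩
    have : y = cornerRefl d hn * u.1 := by rw [hu, refl_mul_cancel_left hr]
    rw [this, G.mul_apply, h, hf]
  · rintro ⟨y, hy, hu, h⟩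
    exact ⟨⟨y, hy, hu⟩, by rw [hu, G.mul_apply, h, hf]⟩

/-- Another pair of cuts, now of the cycle (2 3 … n) at the index n. -/
theorem DPiece_eq {i : ℕ} (hi : 3 ≤ i) (hi' : i + 1 ≤ n) :
    DPiece d n i = translate (reflections d n) (gamma d n)
      (cornerRefl d hn * refl (iₙ hn, 0) (⟨i - 1, by omega⟩, 0)) (twoCycles d hn i (by omega)) := by
  ext u
  rw [mem_DPiece_iff_exists hd hn hi hi']
  have hc := (isCut_twoCycles hd hn hi hi').ale_and_apply_iff
  constructor
  · rintro ⟨y, hy, hu, h⟩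
    obtain ⟨x, hx, rfl⟩ := (hc y).1 ⟨hy, h⟩
    exact ⟨x, hx, by rw [hu, mul_assoc]⟩
  · rintro ⟨x, hx, hu⟩
    obtain ⟨h1, h2⟩ := (hc _).2 ⟨x, hx, rfl⟩
    exact ⟨_, h1, by rw [hu, mul_assoc], h2⟩

theorem lg_cornerRefl_mul {y : G d n} (hy : ale y (outerCycle d hn)) :
    lg (cornerRefl d hn * y) = 1 + lg y := by
  have h := (isReflSystem d n).len_mul_of_absLE (isCut_top hd hn (-1)).reduced hy
  have h1 := lg_refl (x := (i₀ hn, 0)) (y := (iₙ hn, (-1 : ZMod d))) (i₀_ne_iₙ hn)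
  unfold lg at *
  rw [h, h1]

theorem cornerRefl_mul_ale {y : G d n} (hy : ale y (outerCycle d hn)) :
    ale (cornerRefl d hn * y) (gamma d n) :=
  ((isReflSystem d n).mul_absLE_mul (isCut_top hd hn (-1)).reduced hy).trans
    (isCut_top hd hn (-1)).refl_mul_ale

theorem twoCycles_len {i : ℕ} (hi : 3 ≤ i) (hi' : i + 1 ≤ n) :
    lg (cornerRefl d hn * refl (iₙ hn, 0) (⟨i - 1, by omega⟩, 0)) = 2 ∧
    lg (twoCycles d hn i (by omega)) + 4 = n ∧
    lg (cornerRefl d hn * refl (iₙ hn, 0) (⟨i - 1, by omega⟩, 0) * twoCycles d hn i (by omega)) + 2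
      = n ∧
    ale (cornerRefl d hn * refl (iₙ hn, 0) (⟨i - 1, by omega⟩, 0) * twoCycles d hn i (by omega))
      (gamma d n) := by
  have hc : IsCut (outerCycle d hn) (iₙ hn) (⟨i - 1, by omega⟩, 0) (i₁ hn, 0) _ :=
    isCut_twoCycles hd hn hi hi'
  have hT := isReflSystem d n
  have h1 := lg_outerCycle hd hn
  have h2 := hc.lg_eq
  have h3 := hc.lg_refl_mul
  have h4 := lg_cornerRefl_mul hd hn hc.refl_mul_ale
  have h5 := lg_cornerRefl_mul hd hn ((hT.absLE_mul_iff.2 hc.reduced).trans hc.refl_mul_ale)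
  have h6 := lg_refl (x := (iₙ hn, (0 : ZMod d))) (y := (⟨i - 1, by omega⟩, 0)) hc.ne
  rw [← mul_assoc] at h4
  refine ⟨by omega, by omega, by omega, ?_⟩
  rw [mul_assoc]
  exact cornerRefl_mul_ale hd hn hc.refl_mul_ale

theorem DPiece_reduced {i : ℕ} (hi : 3 ≤ i) (hi' : i + 1 ≤ n) :
    len (reflections d n) (cornerRefl d hn * refl (iₙ hn, 0) (⟨i - 1, by omega⟩, 0) *
        twoCycles d hn i (by omega)) =
      len (reflections d n) (cornerRefl d hn * refl (iₙ hn, 0) (⟨i - 1, by omega⟩, 0)) +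
        len (reflections d n) (twoCycles d hn i (by omega)) := by
  obtain ⟨h1, h2, h3, -⟩ := twoCycles_len (d := d) hd hn hi hi'
  unfold lg at *
  omega

include hn in
theorem DPiece_isSymPart {i : ℕ} (hi : 3 ≤ i) (hi' : i + 1 ≤ n) :
    IsSymPart n (DPiece d n i) := by
  obtain ⟨h1, h2, h3, h4⟩ := twoCycles_len (d := d) hd hn hi hi'
  rw [DPiece_eq hd hn hi hi']
  refine translate_isSymPart (isReflSystem d n) (DPiece_reduced hd hn hi hi') h4 ?_
  unfold lg at *
  omega

include hn in
theorem nonempty_DPiece_orderIso {i : ℕ} (hi : 3 ≤ i) (hi' : i + 1 ≤ n) :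
    Nonempty (↥(DPiece d n i) ≃o NCA (i - 2) × NCA (n - i)) := by
  obtain ⟨h1, h2, h3, h4⟩ := twoCycles_len (d := d) hd hn hi hi'
  rw [DPiece_eq hd hn hi hi']
  obtain ⟨f⟩ := nonempty_translate_orderIso (isReflSystem d n) (DPiece_reduced hd hn hi hi') h4
  obtain ⟨g⟩ := nonempty_nc_twoCycles (d := d) hd hn hi hi'
  exact ⟨f.trans g⟩

omit [NeZero d] hd in
theorem eq_of_mem_DPiece {i j : ℕ} {u : NCD d n} (hi : u ∈ DPiece d n i)
    (hj : u ∈ DPiece d n j) : i = j := by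
  obtain ⟨-, a, b, ha, hb, h⟩ := hi
  obtain ⟨-, a', b', ha', hb', h'⟩ := hj
  obtain rfl : a = a' := Fin.ext (by omega)
  rw [h] at h'
  rw [← hb, ← hb', show b = b' from (Prod.ext_iff.1 h').1]

theorem mem_E₁_or_E₂_or_DPiece {u : NCD d n} (hu : u ∈ R d n n (-1)) :
    u ∈ E₁ d n hn ∨ u ∈ E₂ d n hn ∨ ∃ i, 3 ≤ i ∧ i + 1 ≤ n ∧ u ∈ DPiece d n i := by
  obtain ⟨y, hy, hu⟩ := (mem_R_last_iff hd hn).1 hu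
  obtain ⟨h1, h2⟩ := outerCycle_section hd hn hy
  obtain ⟨j, hj⟩ : ∃ j, (y.1 (iₙ hn, 0)).1 = j := ⟨_, rfl⟩
  have hyj : y.1 (iₙ hn, 0) = (j, 0) := Prod.ext hj h2
  rw [hj] at h1
  have h0 : (j : ℕ) ≠ 0 := fun h => h1 (Fin.ext h)
  by_cases hl : j = iₙ hn
  · exact Or.inl (mem_E₁_of_fix hd hn hy hu (by rw [hyj, hl]))
  by_cases ho : j = i₁ hn
  · exact Or.inr (Or.inl (mem_E₂_of_apply hd hn hy hu (by rw [hyj, ho])))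
  have hl' : (j : ℕ) ≠ n - 1 := fun h => hl (Fin.ext h)
  have ho' : (j : ℕ) ≠ 1 := fun h => ho (Fin.ext h)
  have := j.2
  exact Or.inr (Or.inr ⟨j + 1, by omega, by omega,
    (mem_DPiece_iff_exists hd hn (by omega) (by omega)).2 ⟨y, hy, hu, hyj⟩⟩)

theorem iUnion_DPiece : (⋃ i : Finset.Icc 3 (n - 1), DPiece d n i) = D d n hn := by
  ext u
  rw [Set.mem_iUnion]
  constructor
  · rintro ⟨⟨i, hi⟩, hu⟩
    rw [Finset.mem_Icc] at hi
    refine ⟨hu.1, ?_⟩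
    have h := ((mem_DPiece_iff hn hi.1 (by omega)).1 hu).2
    rintro (h' | h')
    · have := (E₁_apply hd hn h').2
      rw [h, Prod.ext_iff, Fin.ext_iff] at this
      simp only at this
      omega
    · have := (E₂_apply hd hn h').2
      rw [h, Prod.ext_iff, Fin.ext_iff] at this
      simp only at this
      omega
  · rintro ⟨hu, h⟩
    obtain h' | h' | ⟨i, h1, h2, hi⟩ := mem_E₁_or_E₂_or_DPiece hd hn hu
    · exact absurd (Or.inl h') h
    · exact absurd (Or.inr h') h
    · exact ⟨⟨i, Finset.mem_Icc.2 ⟨h1, by omega⟩⟩, hi⟩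

/-- The set `D` is convex. -/
theorem mem_D_of_le_of_le {p v q : NCD d n} (hp : p ∈ D d n hn) (hq : q ∈ D d n hn)
    (hpv : p ≤ v) (hvq : v ≤ q) : v ∈ D d n hn := by
  have hT := isReflSystem d n
  have hr := (isCut_top (d := d) hd hn (-1)).reduced
  have hv : v ∈ R d n n (-1) := by
    have hp' := hp.1
    have hq' := hq.1
    rw [R_eq_translate hn (by omega) le_rfl (isCut_top hd hn (-1))] at hp' hq' ⊢
    exact mem_translate_of_le_of_le hT hr hp' hq' hpv hvq
  rw [← iUnion_DPiece hd hn, Set.mem_iUnion] at hp hq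
  obtain ⟨⟨i, hi⟩, hp⟩ := hp
  obtain ⟨⟨k, hk⟩, hq⟩ := hq
  rw [Finset.mem_Icc] at hi hk
  obtain ⟨y, hy, hyp, hyi⟩ := (mem_DPiece_iff_exists hd hn hi.1 (by omega)).1 hp
  obtain ⟨z, hz, hzq, hzk⟩ := (mem_DPiece_iff_exists hd hn hk.1 (by omega)).1 hq
  obtain ⟨x, hx, hxv⟩ := (mem_R_last_iff hd hn).1 hv
  have hr' : ∀ {x}, ale x (outerCycle d hn) → len (reflections d n) (cornerRefl d hn * x) =
      len (reflections d n) (cornerRefl d hn) + len (reflections d n) x :=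
    fun hx => hT.len_mul_of_absLE hr hx
  have hyx : ale y x := by
    rw [NC.le_def, hyp, hxv] at hpv
    exact (hT.mul_absLE_mul_iff (hr' hy) (hr' hx)).1 hpv
  have hxz : ale x z := by
    rw [NC.le_def, hxv, hzq] at hvq
    exact (hT.mul_absLE_mul_iff (hr' hx) (hr' hz)).1 hvq
  have htop := (isCut_top (d := d) hd hn (-1)).tight_w
  have hxt := (htop.of_ale hx).1
  have hzt := (htop.of_ale hz).1
  have hr0 : ((i₀ hn, 0) : Fin n × ZMod d).1 ≠ ((iₙ hn, -1) : Fin n × ZMod d).1 := i₀_ne_iₙ hn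
  have hxv' : x = cornerRefl d hn * v.1 := by rw [hxv, refl_mul_cancel_left hr0]
  refine ⟨hv, ?_⟩
  rintro (h | h)
  -- If v were in E₁, then x and hence the smaller y would fix n, but y maps n to i.
  · have h1 := (E₁_apply hd hn h).2
    have h2 : x.1 (iₙ hn, 0) = (iₙ hn, 0) := by
      rw [hxv', G.mul_apply, h1, refl_apply (x := (i₀ hn, 0)) (y := (iₙ hn, -1)) hr0]
      simp
    have h3 := hxt.fix_of_ale hyx h2
    rw [hyi, Prod.ext_iff, Fin.ext_iff] at h3
    simp only at h3
    omega
  -- If v were in E₂, then x would map n to 2. But z = ((n k)) w preserves {2, …, k-1}, which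
  -- contains 2 and not n; so the smaller x cannot lead from n into it.
  · have h1 := (E₂_apply hd hn h).2
    have h2 : x.1 (iₙ hn, 0) = (i₁ hn, 0) := by
      rw [hxv', G.mul_apply, h1, cornerRefl_of_ne hn (i₀_ne_i₁ hn).symm (i₁_ne_iₙ hn)]
    have hcut := isCut_twoCycles (d := d) hd hn hk.1 (by omega)
    obtain ⟨w, hw, rfl⟩ := (hcut.ale_and_apply_iff z).1 ⟨hz, hzk⟩
    have hB : ∀ m ∈ {m : Fin n | 1 ≤ (m : ℕ) ∧ (m : ℕ) + 1 < k},
        ((refl (iₙ hn, 0) (⟨k - 1, by omega⟩, 0) * w).1 (m, (0 : Fin n → ZMod d) m)).1 ∈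
          {m : Fin n | 1 ≤ (m : ℕ) ∧ (m : ℕ) + 1 < k} ∧
        ((refl (iₙ hn, 0) (⟨k - 1, by omega⟩, 0) * w).1 (m, (0 : Fin n → ZMod d) m)).2 =
          (0 : Fin n → ZMod d)
            ((refl (iₙ hn, 0) (⟨k - 1, by omega⟩, 0) * w).1 (m, (0 : Fin n → ZMod d) m)).1 := by
      intro m hm
      have h5 := hcut.tight_w.section_of_ale hw (B := {m : Fin n | 1 ≤ (m : ℕ) ∧ (m : ℕ) + 1 < k})
        (c := 0) (fun m hm => twoCycles_inner hn hk.1 (by omega) hm.1 hm.2) hm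
      obtain ⟨⟨h6, h7⟩, h8⟩ := h5
      have h9 : (refl (iₙ hn, 0) (⟨k - 1, by omega⟩, 0) * w).1 (m, 0) = w.1 (m, 0) := by
        rw [G.mul_apply]
        refine refl_of_ne hcut.ne ?_ ?_
        · intro h; simp only [Pi.zero_apply] at h7; rw [h] at h7; simp only at h7; omega
        · intro h; simp only [Pi.zero_apply] at h7; rw [h] at h7; simp only at h7; omega
      simp only [Pi.zero_apply, h9]
      exact ⟨⟨h6, h7⟩, h8⟩
    have h10 := hzt.not_mem_of_ale hxz hB (k := iₙ hn) (fun h => by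
      have := h.2; simp only at this; omega)
    rw [h2] at h10
    exact h10 ⟨le_rfl, by simp only; omega⟩

/-- An element of `D` that lies above all minimal elements of `D`. -/
theorem exists_pivot (h4 : 4 ≤ n) : ∃ y : G d n, ale y (outerCycle d hn) ∧
    y.1 (iₙ hn, 0) = (⟨2, by omega⟩, 0) ∧
    ∀ i (hi : 3 ≤ i) (hi' : i + 1 ≤ n), ale (refl (iₙ hn, 0) (⟨i - 1, by omega⟩, 0)) y := by
  have hT := isReflSystem d n
  have hne : ((i₁ hn, 0) : Fin n × ZMod d).1 ≠ ((⟨2, by omega⟩, 0) : Fin n × ZMod d).1 := by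
    simp
  have hl2 : iₙ hn ≠ ((⟨2, by omega⟩, 0) : Fin n × ZMod d).1 := by
    simp only [ne_eq, Fin.mk.injEq]; omega
  have hl1 : iₙ hn ≠ ((i₁ hn, 0) : Fin n × ZMod d).1 := (i₁_ne_iₙ hn).symm
  have hc1 : (outerCycle d hn).1 (i₁ hn, 0) = (⟨2, by omega⟩, 0) :=
    cutGamma_lt hn _ _ le_rfl (by omega) (by omega) (by omega) 0
  have h1 := lg_refl_mul_of_apply (k := i₁ hn) hne hc1
  have h2 := lg_refl hne
  have hlast : (refl (i₁ hn, 0) (⟨2, by omega⟩, 0) * outerCycle d hn).1 (iₙ hn, 0) =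
      (⟨2, by omega⟩, 0) := by
    rw [G.mul_apply, outerCycle_last, refl_left hne]
  -- The witness is the cycle (3 4 … n), obtained from (2 3 … n) by cutting out 2.
  refine ⟨refl (i₁ hn, 0) (⟨2, by omega⟩, 0) * outerCycle d hn, ?_, hlast, ?_⟩
  · have h3 := hT.absLE_mul_right (a := refl (i₁ hn, 0) (⟨2, by omega⟩, 0))
      (b := refl (i₁ hn, 0) (⟨2, by omega⟩, 0) * outerCycle d hn) ?_
    · rwa [refl_mul_cancel_left hne] at h3
    · rw [refl_mul_cancel_left hne]
      unfold lg at *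
      omega
  · intro i hi hi'
    have hcut : IsCut (outerCycle d hn) (iₙ hn) (⟨i - 1, by omega⟩, 0) (i₁ hn, 0) _ :=
      isCut_twoCycles hd hn hi hi'
    have hnr : ((iₙ hn, 0) : Fin n × ZMod d).1 ≠ ((⟨i - 1, by omega⟩, 0) : Fin n × ZMod d).1 :=
      hcut.ne
    refine hT.absLE_of_len_add_le (refl_mul_cancel_left hnr _) ?_
    have h3 := lg_refl hnr
    suffices h : lg (refl (iₙ hn, 0) (⟨i - 1, by omega⟩, 0) *
        (refl (i₁ hn, 0) (⟨2, by omega⟩, 0) * outerCycle d hn)) + 1 =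
        lg (refl (i₁ hn, 0) (⟨2, by omega⟩, 0) * outerCycle d hn) by
      unfold lg at *
      omega
    by_cases h : i = 3
    · subst h
      exact lg_refl_mul_of_apply hl2 hlast
    -- For i > 3 the reflections ((n i)) and ((2 3)) commute, so 2 can equally be cut out after the
    -- multiplication by ((n i)).
    · have h5 : (refl (iₙ hn, 0) (⟨i - 1, by omega⟩, 0) * outerCycle d hn).1 (i₁ hn, 0) =
          (⟨2, by omega⟩, 0) := by
        rw [G.mul_apply, hc1]
        refine refl_of_ne hnr hl2.symm ?_
        simp only [ne_eq, Fin.mk.injEq]; omega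
      have h6 := lg_refl_mul_of_apply (k := i₁ hn) hne h5
      have h7 := hcut.lg_mid
      have h8 := hcut.lg_eq
      rw [← mul_assoc, refl_commute (x := (i₁ hn, 0)) (y := (⟨2, by omega⟩, 0)) hnr hne hl1.symm ?_
        hl2.symm ?_, mul_assoc]
      · omega
      · simp only [ne_eq, Fin.mk.injEq]; omega
      · simp only [ne_eq, Fin.mk.injEq]; omega

theorem D_isSymPart : IsSymPart n (D d n hn) := by
  have hT := isReflSystem d n
  have hI : ∀ i : Finset.Icc 3 (n - 1), 3 ≤ (i : ℕ) ∧ (i : ℕ) + 1 ≤ n := by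
    rintro ⟨i, hi⟩
    rw [Finset.mem_Icc] at hi
    exact ⟨hi.1, by simp only; omega⟩
  have hL := fun i => twoCycles_len (d := d) hd hn (hI i).1 (hI i).2
  have hR := fun i => DPiece_reduced (d := d) hd hn (hI i).1 (hI i).2
  have hE := fun i => DPiece_eq (d := d) hd hn (hI i).1 (hI i).2
  have hS : IsSaturated (⋃ i : Finset.Icc 3 (n - 1), DPiece d n i) := by
    rw [iUnion_DPiece hd hn]
    intro p hp q hq hpq hl
    obtain ⟨z, h1, h2, h3⟩ := hT.nc_exists_between hpq (k := len (reflections d n) p.1 + 1)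
      (by omega) (by omega)
    exact ⟨z, mem_D_of_le_of_le hd hn hp hq h1 h2, h1, h2, by omega, by omega⟩
  obtain ⟨p, hp⟩ : ∃ p : NCD d n, ∀ i : Finset.Icc 3 (n - 1),
      p ∈ (⋃ i : Finset.Icc 3 (n - 1), DPiece d n i) ∧
      AbsLE (reflections d n)
        (cornerRefl d hn * refl (iₙ hn, 0) (⟨i - 1, by have := hI i; omega⟩, 0)) p.1 := by
    by_cases h4 : 4 ≤ n
    · obtain ⟨y, hy, hl, h⟩ := exists_pivot (d := d) hd hn h4
      refine ⟨NC.of hT (cornerRefl_mul_ale hd hn hy), fun i => ⟨?_, ?_⟩⟩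
      · exact Set.mem_iUnion.2 ⟨⟨3, Finset.mem_Icc.2 ⟨le_rfl, by omega⟩⟩,
          (mem_DPiece_iff_exists hd hn le_rfl (by omega)).2 ⟨y, hy, rfl, hl⟩⟩
      · exact hT.mul_absLE_mul (hT.len_mul_of_absLE (isCut_top hd hn (-1)).reduced hy)
          (h i (hI i).1 (hI i).2)
    -- For n = 3 there are no pieces and D is empty.
    · exact ⟨NC.of hT (hT.one_absLE _), fun i => by have := hI i; omega⟩
  rw [← iUnion_DPiece hd hn]
  refine isSymPart_iUnion hT (m := 2) (m' := n - 2)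
    (a := fun i => NC.of hT ((hT.absLE_mul_iff.2 (hR i)).trans (hL i).2.2.2))
    (b := fun i => NC.of hT (hL i).2.2.2) ?_ ?_ ?_ (fun i => (hL i).1) ?_ (by omega)
    (fun i j u hi hj => Subtype.ext (eq_of_mem_DPiece hi hj)) hp hS
  · intro i
    rw [hE i]
    exact ⟨1, hT.one_absLE _, (mul_one _).symm⟩
  · intro i
    rw [hE i]
    exact ⟨_, AbsLE.refl _ _, rfl⟩
  · intro i u hu
    rw [hE i] at hu
    obtain ⟨y, hy, hu⟩ := hu
    rw [NC.le_def, NC.le_def, hu]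
    exact ⟨hT.absLE_mul_iff.2 (hT.len_mul_of_absLE (hR i) hy), hT.mul_absLE_mul (hR i) hy⟩
  · intro i
    have := (hL i).2.2.1
    change lg _ = _
    exact Nat.eq_sub_of_add_eq this

end PiecesOfD

end GddNC

/-! ### Assembling the decomposition -/

namespace GddNC

/-- What the elements `u` of the part with the given index satisfy: `a` and `s` are the position and
the colour of `u (1^(0))`, and `b` is the position of `u (n^(0))`, counted from `0`. -/
def PartSpec {d n : ℕ} (a b : ℕ) (s : ZMod d) : PartIndex d n → Prop
  | .base => (a = 0 ∨ a = 1) ∧ s = 0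
  | .first i => a + 1 = i ∧ s = 0
  | .last i => a + 1 = i ∧ s = -1
  | .top t => a + 1 = n ∧ s = t
  | .one => (a = 0 ∧ s = 1) ∨ (a + 1 = n ∧ s = -1 ∧ b = 0)
  | .two => (a = 1 ∧ s = -1) ∨ (a + 1 = n ∧ s = -1 ∧ b = 1)

/-- The only inequalities between named colours that are needed are 1 ≠ 0 and -1 ≠ 0, so d = 2,
where 1 = -1, is not exceptional. -/
theorem PartSpec.unique {d n : ℕ} (hd : 2 ≤ d) (hn : 3 ≤ n) {a b : ℕ} {s : ZMod d}
    {p q : PartIndex d n} (hp : PartSpec a b s p) (hq : PartSpec a b s q) : p = q := by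
  have h1 : (1 : ZMod d) ≠ 0 := one_ne_zero_of_two_le hd
  have h2 : (-1 : ZMod d) ≠ 0 := neg_ne_zero.2 h1
  rcases p with _ | ⟨i, hi⟩ | ⟨i, hi⟩ | ⟨t, ht⟩ | _ | _ <;>
  rcases q with _ | ⟨j, hj⟩ | ⟨j, hj⟩ | ⟨r, hr⟩ | _ | _ <;>
  simp only [PartSpec] at * <;>
  grind

/-- The order isomorphism of products given by an order isomorphism of the second factors. -/
def prodOrderIso (α : Type*) {β γ : Type*} [Preorder α] [Preorder β] [Preorder γ] (g : β ≃o γ) :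
    α × β ≃o α × γ where
  toEquiv := Equiv.prodCongr (Equiv.refl α) g.toEquiv
  map_rel_iff' := by simp [Prod.le_def]

section Main

variable {d n : ℕ} [NeZero d] (hd : 2 ≤ d) (hn : 3 ≤ n)

omit [NeZero d] in
theorem apply_eq_of_mem_R {i : ℕ} (h1 : 1 ≤ i) (h2 : i ≤ n) {s : ZMod d} {u : NCD d n}
    (h : u ∈ R d n i s) :
    ((u.1.1 (i₀ hn, 0)).1 : ℕ) + 1 = i ∧ (u.1.1 (i₀ hn, 0)).2 = s := by
  have := (mem_R_iff h1 h2).1 h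
  rw [show u.1.1 (i₀ hn, 0) = _ from this]
  exact ⟨by simp only; omega, rfl⟩

include hd

theorem partSpec_of_mem {p : PartIndex d n} {u : NCD d n} (h : u ∈ part d n hn p) :
    PartSpec ((u.1.1 (i₀ hn, 0)).1 : ℕ) ((u.1.1 (iₙ hn, 0)).1 : ℕ) (u.1.1 (i₀ hn, 0)).2 p := by
  rcases p with _ | ⟨i, hi⟩ | ⟨i, hi⟩ | ⟨t, ht⟩ | _ | _
  · rcases h with h | h
    · have := apply_eq_of_mem_R hn le_rfl (by omega) h
      exact ⟨Or.inl (by omega), this.2⟩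
    · have := apply_eq_of_mem_R hn (by omega) (by omega) h
      exact ⟨Or.inr (by omega), this.2⟩
  · have := Finset.mem_Icc.1 hi
    exact apply_eq_of_mem_R hn (i := i) (by omega) (by omega) h
  · have := Finset.mem_Icc.1 hi
    exact apply_eq_of_mem_R hn (i := i) (by omega) (by omega) h
  · exact apply_eq_of_mem_R hn (by omega) le_rfl h
  · rcases h with h | h
    · have := apply_eq_of_mem_R hn le_rfl (by omega) h
      exact Or.inl ⟨by omega, this.2⟩
    · have := E₁_apply hd hn h
      rw [this.1, this.2]
      exact Or.inr ⟨by simp only; omega, rfl, rfl⟩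
  · rcases h with h | h
    · have := apply_eq_of_mem_R hn (by omega) (by omega) h
      exact Or.inl ⟨by omega, this.2⟩
    · have := E₂_apply hd hn h
      rw [this.1, this.2]
      exact Or.inr ⟨by simp only; omega, rfl, rfl⟩

theorem pairwise_disjoint_part {p q : PartIndex d n} (hpq : p ≠ q) :
    Disjoint (part d n hn p) (part d n hn q) :=
  Set.disjoint_left.2 fun _ hp hq =>
    hpq (PartSpec.unique hd hn (partSpec_of_mem hd hn hp) (partSpec_of_mem hd hn hq))

theorem disjoint_part_D (p : PartIndex d n) : Disjoint (part d n hn p) (D d n hn) := by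
  refine Set.disjoint_left.2 fun u hp hD => ?_
  have h2 : (-1 : ZMod d) ≠ 0 := neg_ne_zero.2 (one_ne_zero_of_two_le hd)
  obtain ⟨h3, h4⟩ := apply_eq_of_mem_R hn (by omega) le_rfl hD.1
  have hs := partSpec_of_mem hd hn hp
  rcases p with _ | ⟨i, hi⟩ | ⟨i, hi⟩ | ⟨t, ht⟩ | _ | _
  · exact h2 (h4 ▸ hs.2)
  · exact h2 (h4 ▸ hs.2)
  · have := Finset.mem_Icc.1 hi
    have h5 := hs.1
    simp only at h5
    omega
  · exact ht (hs.2.symm.trans h4)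
  · rcases hp with h | h
    · have := apply_eq_of_mem_R hn le_rfl (by omega) h
      omega
    · exact hD.2 (Or.inl h)
  · rcases hp with h | h
    · have := apply_eq_of_mem_R hn (by omega) (by omega) h
      omega
    · exact hD.2 (Or.inr h)

/-- Sorted by the value a^(s) of u at 1^(0). For a = 1 a nonzero colour must be 1; for a strictly
between 1 and n the reflection ((1^(0) a^(s))) lies below u, which leaves the colours 0 and -1. -/
theorem mem_part_or_mem_D (u : NCD d n) : (∃ p, u ∈ part d n hn p) ∨ u ∈ D d n hn := by
  obtain ⟨⟨a, s⟩, h⟩ : ∃ x, u.1.1 (i₀ hn, 0) = x := ⟨_, rfl⟩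
  have hR : u ∈ R d n (a + 1) s := (mem_R_iff (by omega) (by omega)).2 h
  by_cases ha0 : (a : ℕ) = 0
  · rw [ha0] at hR
    by_cases hs : s = 0
    · exact Or.inl ⟨.base, Or.inl (hs ▸ hR)⟩
    · obtain rfl : a = i₀ hn := Fin.ext ha0
      obtain rfl := (color_of_apply_zero hd hn u.2.2 hs h).1
      exact Or.inl ⟨.one, Or.inl hR⟩
  by_cases hal : (a : ℕ) + 1 = n
  · rw [hal] at hR
    by_cases hs : s = -1
    · subst hs
      by_cases h1 : u ∈ E₁ d n hn
      · exact Or.inl ⟨.one, Or.inr h1⟩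
      by_cases h2 : u ∈ E₂ d n hn
      · exact Or.inl ⟨.two, Or.inr h2⟩
      exact Or.inr ⟨hR, fun h => h.elim h1 h2⟩
    · exact Or.inl ⟨.top ⟨s, hs⟩, hR⟩
  have han := a.2
  have hT := isReflSystem d n
  have hne : i₀ hn ≠ a := fun h => ha0 (congrArg Fin.val h).symm
  have hne' : ((i₀ hn, 0) : Fin n × ZMod d).1 ≠ (a, s).1 := hne
  have hs : s = 0 ∨ s = -1 := by
    refine color_of_refl_ale_gamma hd hn (i := a) (by omega) (by omega) ?_
    change ale (refl (i₀ hn, 0) (a, s)) (gamma d n)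
    refine AbsLE.trans ?_ u.2.2
    refine hT.absLE_of_len_add_le (refl_mul_cancel_left hne' u.1) ?_
    have h1 := lg_refl_mul_of_apply (k := i₀ hn) hne h
    have h2 := lg_refl hne'
    unfold lg at *
    omega
  by_cases ha1 : (a : ℕ) = 1
  · rw [ha1] at hR
    rcases hs with rfl | rfl
    · exact Or.inl ⟨.base, Or.inr hR⟩
    · exact Or.inl ⟨.two, Or.inl hR⟩
  have hi : (a : ℕ) + 1 ∈ Finset.Icc 3 (n - 1) := Finset.mem_Icc.2 ⟨by omega, by omega⟩
  rcases hs with rfl | rfl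
  · exact Or.inl ⟨.first ⟨_, hi⟩, hR⟩
  · exact Or.inl ⟨.last ⟨_, hi⟩, hR⟩

omit hd in
theorem IsCut.nonempty_orderIso {k : Fin n} {j j₂ : Fin n × ZMod d} {w : G d n}
    (h : IsCut (gamma d n) k j j₂ w) :
    Nonempty (translate (reflections d n) (gamma d n) (refl (k, 0) j) w ≃o
      NC (reflections d n) w) :=
  nonempty_translate_orderIso (isReflSystem d n) h.reduced h.refl_mul_ale

theorem base_eq : R d n 1 0 ∪ R d n 2 0 =
    translate (reflections d n) (gamma d n) 1 (refl (i₀ hn, 0) (i₁ hn, 0) * gamma d n) ∪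
    translate (reflections d n) (gamma d n) (1 * refl (i₀ hn, 0) (i₁ hn, 0))
      (refl (i₀ hn, 0) (i₁ hn, 0) * gamma d n) := by
  rw [R_one_zero hd hn, R_two_zero hd hn]

theorem D₁_eq : D₁ d n hn =
    translate (reflections d n) (gamma d n) (refl (i₀ hn, 0) (iₙ hn, -1)) (innerCycle d hn) ∪
    translate (reflections d n) (gamma d n)
      (refl (i₀ hn, 0) (iₙ hn, -1) * refl (i₀ hn, 0) (iₙ hn, 0)) (innerCycle d hn) := by
  rw [D₁, R_one_one hd hn, E₁_eq hd hn, Set.union_comm]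

theorem D₂_eq : D₂ d n hn =
    translate (reflections d n) (gamma d n) (refl (i₀ hn, 0) (i₁ hn, -1)) (innerCycle d hn) ∪
    translate (reflections d n) (gamma d n)
      (refl (i₀ hn, 0) (i₁ hn, -1) * refl (i₀ hn, 0) (iₙ hn, -1)) (innerCycle d hn) := by
  rw [D₂, R_two_neg_one hd hn, E₂_eq hd hn]

theorem part_isSymPart (p : PartIndex d n) : IsSymPart n (part d n hn p) := by
  have hT := isReflSystem d n
  have hc := lg_innerCycle (d := d) hd hn
  rcases p with _ | ⟨i, hi⟩ | ⟨i, hi⟩ | ⟨t, ht⟩ | _ | _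
  · rw [part, base_eq hd hn]
    refine (isDoubled_base hd hn).isSymPart hT ?_
    have h1 := lg_refl_mul_gamma (d := d) hd hn
    have h2 := hT.len_one
    unfold lg at *
    omega
  · have := Finset.mem_Icc.1 hi
    have h := isCut_first (d := d) hd hn this.1 (by omega)
    rw [part, R_eq_translate hn (by omega) (by omega) h]
    exact h.isSymPart hd
  · have := Finset.mem_Icc.1 hi
    have h := isCut_neg_one (d := d) hd hn this.1 (by omega)
    rw [part, R_eq_translate hn (by omega) (by omega) h]
    exact h.isSymPart hd
  · have h := isCut_top hd hn t
    rw [part, R_eq_translate hn (by omega) le_rfl h]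
    exact h.isSymPart hd
  · rw [part, D₁_eq hd hn]
    refine (isDoubled_one hd hn).isSymPart hT ?_
    have h1 := lg_refl (x := (i₀ hn, 0)) (y := (iₙ hn, (-1 : ZMod d))) (i₀_ne_iₙ hn)
    unfold lg at *
    omega
  · rw [part, D₂_eq hd hn]
    refine (isDoubled_two hd hn).isSymPart hT ?_
    have h1 := lg_refl (x := (i₀ hn, 0)) (y := (i₁ hn, (-1 : ZMod d))) (i₀_ne_i₁ hn)
    unfold lg at *
    omega

include hn in
theorem isGradedOfRank_NCD : IsGradedOfRank (NCD d n) n := by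
  have h := (isReflSystem d n).isGradedOfRank (gamma d n)
  have h1 := lg_gamma (d := d) (n := n) hd (by omega)
  unfold lg at h1
  rwa [h1] at h

/-- The part `D` may be replaced by the members of a disjoint family with union `D`. -/
theorem isSymmetricDecomposition_part {ι : Type*} {B : ι → Set (NCD d n)}
    (hB : ⋃ i, B i = D d n hn) (hdisj : ∀ i j u, u ∈ B i → u ∈ B j → i = j)
    (hsym : ∀ i, IsSymPart n (B i)) :
    IsSymmetricDecomposition n (Sum.elim (part d n hn) B) := by
  have hsub : ∀ i, B i ⊆ D d n hn := fun i => hB ▸ Set.subset_iUnion B i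
  refine isSymmetricDecomposition_of (isGradedOfRank_NCD hd hn) ?_ ?_ ?_
  · rintro (p | i) (q | j) hpq
    · exact pairwise_disjoint_part hd hn fun h => hpq (congrArg _ h)
    · exact (disjoint_part_D hd hn p).mono_right (hsub j)
    · exact ((disjoint_part_D hd hn q).mono_right (hsub i)).symm
    · exact Set.disjoint_left.2 fun u hi hj => hpq (congrArg _ (hdisj i j u hi hj))
  · intro u
    rcases mem_part_or_mem_D hd hn u with ⟨p, hp⟩ | h
    · exact ⟨.inl p, hp⟩
    · rw [← hB] at h
      obtain ⟨i, hi⟩ := Set.mem_iUnion.1 h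
      exact ⟨.inr i, hi⟩
  · rintro (p | i)
    · exact part_isSymPart hd hn p
    · exact hsym i

end Main

end GddNC

theorem theorem3p11 (d n : ℕ) (hd : 2 ≤ d) (hn : 3 ≤ n) :
    -- `f₁` and `f₂` map into `R_n^(d-1)`, so that `E₁` and `E₂` are contained in it
    (∀ x ∈ R d n 1 1, ∃ y ∈ R d n n (-1), f₁ hn x.1 = y.1) ∧
    (∀ x ∈ R d n 2 (-1), ∃ y ∈ R d n n (-1), f₂ hn x.1 = y.1) ∧
    E₁ d n hn ⊆ R d n n (-1) ∧ E₂ d n hn ⊆ R d n n (-1) ∧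
    -- the decomposition with `D` as one part is symmetric
    IsSymmetricDecomposition n (Sum.elim (part d n hn) fun _ : Unit => D d n hn) ∧
    -- the decomposition with `D` split into its pieces is symmetric
    (⋃ i : Finset.Icc 3 (n - 1), DPiece d n i) = D d n hn ∧
    IsSymmetricDecomposition n
      (Sum.elim (part d n hn) fun i : Finset.Icc 3 (n - 1) => DPiece d n i) ∧
    -- the isomorphism types of the parts
    Nonempty (↥(R d n 1 0 ∪ R d n 2 0) ≃o Fin 2 × NCD d (n - 1)) ∧
    (∀ i ∈ Finset.Icc 3 (n - 1),
      Nonempty (↥(R d n i 0) ≃o NCD d (n - i + 1) × NCA (i - 2)) ∧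
      Nonempty (↥(R d n i (-1)) ≃o NCA (n - i) × NCD d (i - 1))) ∧
    (∀ s : ZMod d, Nonempty (↥(R d n n s) ≃o NCA (n - 1))) ∧
    Nonempty (↥(D₁ d n hn) ≃o Fin 2 × NCA (n - 2)) ∧
    Nonempty (↥(D₂ d n hn) ≃o Fin 2 × NCA (n - 2)) ∧
    (∀ i ∈ Finset.Icc 3 (n - 1),
      Nonempty (↥(DPiece d n i) ≃o NCA (i - 2) × NCA (n - i))) := by
  have : NeZero d := ⟨by omega⟩
  have hT := isReflSystem d n
  refine ⟨?_, ?_, E₁_subset hd hn, E₂_subset hd hn, ?_, iUnion_DPiece hd hn, ?_, ?_, ?_, ?_, ?_, ?_,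
    ?_⟩
  · intro x hx
    obtain ⟨y, hy, hx'⟩ := (R_one_one (d := d) hd hn) ▸ hx
    -- f₁ x is the element t y of the unshifted copy in D₁, and so lies below γ.
    have h := (isDoubled_one (d := d) hd hn).t_absLE hT
      ((isDoubled_one (d := d) hd hn).absLE_rw hT hy)
    have hm : NC.of hT h ∈ E₁ d n hn := ⟨x, hx, by rw [hx', f₁_mul]; rfl⟩
    exact ⟨_, E₁_subset hd hn hm, by rw [hx', f₁_mul]; rfl⟩
  · intro x hx
    obtain ⟨y, hy, hx'⟩ := (R_two_neg_one (d := d) hd hn) ▸ hx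
    -- f₂ x is the element t r y of the shifted copy in D₂.
    have h := (isDoubled_two (d := d) hd hn).t_absLE hT
      ((isDoubled_two (d := d) hd hn).rabsLE_rw hT hy)
    have hm : NC.of hT h ∈ E₂ d n hn := ⟨x, hx, by rw [hx', f₂_mul, mul_assoc]; rfl⟩
    exact ⟨_, E₂_subset hd hn hm, by rw [hx', f₂_mul, mul_assoc]; rfl⟩
  · exact isSymmetricDecomposition_part hd hn (Set.iUnion_const _) (fun _ _ _ _ _ => rfl)
      fun _ => D_isSymPart hd hn
  · refine isSymmetricDecomposition_part hd hn (iUnion_DPiece hd hn)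
      (fun i j u hi hj => Subtype.ext (eq_of_mem_DPiece hi hj)) ?_
    rintro ⟨i, hi⟩
    have := Finset.mem_Icc.1 hi
    exact DPiece_isSymPart hd hn (i := i) this.1 (by omega)
  · rw [base_eq hd hn]
    obtain ⟨f⟩ := (isDoubled_base (d := d) hd hn).nonempty_orderIso hT
    obtain ⟨g⟩ := nonempty_nc_refl_mul_gamma (d := d) hd hn
    exact ⟨f.trans (prodOrderIso _ g)⟩
  · intro i hi
    have hi := Finset.mem_Icc.1 hi
    have hi' : i + 1 ≤ n := by omega
    constructor
    · obtain ⟨f⟩ := (isCut_first (d := d) hd hn hi.1 hi').nonempty_orderIso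
      obtain ⟨g⟩ := nonempty_nc_first (d := d) hd hn hi.1 hi'
      rw [R_eq_translate hn (by omega) (by omega) (isCut_first hd hn hi.1 hi')]
      exact ⟨f.trans g⟩
    · obtain ⟨f⟩ := (isCut_neg_one (d := d) hd hn hi.1 hi').nonempty_orderIso
      obtain ⟨g⟩ := nonempty_nc_neg_one (d := d) hd hn hi.1 hi'
      rw [R_eq_translate hn (by omega) (by omega) (isCut_neg_one hd hn hi.1 hi')]
      exact ⟨f.trans g⟩
  · intro s
    obtain ⟨f⟩ := (isCut_top hd hn s).nonempty_orderIso
    obtain ⟨g⟩ := nonempty_nc_top hd hn s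
    rw [R_eq_translate hn (by omega) le_rfl (isCut_top hd hn s)]
    exact ⟨f.trans g⟩
  · rw [D₁_eq hd hn]
    obtain ⟨f⟩ := (isDoubled_one (d := d) hd hn).nonempty_orderIso hT
    obtain ⟨g⟩ := nonempty_nc_innerCycle (d := d) hd hn
    exact ⟨f.trans (prodOrderIso _ g)⟩
  · rw [D₂_eq hd hn]
    obtain ⟨f⟩ := (isDoubled_two (d := d) hd hn).nonempty_orderIso hT
    obtain ⟨g⟩ := nonempty_nc_innerCycle (d := d) hd hn
    exact ⟨f.trans (prodOrderIso _ g)⟩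
  · intro i hi
    have hi := Finset.mem_Icc.1 hi
    exact nonempty_DPiece_orderIso hd hn hi.1 (by omega)
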